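/- For a finite simple graph $G=(V,E)$ and a symmetric matrix $B\in\mathbb{C}^{q\times q}$ let $$\hom(G,B)=\sum_{\phi:V\to[q]}\ \prod_{uv\in E}B_{\phi(u)\phi(v)},$$ let $J$ be the all-ones $q\times q$ matrix, and for a symmetric $A\in\mathbb{C}^{q\times q}$ put $H(G;x)=q^{-|V|}\hom(G,J+x(A-J))$. Since $H(G;0)=1$, the function $\log H(G;x)$ (principal branch) is analytic near $x=0$; write $(\log H(G;x))^{[m]}=\sum_{k=0}^m a_kx^k$ for its $m$-th Taylor polynomial at $0$. **Theorem.** Let $q\ge 2$ be an integer. There are a deterministic algorithm and a constant $C$, depending only on $q$, such that the following holds for every symmetric matrix $A\in\mathbb{C}^{q\times q}$ and all integers $n,\Delta,m\ge 1$. On input of $A$, $m$ and an $n$-vertex graph $G$ of maximum degree at most $\Delta$, given in adjacency list format, the algorithm computes the coefficients of $(\log H(G;x))^{[m]}$ in time at most $$C\cdot n\,\Delta\,\bigl(e(q+1)\Delta\bigr)^m m^3 .$$ Here $e$ is Euler's number, and time is the number of steps of a random access machine with unit-cost addition, subtraction and comparison of natural numbers and unit-cost exact addition, subtraction, multiplication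 and division of complex numbers (without branching on complex numbers), which has constant-time access to the number $n$ of vertices, to $m$, to the length and the entries of each adjacency list, and to the entries of $A$. -/

import Mathlib

/-! ### The partition function and Taylor polynomials -/

/-- `hom(G, B) = ∑_{φ : V → [q]} ∏_{uv ∈ E} B_{φ(u) φ(v)}` for a symmetric matrix `B`. -/
noncomputable def homNum {V : Type*} [Fintype V] [DecidableEq V] (G : SimpleGraph V)
    [DecidableRel G.Adj] {q : ℕ} (B : Matrix (Fin q) (Fin q) ℂ) (hB : B.IsSymm) : ℂ :=
  ∑ φ : V → Fin q, ∏ e ∈ G.edgeFinset,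
    Sym2.lift ⟨fun i j => B i j, fun i j => hB.apply j i⟩ (e.map φ)

/-- The all ones matrix `J`. -/
def onesMatrix (q : ℕ) : Matrix (Fin q) (Fin q) ℂ := Matrix.of fun _ _ => 1

theorem interpMatrix_isSymm {q : ℕ} {A : Matrix (Fin q) (Fin q) ℂ} (hA : A.IsSymm) (x : ℂ) :
    (onesMatrix q + x • (A - onesMatrix q)).IsSymm := by
  ext i j
  simp [onesMatrix, hA.apply i j]

/-- `H(G; x) = q^{-|V|} hom(G, J + x (A - J))`. -/
noncomputable def homPoly {V : Type*} [Fintype V] [DecidableEq V] (G : SimpleGraph V)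
    [DecidableRel G.Adj] {q : ℕ} (A : Matrix (Fin q) (Fin q) ℂ) (hA : A.IsSymm) (x : ℂ) : ℂ :=
  ((q : ℂ) ^ Fintype.card V)⁻¹ *
    homNum G (onesMatrix q + x • (A - onesMatrix q)) (interpMatrix_isSymm hA x)

/-- The `m`-th Taylor polynomial at `0`, `f^{[m]} = ∑_{k ≤ m} (f^{(k)}(0) / k!) x^k`. -/
noncomputable def taylorPoly (f : ℂ → ℂ) (m : ℕ) : Polynomial ℂ :=
  ∑ k ∈ Finset.range (m + 1), Polynomial.monomial k (iteratedDeriv k f 0 / (k.factorial : ℂ))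

/-! ### A random access machine with exact complex arithmetic

Programs are deterministic, with loops and recursive procedures. There is a read-only input, a
random access memory of natural numbers, a random access memory of complex numbers, and index
registers which serve as the local variables of a procedure. Every arithmetic operation, memory or
input access, comparison, assignment and procedure call costs one step. On natural numbers the
machine can only add, subtract and compare; on complex numbers it can only add, subtract, multiply
and divide (by something nonzero), and it cannot branch on them. -/

namespace AlgRAM

/-- An input: a graph on the vertices `0, …, n - 1` in adjacency list format, the number `m`, and
the entries of the matrix. -/
structure Input (q : ℕ) where
  /-- number of vertices -/
  n : ℕ
  /-- the list of neighbours of each vertex -/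
  nbrs : Fin n → List (Fin n)
  /-- the order of the Taylor polynomial that is asked for -/
  m : ℕ
  /-- the matrix -/
  A : Matrix (Fin q) (Fin q) ℂ

/-- `nbrs` is an adjacency list representation of `G`: the list of `u` contains every neighbour
of `u` exactly once, in any order, and nothing else. -/
def IsAdjList {n : ℕ} (G : SimpleGraph (Fin n)) (nbrs : Fin n → List (Fin n)) : Prop :=
  ∀ u, (nbrs u).Nodup ∧ ∀ v, v ∈ nbrs u ↔ G.Adj u v

/-- The contents of the registers and of the two memories. -/
structure State where
  /-- index registers -/
  reg : ℕ → ℕ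
  /-- memory of natural numbers -/
  mem : ℕ → ℕ
  /-- memory of complex numbers -/
  fld : ℕ → ℂ

/-- At the start all registers and memory cells hold `0`. -/
def State.init : State := ⟨fun _ => 0, fun _ => 0, fun _ => 0⟩

/-- Expressions with values in the natural numbers. -/
inductive IExp where
  /-- a constant written in the program -/
  | const (c : ℕ)
  /-- the content of a register -/
  | reg (r : ℕ)
  /-- the content of the memory cell with address `a` -/
  | load (a : IExp)
  /-- sum -/
  | add (a b : IExp)
  /-- truncated difference -/
  | sub (a b : IExp)
  /-- the number of vertices of the input graph -/
  | order
  /-- the input number `m` -/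
  | level
  /-- the length of the adjacency list of vertex `u` -/
  | deg (u : IExp)
  /-- the entry at position `i` (counted from `0`) of the adjacency list of vertex `u` -/
  | nbr (u i : IExp)

/-- The value of an expression (an input access out of range gives `0`). -/
def IExp.eval {q : ℕ} (inp : Input q) (s : State) : IExp → ℕ
  | .const c => c
  | .reg r => s.reg r
  | .load a => s.mem (a.eval inp s)
  | .add a b => a.eval inp s + b.eval inp s
  | .sub a b => a.eval inp s - b.eval inp s
  | .order => inp.n
  | .level => inp.m
  | .deg u => if h : u.eval inp s < inp.n then (inp.nbrs ⟨u.eval inp s, h⟩).length else 0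
  | .nbr u i =>
      if h : u.eval inp s < inp.n then
        (((inp.nbrs ⟨u.eval inp s, h⟩).map Fin.val)[i.eval inp s]?).getD 0
      else 0

/-- The number of steps needed to evaluate an expression. -/
def IExp.cost : IExp → ℕ
  | .const _ => 1
  | .reg _ => 1
  | .load a => a.cost + 1
  | .add a b => a.cost + b.cost + 1
  | .sub a b => a.cost + b.cost + 1
  | .order => 1
  | .level => 1
  | .deg u => u.cost + 1
  | .nbr u i => u.cost + i.cost + 1

/-- Tests on natural numbers. -/
inductive BExp where
  | lt (a b : IExp)
  | eq (a b : IExp)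
  | not (b : BExp)
  | and (b c : BExp)

/-- The truth value of a test. -/
def BExp.eval {q : ℕ} (inp : Input q) (s : State) : BExp → Bool
  | .lt a b => decide (a.eval inp s < b.eval inp s)
  | .eq a b => decide (a.eval inp s = b.eval inp s)
  | .not b => !(b.eval inp s)
  | .and b c => b.eval inp s && c.eval inp s

/-- The number of steps needed to evaluate a test. -/
def BExp.cost : BExp → ℕ
  | .lt a b => a.cost + b.cost + 1
  | .eq a b => a.cost + b.cost + 1
  | .not b => b.cost + 1
  | .and b c => b.cost + c.cost + 1

/-- Expressions with values in the complex numbers. -/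
inductive FExp where
  | zero
  | one
  /-- the entry `(i, j)` (counted from `0`) of the input matrix -/
  | entry (i j : IExp)
  /-- the content of the complex memory cell with address `a` -/
  | load (a : IExp)
  | add (a b : FExp)
  | sub (a b : FExp)
  | mul (a b : FExp)
  | div (a b : FExp)

/-- The value of an expression (a matrix access out of range gives `0`). -/
noncomputable def FExp.eval {q : ℕ} (inp : Input q) (s : State) : FExp → ℂ
  | .zero => 0
  | .one => 1
  | .entry i j =>
      if h : i.eval inp s < q ∧ j.eval inp s < q then
        inp.A ⟨i.eval inp s, h.1⟩ ⟨j.eval inp s, h.2⟩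
      else 0
  | .load a => s.fld (a.eval inp s)
  | .add a b => a.eval inp s + b.eval inp s
  | .sub a b => a.eval inp s - b.eval inp s
  | .mul a b => a.eval inp s * b.eval inp s
  | .div a b => a.eval inp s / b.eval inp s

/-- No division by zero occurs in the evaluation of the expression. -/
def FExp.Defined {q : ℕ} (inp : Input q) (s : State) : FExp → Prop
  | .zero => True
  | .one => True
  | .entry _ _ => True
  | .load _ => True
  | .add a b => a.Defined inp s ∧ b.Defined inp s
  | .sub a b => a.Defined inp s ∧ b.Defined inp s
  | .mul a b => a.Defined inp s ∧ b.Defined inp s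
  | .div a b => a.Defined inp s ∧ b.Defined inp s ∧ b.eval inp s ≠ 0

/-- The number of steps needed to evaluate an expression. -/
def FExp.cost : FExp → ℕ
  | .zero => 1
  | .one => 1
  | .entry i j => i.cost + j.cost + 1
  | .load a => a.cost + 1
  | .add a b => a.cost + b.cost + 1
  | .sub a b => a.cost + b.cost + 1
  | .mul a b => a.cost + b.cost + 1
  | .div a b => a.cost + b.cost + 1

/-- Statements. -/
inductive Stmt where
  | skip
  /-- assign to a register -/
  | setReg (r : ℕ) (e : IExp)
  /-- write to the cell with address `a` of the memory of natural numbers -/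
  | setMem (a e : IExp)
  /-- write to the cell with address `a` of the memory of complex numbers -/
  | setFld (a : IExp) (e : FExp)
  | seq (c d : Stmt)
  | ite (b : BExp) (c d : Stmt)
  | while (b : BExp) (c : Stmt)
  /-- call procedure number `p` -/
  | call (p : ℕ)

/-- A program: a main statement and finitely many, possibly recursive, procedures. -/
structure Program where
  main : Stmt
  procs : List Stmt

/-- `Exec inp procs c s t s'`: started in state `s`, the statement `c` terminates after exactly
`t` steps, in state `s'`. A procedure starts with the register contents of its caller as arguments,
and the caller finds its own registers unchanged when the procedure returns; both memories are
shared. (Only the finitely many registers named in the program matter, so that this takes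
constant time.) -/
inductive Exec {q : ℕ} (inp : Input q) (procs : List Stmt) :
    Stmt → State → ℕ → State → Prop where
  | skip (s : State) : Exec inp procs .skip s 1 s
  | setReg (r : ℕ) (e : IExp) (s : State) :
      Exec inp procs (.setReg r e) s (e.cost + 1)
        { s with reg := Function.update s.reg r (e.eval inp s) }
  | setMem (a e : IExp) (s : State) :
      Exec inp procs (.setMem a e) s (a.cost + e.cost + 1)
        { s with mem := Function.update s.mem (a.eval inp s) (e.eval inp s) }
  | setFld (a : IExp) (e : FExp) (s : State) (he : e.Defined inp s) :
      Exec inp procs (.setFld a e) s (a.cost + e.cost + 1)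
        { s with fld := Function.update s.fld (a.eval inp s) (e.eval inp s) }
  | seq {c d : Stmt} {s s₁ s₂ : State} {t₁ t₂ : ℕ}
      (h₁ : Exec inp procs c s t₁ s₁) (h₂ : Exec inp procs d s₁ t₂ s₂) :
      Exec inp procs (.seq c d) s (t₁ + t₂) s₂
  | iteTrue {b : BExp} {c d : Stmt} {s s₁ : State} {t : ℕ}
      (hb : b.eval inp s = true) (h : Exec inp procs c s t s₁) :
      Exec inp procs (.ite b c d) s (b.cost + t) s₁
  | iteFalse {b : BExp} {c d : Stmt} {s s₁ : State} {t : ℕ}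
      (hb : b.eval inp s = false) (h : Exec inp procs d s t s₁) :
      Exec inp procs (.ite b c d) s (b.cost + t) s₁
  | whileFalse {b : BExp} {c : Stmt} {s : State} (hb : b.eval inp s = false) :
      Exec inp procs (.while b c) s b.cost s
  | whileTrue {b : BExp} {c : Stmt} {s s₁ s₂ : State} {t₁ t₂ : ℕ}
      (hb : b.eval inp s = true) (h₁ : Exec inp procs c s t₁ s₁)
      (h₂ : Exec inp procs (.while b c) s₁ t₂ s₂) :
      Exec inp procs (.while b c) s (b.cost + t₁ + t₂) s₂
  | call {p : ℕ} {c : Stmt} {s s₁ : State} {t : ℕ}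
      (hp : procs[p]? = some c) (h : Exec inp procs c s t s₁) :
      Exec inp procs (.call p) s (t + 1) { s₁ with reg := s.reg }

/-- The polynomial of degree at most `m` whose coefficients are in the complex memory cells
`0, …, m`. -/
noncomputable def State.outPoly (s : State) (m : ℕ) : Polynomial ℂ :=
  ∑ k ∈ Finset.range (m + 1), Polynomial.monomial k (s.fld k)

/-- On input `inp`, the program `P` halts after exactly `t` steps with output the polynomial `p`
(of degree at most `inp.m`). -/
def Program.Computes {q : ℕ} (P : Program) (inp : Input q) (t : ℕ) (p : Polynomial ℂ) : Prop :=
  ∃ s, Exec inp P.procs P.main State.init t s ∧ s.outPoly inp.m = p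

end AlgRAM

/-! Put $a=A-J$ and give each vertex $v$ weights $w_v(c)\in\mathbb{C}[[X]]$ with constant term
$1/q$. Let $Z_U(w)$ be the partition function of the graph induced on $U$ with these weights and
edge factors $1+Xa_{cc'}$. For $U=V$ and uniform weights it is $H(G;X)$.

Fixing the colour $c$ of $u$ deletes $u$ and turns its edges into factors on the weights of its
neighbours (`partitionAt_eq`). The effect of these factors on $Z_{U\setminus u}$ telescopes if the
neighbours are pinned one at a time: pinning $v$ multiplies the partition function by
$1+X\sum_{c'}a_{cc'}\mu_v(c')$, where $\mu_v$ is the marginal of $v$ for the current weights, with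
$u$ removed (`partition_pin`). The factor $X$ gains one order of accuracy. Starting from the
approximation $w_u$, a recursion of depth $k$ is therefore correct modulo $X^{k+1}$
(`X_pow_dvd_num`). Summed over the colours it gives $Z_U/Z_{U\setminus u}$ (`X_pow_dvd_den`), and
the product of these quotients while the vertices are removed one by one is $H$ modulo $X^{m+1}$
(`Runs.rootLoop`). The logarithm is read off from $XF'/F$ (`taylorPoly_log_eq`).

A call makes at most $q\Delta$ recursive calls. Its other work consists of $O(\Delta)$ operations on
truncated series ($q$ being fixed), each of cost $O(m^2)$, since series are only multiplied or
divided by series of the form $1+Xy$. Weights are pinned in place and restored by exact division, so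
they are never copied for a recursive call. This gives a bound with base $2(q+1)\Delta$
(`margSpec`), and $2\le e$.

Correctness and time are proved together with the Hoare triples `Runs`; `MargSpec` is the contract
proved by induction on the depth. The complex memory consists of blocks of $m+1$ cells: block 0 for
the output, block 1 for the accumulated product, then $q^2$ blocks for $a$, then $q$ blocks per
vertex for the weights, then a stack of frames of $q+2$ blocks (numerators, their sum, one scratch
series). The memory of natural numbers holds the address of the weights of $u$ in cell $u$, and in
cell $n+u$ a flag that is 0 while $u$ is active. -/

/-! ### Partition functions with vertex weights over formal power series -/

namespace PartitionSeries

open PowerSeries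

section

set_option linter.unusedSectionVars false

variable {V : Type*} [Fintype V] [DecidableEq V] {q : ℕ}

/-- The factor `1 + X a_{φ(u) φ(v)}` of an edge `uv`. -/
noncomputable def edgeFactor {a : Matrix (Fin q) (Fin q) ℂ} (ha : a.IsSymm) (φ : V → Fin q)
    (e : Sym2 V) : ℂ⟦X⟧ :=
  Sym2.lift ⟨fun i j => 1 + X * C (a i j), fun i j => by simp only [ha.apply j i]⟩ (e.map φ)

@[simp]
theorem edgeFactor_mk {a : Matrix (Fin q) (Fin q) ℂ} (ha : a.IsSymm) (φ : V → Fin q) (u v : V) :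
    edgeFactor ha φ s(u, v) = 1 + X * C (a (φ u) (φ v)) := rfl

/-- The product of the vertex weights of a colouring; removed vertices have the uniform weight. -/
noncomputable def vertexWeight (U : Finset V) (w : V → Fin q → ℂ⟦X⟧) (φ : V → Fin q) : ℂ⟦X⟧ :=
  ∏ v, if v ∈ U then w v (φ v) else C ((q : ℂ)⁻¹)

/-- The product of the edge factors of a colouring over the edges inside `U`. -/
noncomputable def edgeWeight (G : SimpleGraph V) [DecidableRel G.Adj]
    {a : Matrix (Fin q) (Fin q) ℂ} (ha : a.IsSymm) (U : Finset V) (φ : V → Fin q) : ℂ⟦X⟧ :=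
  ∏ e ∈ G.edgeFinset with (∀ v ∈ e, v ∈ U), edgeFactor ha φ e

/-- The partition function of the graph induced on `U` with vertex weights `w`. -/
noncomputable def partition (G : SimpleGraph V) [DecidableRel G.Adj]
    {a : Matrix (Fin q) (Fin q) ℂ} (ha : a.IsSymm) (U : Finset V) (w : V → Fin q → ℂ⟦X⟧) : ℂ⟦X⟧ :=
  ∑ φ : V → Fin q, vertexWeight U w φ * edgeWeight G ha U φ

/-- The part of the partition function in which `v` has colour `c`. -/
noncomputable def partitionAt (G : SimpleGraph V) [DecidableRel G.Adj]
    {a : Matrix (Fin q) (Fin q) ℂ} (ha : a.IsSymm) (U : Finset V) (w : V → Fin q → ℂ⟦X⟧)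
    (v : V) (c : Fin q) : ℂ⟦X⟧ :=
  ∑ φ : V → Fin q, if φ v = c then vertexWeight U w φ * edgeWeight G ha U φ else 0

/-- The weights after the edge from `v` to a vertex of colour `c` is replaced by a factor. -/
noncomputable def pin (a : Matrix (Fin q) (Fin q) ℂ) (c : Fin q) (v : V) (w : V → Fin q → ℂ⟦X⟧) :
    V → Fin q → ℂ⟦X⟧ :=
  fun v' c' => if v' = v then w v' c' * (1 + X * C (a c c')) else w v' c'

/-- The weights after all edges from vertices of `S` to a vertex of colour `c` are replaced. -/
noncomputable def pinSet (a : Matrix (Fin q) (Fin q) ℂ) (c : Fin q) (S : Finset V)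
    (w : V → Fin q → ℂ⟦X⟧) : V → Fin q → ℂ⟦X⟧ :=
  fun v' c' => w v' c' * if v' ∈ S then 1 + X * C (a c c') else 1

variable (G : SimpleGraph V) [DecidableRel G.Adj] {a : Matrix (Fin q) (Fin q) ℂ} (ha : a.IsSymm)

theorem sum_partitionAt (U : Finset V) (w : V → Fin q → ℂ⟦X⟧) (v : V) :
    ∑ c, partitionAt G ha U w v c = partition G ha U w := by
  unfold partitionAt partition
  rw [Finset.sum_comm]
  simp

/-- Since `F` ignores the colour of `v`, the `q` slices have equal sums. This is why deleted
vertices carry the weight $1/q$: all sums can range over colourings of the whole of `V` instead of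
shrinking vertex sets. -/
theorem sum_filter_eval_eq (v : V) (c : Fin q) (F : (V → Fin q) → ℂ⟦X⟧)
    (hF : ∀ φ d, F (Function.update φ v d) = F φ) :
    (∑ φ : V → Fin q, if φ v = c then F φ else 0) = ∑ φ : V → Fin q, C ((q : ℂ)⁻¹) * F φ := by
  have hq : (q : ℂ) ≠ 0 := by
    have := c.pos
    exact_mod_cast this.ne'
  rw [← Finset.mul_sum, ← (Equiv.funSplitAt v (Fin q)).symm.sum_comp,
    ← (Equiv.funSplitAt v (Fin q)).symm.sum_comp, Fintype.sum_prod_type, Fintype.sum_prod_type]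
  have h : ∀ (d : Fin q) (ψ : {j // j ≠ v} → Fin q),
      F ((Equiv.funSplitAt v (Fin q)).symm (d, ψ)) =
        F ((Equiv.funSplitAt v (Fin q)).symm (c, ψ)) := by
    intro d ψ
    rw [← hF _ c]
    congr 1
    ext j
    by_cases hj : j = v
    · subst hj; simp [Equiv.funSplitAt, Equiv.piSplitAt]
    · simp [Equiv.funSplitAt, Equiv.piSplitAt, hj]
  have h1 : ∀ (d : Fin q) (ψ : {j // j ≠ v} → Fin q),
      (Equiv.funSplitAt v (Fin q)).symm (d, ψ) v = d := by
    intro d ψ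
    simp [Equiv.funSplitAt, Equiv.piSplitAt]
  simp only [h1, h]
  rw [Finset.sum_const, Finset.card_univ, Fintype.card_fin, nsmul_eq_mul, ← mul_assoc]
  have : C ((q : ℂ)⁻¹) * (q : ℂ⟦X⟧) = 1 := by
    rw [show (q : ℂ⟦X⟧) = C (q : ℂ) by simp, ← map_mul, inv_mul_cancel₀ hq, map_one]
  rw [this, one_mul, Finset.sum_comm]
  simp

/-- An edge inside `U` either avoids `v` or is `s(v, u)` for exactly one neighbour `u` in `U`. -/
theorem edgeWeight_eq_mul {U : Finset V} {v : V} (hv : v ∈ U) (φ : V → Fin q) :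
    edgeWeight G ha U φ = edgeWeight G ha (U.erase v) φ *
      ∏ u ∈ (U.erase v).filter (G.Adj v), (1 + X * C (a (φ v) (φ u))) := by
  unfold edgeWeight
  have hinj : Set.InjOn (fun u => s(v, u)) ((U.erase v).filter (G.Adj v) : Finset V) := by
    intro x _ y _ h
    exact Sym2.congr_right.mp h
  have himg : ∏ u ∈ (U.erase v).filter (G.Adj v), (1 + X * C (a (φ v) (φ u))) =
      ∏ e ∈ ((U.erase v).filter (G.Adj v)).image (fun u => s(v, u)), edgeFactor ha φ e := by
    rw [Finset.prod_image hinj]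
    rfl
  rw [himg, ← Finset.prod_union]
  · congr 1
    ext e
    induction e with
    | h x y =>
      simp only [Finset.mem_filter, SimpleGraph.mem_edgeFinset, SimpleGraph.mem_edgeSet,
        Sym2.mem_iff, forall_eq_or_imp, forall_eq, Finset.mem_erase, Finset.mem_union,
        Finset.mem_image, Sym2.eq_iff]
      constructor
      · rintro ⟨hxy, hx, hy⟩
        by_cases h1 : x = v
        · subst h1
          exact Or.inr ⟨y, ⟨⟨hxy.ne', hy⟩, hxy⟩, Or.inl ⟨rfl, rfl⟩⟩
        · by_cases h2 : y = v
          · subst h2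
            exact Or.inr ⟨x, ⟨⟨hxy.ne, hx⟩, hxy.symm⟩, Or.inr ⟨rfl, rfl⟩⟩
          · exact Or.inl ⟨hxy, ⟨h1, hx⟩, ⟨h2, hy⟩⟩
      · rintro (⟨hxy, hx, hy⟩ | ⟨z, ⟨⟨-, hz⟩, hvz⟩, ⟨rfl, rfl⟩ | ⟨rfl, rfl⟩⟩)
        · exact ⟨hxy, hx.2, hy.2⟩
        · exact ⟨hvz, hv, hz⟩
        · exact ⟨hvz.symm, hz, hv⟩
  · rw [Finset.disjoint_left]
    intro e he he'
    simp only [Finset.mem_image] at he'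
    obtain ⟨u, -, rfl⟩ := he'
    have := (Finset.mem_filter.mp he).2 v (by simp)
    simp at this

/-- Once `v` has colour `c`, each edge at `v` contributes a factor that depends on the colour of its
other end only, and so can be absorbed into the weight there. -/
theorem partitionAt_eq {U : Finset V} {v : V} (hv : v ∈ U) (w : V → Fin q → ℂ⟦X⟧) (c : Fin q) :
    partitionAt G ha U w v c = w v c *
      partition G ha (U.erase v) (pinSet a c ((U.erase v).filter (G.Adj v)) w) := by
  unfold partitionAt partition
  set w' := pinSet a c ((U.erase v).filter (G.Adj v)) w with hw'
  -- The summand without the factor of `v`; it does not depend on `φ v`.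
  let F : (V → Fin q) → ℂ⟦X⟧ := fun φ =>
    (∏ u ∈ Finset.univ.erase v, if u ∈ U.erase v then w' u (φ u) else C ((q : ℂ)⁻¹)) *
      edgeWeight G ha (U.erase v) φ
  have hF : ∀ φ d, F (Function.update φ v d) = F φ := by
    intro φ d
    simp only [F]
    congr 1
    · refine Finset.prod_congr rfl fun u hu => ?_
      rw [Function.update_of_ne (Finset.ne_of_mem_erase hu)]
    · unfold edgeWeight
      refine Finset.prod_congr rfl fun e he => ?_
      have he2 := (Finset.mem_filter.mp he).2
      induction e with
      | h x y =>
        have hx := Finset.ne_of_mem_erase (he2 x (by simp))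
        have hy := Finset.ne_of_mem_erase (he2 y (by simp))
        simp [Function.update_of_ne hx, Function.update_of_ne hy]
  have hL : ∀ φ : V → Fin q, (if φ v = c then vertexWeight U w φ * edgeWeight G ha U φ else 0) =
      w v c * (if φ v = c then F φ else 0) := by
    intro φ
    split_ifs with h
    · rw [edgeWeight_eq_mul G ha hv, vertexWeight, ← Finset.mul_prod_erase _ _ (Finset.mem_univ v),
        if_pos hv, h]
      have : (∏ u ∈ Finset.univ.erase v, if u ∈ U.erase v then w' u (φ u) else C ((q : ℂ)⁻¹)) =
          (∏ u ∈ Finset.univ.erase v, if u ∈ U then w u (φ u) else C ((q : ℂ)⁻¹)) *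
            ∏ u ∈ (U.erase v).filter (G.Adj v), (1 + X * C (a c (φ u))) := by
        have hsub : (U.erase v).filter (G.Adj v) =
            (Finset.univ.erase v).filter (fun u => u ∈ (U.erase v).filter (G.Adj v)) := by
          ext u
          simp only [Finset.mem_filter, Finset.mem_erase, Finset.mem_univ]
          tauto
        conv_rhs => rw [hsub, Finset.prod_filter]
        rw [← Finset.prod_mul_distrib]
        refine Finset.prod_congr rfl fun u hu => ?_
        have hu' := Finset.ne_of_mem_erase hu
        by_cases huU : u ∈ U
        · simp [hw', pinSet, huU, hu']
        · simp [huU]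
      simp only [F]
      rw [this]
      ring
    · simp
  simp only [hL]
  rw [← Finset.mul_sum, sum_filter_eval_eq v c F hF]
  congr 1
  refine Finset.sum_congr rfl fun φ _ => ?_
  simp only [F]
  rw [vertexWeight, ← Finset.mul_prod_erase Finset.univ _ (Finset.mem_univ v)]
  simp [mul_assoc]

/-- Pinning changes a colouring's weight by a factor that depends on `φ v` only, so one groups by `φ
v`. Divided by `partition G ha U w`, the right side is $1+X\sum a_{cc'}\mu_v(c')$. -/
theorem partition_pin {U : Finset V} {v : V} (hv : v ∈ U) (w : V → Fin q → ℂ⟦X⟧) (c : Fin q) :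
    partition G ha U (pin a c v w) =
      ∑ c', partitionAt G ha U w v c' * (1 + X * C (a c c')) := by
  unfold partitionAt partition
  simp only [Finset.sum_mul]
  rw [Finset.sum_comm]
  refine Finset.sum_congr rfl fun φ _ => ?_
  simp only [ite_mul, zero_mul, Finset.sum_ite_eq, Finset.mem_univ, if_true]
  have : vertexWeight U (pin a c v w) φ = vertexWeight U w φ * (1 + X * C (a c (φ v))) := by
    unfold vertexWeight
    rw [← Finset.mul_prod_erase Finset.univ _ (Finset.mem_univ v),
      ← Finset.mul_prod_erase Finset.univ (fun u => if u ∈ U then w u (φ u) else _)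
        (Finset.mem_univ v)]
    have h : (∏ u ∈ Finset.univ.erase v, if u ∈ U then pin a c v w u (φ u) else C ((q : ℂ)⁻¹)) =
        ∏ u ∈ Finset.univ.erase v, if u ∈ U then w u (φ u) else C ((q : ℂ)⁻¹) := by
      refine Finset.prod_congr rfl fun u hu => ?_
      simp [pin, Finset.ne_of_mem_erase hu]
    rw [h]
    simp only [hv, if_true, pin]
    ring
  rw [this]
  ring

variable {G ha}

/-- At $X=0$ the edge factors are 1 and each of the $q^{|V|}$ colourings has weight $q^{-|V|}$. -/
theorem constantCoeff_partition (hq : q ≠ 0) (U : Finset V) (w : V → Fin q → ℂ⟦X⟧)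
    (hw : ∀ v c, constantCoeff (w v c) = (q : ℂ)⁻¹) : constantCoeff (partition G ha U w) = 1 := by
  have hq' : (q : ℂ) ≠ 0 := by exact_mod_cast hq
  have h1 : ∀ φ, constantCoeff (vertexWeight U w φ) = ((q : ℂ)⁻¹) ^ Fintype.card V := by
    intro φ
    rw [vertexWeight, map_prod, ← Finset.card_univ, ← Finset.prod_const]
    refine Finset.prod_congr rfl fun u _ => ?_
    split_ifs <;> simp [hw]
  have h2 : ∀ φ, constantCoeff (edgeWeight G ha U φ) = 1 := by
    intro φ
    rw [edgeWeight, map_prod]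
    refine Finset.prod_eq_one fun e _ => ?_
    induction e with
    | h x y => simp
  rw [partition, map_sum]
  simp only [map_mul, h1, h2, Finset.sum_const, Finset.card_univ, Fintype.card_fun,
    Fintype.card_fin, nsmul_eq_mul, mul_one, inv_pow]
  push_cast
  exact mul_inv_cancel₀ (pow_ne_zero _ hq')

theorem partition_empty (hq : q ≠ 0) (w : V → Fin q → ℂ⟦X⟧) : partition G ha ∅ w = 1 := by
  have hq' : (q : ℂ) ≠ 0 := by exact_mod_cast hq
  have h2 : ∀ φ, edgeWeight G ha ∅ φ = 1 := by
    intro φ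
    rw [edgeWeight]
    refine Finset.prod_eq_one fun e he => ?_
    induction e with
    | h x y => exact absurd ((Finset.mem_filter.mp he).2 x (by simp)) (Finset.notMem_empty x)
  simp only [partition, h2, vertexWeight]
  simp only [Finset.notMem_empty, if_false, Finset.prod_const, Finset.sum_const, Finset.card_univ,
    Fintype.card_fun, Fintype.card_fin, nsmul_eq_mul, mul_one]
  rw [← map_pow, show ((q ^ Fintype.card V : ℕ) : ℂ⟦X⟧) = C ((q ^ Fintype.card V : ℕ) : ℂ) by simp,
    ← map_mul]
  push_cast
  rw [inv_pow, mul_inv_cancel₀ (pow_ne_zero _ hq'), map_one]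

/-! ### Approximate marginals -/

/-- One step along an adjacency list: if `v` is active, multiply the accumulated ratio by
`1 + X ∑ a_{c c'} M_{c'}`, where `M` is the approximate marginal at `v`, and pin `v`. -/
noncomputable def scanStep (a : Matrix (Fin q) (Fin q) ℂ)
    (M : (V → Fin q → ℂ⟦X⟧) → V → Fin q → ℂ⟦X⟧) (U : Finset V) (c : Fin q)
    (p : ℂ⟦X⟧ × (V → Fin q → ℂ⟦X⟧)) (v : V) : ℂ⟦X⟧ × (V → Fin q → ℂ⟦X⟧) :=
  if v ∈ U then (p.1 * (1 + X * ∑ c', C (a c c') * M p.2 v c'), pin a c v p.2) else p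

/-- The unnormalised approximate marginals of `u`, computed by a recursion of depth `k`. -/
noncomputable def num (a : Matrix (Fin q) (Fin q) ℂ) (nbrs : V → List V) :
    ℕ → Finset V → (V → Fin q → ℂ⟦X⟧) → V → Fin q → ℂ⟦X⟧
  | 0, _, w, u, c => w u c
  | k + 1, U, w, u, c =>
      ((nbrs u).foldl (scanStep a (fun w' v c' => num a nbrs k (U.erase u) w' v c' *
        (∑ d, num a nbrs k (U.erase u) w' v d)⁻¹) (U.erase u) c) (w u c, w)).1

/-- The normalising factor of the approximate marginals. -/
noncomputable def den (a : Matrix (Fin q) (Fin q) ℂ) (nbrs : V → List V) (k : ℕ) (U : Finset V)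
    (w : V → Fin q → ℂ⟦X⟧) (u : V) : ℂ⟦X⟧ :=
  ∑ d, num a nbrs k U w u d

/-- The approximate marginals. -/
noncomputable def marg (a : Matrix (Fin q) (Fin q) ℂ) (nbrs : V → List V) (k : ℕ) (U : Finset V)
    (w : V → Fin q → ℂ⟦X⟧) (u : V) (c : Fin q) : ℂ⟦X⟧ :=
  num a nbrs k U w u c * (den a nbrs k U w u)⁻¹

/-- The recursion in `num` has to spell out the normalised marginals because `marg` is itself
defined from `num`; this form is the one used afterwards. -/
theorem num_succ (nbrs : V → List V) (k : ℕ) (U : Finset V) (w : V → Fin q → ℂ⟦X⟧) (u : V)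
    (c : Fin q) : num a nbrs (k + 1) U w u c =
      ((nbrs u).foldl (scanStep a (marg a nbrs k (U.erase u)) (U.erase u) c) (w u c, w)).1 := rfl

/-- The weights after pinning the active vertices of a list. -/
noncomputable def pinList (a : Matrix (Fin q) (Fin q) ℂ) (U : Finset V) (c : Fin q) (l : List V)
    (w : V → Fin q → ℂ⟦X⟧) : V → Fin q → ℂ⟦X⟧ :=
  l.foldl (fun w v => if v ∈ U then pin a c v w else w) w

theorem foldl_scanStep_snd (M : (V → Fin q → ℂ⟦X⟧) → V → Fin q → ℂ⟦X⟧) (U : Finset V)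
    (c : Fin q) (l : List V) (p : ℂ⟦X⟧ × (V → Fin q → ℂ⟦X⟧)) :
    (l.foldl (scanStep a M U c) p).2 = pinList a U c l p.2 := by
  induction l generalizing p with
  | nil => rfl
  | cons v l ih =>
    rw [List.foldl_cons, ih]
    simp only [pinList, List.foldl_cons, scanStep]
    split_ifs <;> rfl

theorem pin_comm (c : Fin q) (u v : V) (w : V → Fin q → ℂ⟦X⟧) :
    pin a c u (pin a c v w) = pin a c v (pin a c u w) := by
  funext v' c'
  by_cases h1 : v' = u <;> by_cases h2 : v' = v <;> simp [pin, h1, h2]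

theorem pinList_pin (U : Finset V) (c : Fin q) (l : List V) (v : V) (w : V → Fin q → ℂ⟦X⟧) :
    pinList a U c l (pin a c v w) = pin a c v (pinList a U c l w) := by
  induction l generalizing w with
  | nil => rfl
  | cons u l ih =>
    simp only [pinList, List.foldl_cons] at ih ⊢
    split_ifs
    · rw [pin_comm, ih]
    · exact ih w

/-- Pins commute, so the head of the list may be treated as the last pin. Hence pins can be undone
by going through the list in the same order in which they were made. -/
theorem pinList_cons (U : Finset V) (c : Fin q) (l : List V) (v : V) (w : V → Fin q → ℂ⟦X⟧) :
    pinList a U c (v :: l) w =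
      if v ∈ U then pin a c v (pinList a U c l w) else pinList a U c l w := by
  rw [← pinList_pin]
  simp only [pinList, List.foldl_cons]
  split_ifs <;> rfl

/-- Without `Nodup` a repeated neighbour would receive its factor more than once. -/
theorem pinList_eq_pinSet (U : Finset V) (c : Fin q) (l : List V) (hl : l.Nodup)
    (w : V → Fin q → ℂ⟦X⟧) :
    pinList a U c l w = pinSet a c (U.filter (· ∈ l)) w := by
  induction l with
  | nil => funext v' c'; simp [pinList, pinSet]
  | cons v l ih =>
    have hv := (List.nodup_cons.mp hl).1
    rw [pinList_cons, ih (List.nodup_cons.mp hl).2]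
    funext v' c'
    by_cases h1 : v' = v
    · subst h1
      by_cases hU : v' ∈ U <;> simp [pin, pinSet, hU, hv]
    · split_ifs <;> simp [pin, pinSet, h1]

theorem constantCoeff_pin (c : Fin q) (v : V) (w : V → Fin q → ℂ⟦X⟧) (v' : V) (c' : Fin q) :
    constantCoeff (pin a c v w v' c') = constantCoeff (w v' c') := by
  unfold pin
  split_ifs <;> simp

theorem constantCoeff_pinList (U : Finset V) (c : Fin q) (l : List V) (w : V → Fin q → ℂ⟦X⟧)
    (v' : V) (c' : Fin q) :
    constantCoeff (pinList a U c l w v' c') = constantCoeff (w v' c') := by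
  induction l with
  | nil => rfl
  | cons v l ih =>
    rw [pinList_cons]
    split_ifs
    · rw [constantCoeff_pin, ih]
    · exact ih

theorem constantCoeff_foldl_scanStep (M : (V → Fin q → ℂ⟦X⟧) → V → Fin q → ℂ⟦X⟧) (U : Finset V)
    (c : Fin q) (l : List V) (p : ℂ⟦X⟧ × (V → Fin q → ℂ⟦X⟧)) :
    constantCoeff (l.foldl (scanStep a M U c) p).1 = constantCoeff p.1 := by
  induction l generalizing p with
  | nil => rfl
  | cons v l ih =>
    rw [List.foldl_cons, ih, scanStep]
    split_ifs <;> simp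

theorem constantCoeff_num (nbrs : V → List V) (k : ℕ) (U : Finset V) (w : V → Fin q → ℂ⟦X⟧)
    (u : V) (c : Fin q) : constantCoeff (num a nbrs k U w u c) = constantCoeff (w u c) := by
  cases k with
  | zero => rfl
  | succ k => rw [num_succ, constantCoeff_foldl_scanStep]

theorem constantCoeff_den (hq : q ≠ 0) (nbrs : V → List V) (k : ℕ) (U : Finset V)
    (w : V → Fin q → ℂ⟦X⟧) (hw : ∀ v c, constantCoeff (w v c) = (q : ℂ)⁻¹) (u : V) :
    constantCoeff (den a nbrs k U w u) = 1 := by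
  have hq' : (q : ℂ) ≠ 0 := by exact_mod_cast hq
  simp [den, map_sum, constantCoeff_num, hw, hq']

/-! ### Accuracy of the approximate marginals -/

theorem marg_mul_den (hq : q ≠ 0) (nbrs : V → List V) (k : ℕ) (U : Finset V)
    (w : V → Fin q → ℂ⟦X⟧) (hw : ∀ v c, constantCoeff (w v c) = (q : ℂ)⁻¹) (u : V) (c : Fin q) :
    marg a nbrs k U w u c * den a nbrs k U w u = num a nbrs k U w u c := by
  rw [marg, mul_assoc, PowerSeries.inv_mul_cancel, mul_one]
  simp [constantCoeff_den hq nbrs k U w hw u]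

/-- The errors of the numerators add up to an error of their sum `den`; subtracting `marg` times the
latter from the error of one numerator leaves the error of `marg`. Everything is cross-multiplied,
so no partition function is inverted. -/
theorem X_pow_dvd_marg (hq : q ≠ 0) (nbrs : V → List V) (k e : ℕ) (U : Finset V)
    (w : V → Fin q → ℂ⟦X⟧) (hw : ∀ v c, constantCoeff (w v c) = (q : ℂ)⁻¹) (u : V)
    (h : ∀ c, X ^ e ∣
      num a nbrs k U w u c * partition G ha (U.erase u) w - partitionAt G ha U w u c) (c : Fin q) :
    X ^ e ∣ marg a nbrs k U w u c * partition G ha U w - partitionAt G ha U w u c := by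
  have hs : X ^ e ∣
      den a nbrs k U w u * partition G ha (U.erase u) w - partition G ha U w := by
    rw [← sum_partitionAt G ha U w u, den, Finset.sum_mul, ← Finset.sum_sub_distrib]
    exact Finset.dvd_sum fun c _ => h c
  have := dvd_sub (h c) (hs.mul_left (marg a nbrs k U w u c))
  have key : num a nbrs k U w u c * partition G ha (U.erase u) w - partitionAt G ha U w u c -
      marg a nbrs k U w u c * (den a nbrs k U w u * partition G ha (U.erase u) w -
        partition G ha U w) =
      marg a nbrs k U w u c * partition G ha U w - partitionAt G ha U w u c := by
    rw [← marg_mul_den hq nbrs k U w hw u c]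
    ring
  rwa [key] at this

/-- The invariant is that the accumulated ratio times `Z` agrees with `r` times the partition
function of the current weights. In `partition_pin` the marginals occur behind a factor $X$, so
marginals of accuracy `e` preserve the invariant with accuracy `e + 1`. -/
theorem X_pow_dvd_scan (e : ℕ) (U : Finset V) (c : Fin q)
    (M : (V → Fin q → ℂ⟦X⟧) → V → Fin q → ℂ⟦X⟧)
    (hM : ∀ w, (∀ v c, constantCoeff (w v c) = (q : ℂ)⁻¹) → ∀ v ∈ U, ∀ c',
      X ^ e ∣ M w v c' * partition G ha U w - partitionAt G ha U w v c')
    (l : List V) (Z : ℂ⟦X⟧) (p : ℂ⟦X⟧ × (V → Fin q → ℂ⟦X⟧)) (r : ℂ⟦X⟧)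
    (hp : ∀ v c, constantCoeff (p.2 v c) = (q : ℂ)⁻¹)
    (h : X ^ (e + 1) ∣ p.1 * Z - r * partition G ha U p.2) :
    X ^ (e + 1) ∣ (l.foldl (scanStep a M U c) p).1 * Z -
      r * partition G ha U (l.foldl (scanStep a M U c) p).2 := by
  induction l generalizing p with
  | nil => exact h
  | cons v l ih =>
    rw [List.foldl_cons]
    refine ih _ ?_ ?_
    · intro v' c'
      rw [scanStep]
      split_ifs
      · rw [← hp v' c']; exact constantCoeff_pin c v p.2 v' c'
      · exact hp v' c'
    · rw [scanStep]
      split_ifs with hv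
      · simp only
        have h1 : X ^ (e + 1) ∣ partition G ha U p.2 * (1 + X * ∑ c', C (a c c') * M p.2 v c') -
            partition G ha U (pin a c v p.2) := by
          have : partition G ha U p.2 * (1 + X * ∑ c', C (a c c') * M p.2 v c') -
              partition G ha U (pin a c v p.2) =
              X * ∑ c', C (a c c') *
                (M p.2 v c' * partition G ha U p.2 - partitionAt G ha U p.2 v c') := by
            rw [partition_pin G ha hv]
            simp only [mul_add, mul_sub, mul_one, Finset.sum_add_distrib, Finset.sum_sub_distrib]
            rw [sum_partitionAt]
            simp only [Finset.mul_sum]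
            have e1 : ∀ x : Fin q, partition G ha U p.2 * (X * (C (a c x) * M p.2 v x)) =
              X * (C (a c x) * (M p.2 v x * partition G ha U p.2)) := fun x => by ring
            have e2 : ∀ x : Fin q, partitionAt G ha U p.2 v x * (X * C (a c x)) =
              X * (C (a c x) * partitionAt G ha U p.2 v x) := fun x => by ring
            simp only [e1, e2]
            ring
          rw [this, pow_succ']
          exact mul_dvd_mul_left _ (Finset.dvd_sum fun c' _ => (hM p.2 hp v hv c').mul_left _)
        have key : p.1 * (1 + X * ∑ c', C (a c c') * M p.2 v c') * Z -
            r * partition G ha U (pin a c v p.2) =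
            (p.1 * Z - r * partition G ha U p.2) * (1 + X * ∑ c', C (a c c') * M p.2 v c') +
            r * (partition G ha U p.2 * (1 + X * ∑ c', C (a c c') * M p.2 v c') -
            partition G ha U (pin a c v p.2)) := by ring
        rw [key]
        exact dvd_add (h.mul_right _) (h1.mul_left _)
      · exact h

/-- At depth 0 only constant terms matter, and all partition functions have constant term 1. The
induction is over all weights, because the scan asks for marginals with respect to partially pinned
ones. -/
theorem X_pow_dvd_num (hq : q ≠ 0) (nbrs : V → List V)
    (hn : ∀ u, (nbrs u).Nodup ∧ ∀ v, v ∈ nbrs u ↔ G.Adj u v) (k : ℕ) :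
    ∀ (U : Finset V) (w : V → Fin q → ℂ⟦X⟧), (∀ v c, constantCoeff (w v c) = (q : ℂ)⁻¹) →
      ∀ u ∈ U, ∀ c, X ^ (k + 1) ∣
        num a nbrs k U w u c * partition G ha (U.erase u) w - partitionAt G ha U w u c := by
  induction k with
  | zero =>
    intro U w hw u hu c
    have hw' : ∀ v d, constantCoeff (pinSet a c ((U.erase u).filter (G.Adj u)) w v d) =
        (q : ℂ)⁻¹ := by
      intro v d
      rw [pinSet, map_mul, hw]
      split_ifs <;> simp
    rw [partitionAt_eq G ha hu, num, pow_one, X_dvd_iff, map_sub, map_mul, map_mul,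
      constantCoeff_partition hq _ _ hw, constantCoeff_partition hq _ _ hw', sub_self]
  | succ k ih =>
    intro U w hw u hu c
    have hM : ∀ w, (∀ v c, constantCoeff (w v c) = (q : ℂ)⁻¹) → ∀ v ∈ U.erase u, ∀ c',
        X ^ (k + 1) ∣ marg a nbrs k (U.erase u) w v c' * partition G ha (U.erase u) w -
          partitionAt G ha (U.erase u) w v c' := fun w hw v hv c' =>
      X_pow_dvd_marg hq nbrs k (k + 1) (U.erase u) w hw v (ih (U.erase u) w hw v hv) c'
    -- With this choice of `Z` and `r` the invariant holds with equality before the first neighbour.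
    have := X_pow_dvd_scan (k + 1) (U.erase u) c _ hM (nbrs u) (partition G ha (U.erase u) w)
      (w u c, w) (w u c) hw (by simp)
    rw [foldl_scanStep_snd, pinList_eq_pinSet _ _ _ (hn u).1] at this
    rw [partitionAt_eq G ha hu, num_succ]
    simpa only [(hn u).2] using this

theorem X_pow_dvd_den (hq : q ≠ 0) (nbrs : V → List V)
    (hn : ∀ u, (nbrs u).Nodup ∧ ∀ v, v ∈ nbrs u ↔ G.Adj u v) (k : ℕ)
    (U : Finset V) (w : V → Fin q → ℂ⟦X⟧) (hw : ∀ v c, constantCoeff (w v c) = (q : ℂ)⁻¹)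
    (u : V) (hu : u ∈ U) : X ^ (k + 1) ∣
        den a nbrs k U w u * partition G ha (U.erase u) w - partition G ha U w := by
  rw [← sum_partitionAt G ha U w u, den, Finset.sum_mul, ← Finset.sum_sub_distrib]
  exact Finset.dvd_sum fun c _ => X_pow_dvd_num hq nbrs hn k U w hw u hu c

end

end PartitionSeries

/-! ### Taylor coefficients of the logarithm -/

namespace PartitionSeries

open PowerSeries

/-- The Taylor series at `0`. -/
noncomputable def taylorSeries (f : ℂ → ℂ) : ℂ⟦X⟧ :=
  PowerSeries.mk fun k => iteratedDeriv k f 0 / (k.factorial : ℂ)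

/-- The Leibniz rule, with the binomial coefficients absorbed by the factorials. -/
theorem taylorSeries_mul {f g : ℂ → ℂ} (hf : AnalyticAt ℂ f 0) (hg : AnalyticAt ℂ g 0) :
    taylorSeries (fun x => f x * g x) = taylorSeries f * taylorSeries g := by
  ext k
  simp only [taylorSeries, coeff_mk, coeff_mul]
  rw [iteratedDeriv_fun_mul hf.contDiffAt hg.contDiffAt, Finset.sum_div,
    Finset.Nat.sum_antidiagonal_eq_sum_range_succ_mk]
  refine Finset.sum_congr rfl fun i hi => ?_
  have hik : i ≤ k := Nat.lt_succ_iff.mp (Finset.mem_range.mp hi)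
  have h1 : (k.factorial : ℂ) ≠ 0 := by exact_mod_cast k.factorial_ne_zero
  have h2 : (i.factorial : ℂ) ≠ 0 := by exact_mod_cast i.factorial_ne_zero
  have h3 : ((k - i).factorial : ℂ) ≠ 0 := by exact_mod_cast (k - i).factorial_ne_zero
  have h4 : (k.choose i : ℂ) * i.factorial * (k - i).factorial = k.factorial := by
    exact_mod_cast Nat.choose_mul_factorial_mul_factorial hik
  field_simp
  rw [← h4]
  ring

theorem taylorSeries_deriv (f : ℂ → ℂ) :
    taylorSeries (deriv f) = PowerSeries.derivative ℂ (taylorSeries f) := by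
  ext k
  rw [coeff_derivative]
  simp only [taylorSeries, coeff_mk]
  rw [← iteratedDeriv_succ', Nat.factorial_succ]
  have h1 : (k.factorial : ℂ) ≠ 0 := by exact_mod_cast k.factorial_ne_zero
  have h2 : (k : ℂ) + 1 ≠ 0 := by exact_mod_cast k.succ_ne_zero
  push_cast
  field_simp

theorem iteratedDeriv_polynomial_eval (p : Polynomial ℂ) (k : ℕ) :
    iteratedDeriv k (fun x => p.eval x) = fun x => (Polynomial.derivative^[k] p).eval x := by
  induction k with
  | zero => rfl
  | succ k ih =>
    rw [iteratedDeriv_succ, ih, Function.iterate_succ_apply']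
    funext x
    exact Polynomial.deriv _

theorem taylorSeries_polynomial (p : Polynomial ℂ) :
    taylorSeries (fun x => p.eval x) = (p : ℂ⟦X⟧) := by
  ext k
  have h1 : (k.factorial : ℂ) ≠ 0 := by exact_mod_cast k.factorial_ne_zero
  simp only [taylorSeries, coeff_mk, Polynomial.coeff_coe, iteratedDeriv_polynomial_eval]
  rw [← Polynomial.coeff_zero_eq_eval_zero, Polynomial.coeff_iterate_derivative]
  simp only [zero_add, Nat.descFactorial_self, nsmul_eq_mul]
  field_simp

theorem taylorSeries_congr {f g : ℂ → ℂ} (h : f =ᶠ[nhds 0] g) :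
    taylorSeries f = taylorSeries g := by
  ext k
  simp only [taylorSeries, coeff_mk, h.iteratedDeriv_eq]

/-- The equation $(\log p)'p=p'$ for germs at 0, transferred to Taylor series. It replaces any
formal logarithm of power series. -/
theorem derivative_taylorSeries_log_mul (p : Polynomial ℂ) (hp : p.eval 0 = 1) :
    PowerSeries.derivative ℂ (taylorSeries fun x => Complex.log (p.eval x)) * (p : ℂ⟦X⟧) =
      PowerSeries.derivative ℂ (p : ℂ⟦X⟧) := by
  have hpa : ∀ p : Polynomial ℂ, AnalyticAt ℂ (fun x => p.eval x) 0 := fun p =>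
    AnalyticOnNhd.eval_polynomial p 0 trivial
  -- Since $p(0)=1$, the values of $p$ near 0 stay in the slit plane, where the principal branch is
  -- analytic.
  have hs : p.eval 0 ∈ Complex.slitPlane := by rw [hp]; exact Complex.one_mem_slitPlane
  have hf : AnalyticAt ℂ (fun x => Complex.log (p.eval x)) 0 := (hpa p).clog hs
  have hev : ∀ᶠ x in nhds (0 : ℂ), p.eval x ∈ Complex.slitPlane :=
    (hpa p).continuousAt.eventually (Complex.isOpen_slitPlane.mem_nhds hs)
  rw [← taylorSeries_deriv, derivative_coe, ← taylorSeries_polynomial p,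
    ← taylorSeries_polynomial (Polynomial.derivative p), ← taylorSeries_mul hf.deriv (hpa p)]
  refine taylorSeries_congr ?_
  filter_upwards [hev] with x hx
  have hx0 : p.eval x ≠ 0 := Complex.slitPlane_ne_zero hx
  rw [((p.hasDerivAt x).clog hx).deriv]
  field_simp

/-- Differentiation loses one order and the factor $X$ restores it. For this reason the logarithm is
computed from $Xp'$ and not from $p'$. -/
theorem X_pow_dvd_X_mul_derivative {e : ℕ} {f : ℂ⟦X⟧} (h : X ^ e ∣ f) :
    X ^ e ∣ X * PowerSeries.derivative ℂ f := by
  rw [X_pow_dvd_iff] at h ⊢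
  rintro (_ | i) hi
  · simp
  · rw [coeff_succ_X_mul, coeff_derivative, h _ hi, zero_mul]

/-- The coefficients of `log p` from those of an approximation of `p`. -/
theorem taylorPoly_log_eq (p : Polynomial ℂ) (hp : p.eval 0 = 1) (m : ℕ) (acc r : ℂ⟦X⟧)
    (hacc : X ^ (m + 1) ∣ acc - (p : ℂ⟦X⟧)) (hr : r * acc = X * PowerSeries.derivative ℂ acc)
    (l : ℕ → ℂ) (hl0 : l 0 = 0) (hl : ∀ i, 1 ≤ i → i ≤ m → l i = coeff i r / i) :
    taylorPoly (fun x => Complex.log (p.eval x)) m =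
      ∑ k ∈ Finset.range (m + 1), Polynomial.monomial k (l k) := by
  set T := taylorSeries fun x => Complex.log (p.eval x) with hT
  have hdT := derivative_taylorSeries_log_mul p hp
  rw [← hT] at hdT
  -- Both $r$ and $X(\log p)'$ are logarithmic derivatives times $X$, of `acc` and of `p`; they are
  -- compared after multiplication by `p`, which is a unit.
  have hdvd : X ^ (m + 1) ∣ r - X * PowerSeries.derivative ℂ T := by
    have h1 : X ^ (m + 1) ∣ (r - X * PowerSeries.derivative ℂ T) * (p : ℂ⟦X⟧) := by
      have h2 := X_pow_dvd_X_mul_derivative hacc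
      rw [map_sub] at h2
      have key : (r - X * PowerSeries.derivative ℂ T) * (p : ℂ⟦X⟧) =
          X * (PowerSeries.derivative ℂ acc - PowerSeries.derivative ℂ (p : ℂ⟦X⟧)) -
            r * (acc - (p : ℂ⟦X⟧)) := by
        linear_combination hr - X * hdT
      rw [key]
      exact dvd_sub h2 (hacc.mul_left r)
    have hu : IsUnit (p : ℂ⟦X⟧) := by
      rw [isUnit_iff_constantCoeff]
      simp [Polynomial.constantCoeff_coe, Polynomial.coeff_zero_eq_eval_zero, hp]
    exact (hu.dvd_mul_right).mp h1
  unfold taylorPoly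
  refine Finset.sum_congr rfl fun k hk => ?_
  have hkm : k < m + 1 := Finset.mem_range.mp hk
  congr 1
  rcases Nat.eq_zero_or_pos k with rfl | hk0
  · simp [hl0, hp]
  · obtain ⟨j, rfl⟩ : ∃ j, k = j + 1 := ⟨k - 1, by omega⟩
    have := X_pow_dvd_iff.mp hdvd _ hkm
    rw [map_sub, coeff_succ_X_mul, coeff_derivative, sub_eq_zero] at this
    rw [hl _ hk0 (by omega), this, hT]
    simp only [taylorSeries, coeff_mk]
    have h2 : (j : ℂ) + 1 ≠ 0 := by exact_mod_cast j.succ_ne_zero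
    push_cast
    field_simp

/-! ### The polynomial $H(G;x)$ as a weighted partition function -/

/-- The polynomial `H(G; x)`. -/
noncomputable def homPolynomial {V : Type*} [Fintype V] [DecidableEq V] (G : SimpleGraph V)
    [DecidableRel G.Adj] {q : ℕ} {a : Matrix (Fin q) (Fin q) ℂ} (ha : a.IsSymm) : Polynomial ℂ :=
  Polynomial.C ((q : ℂ) ^ Fintype.card V)⁻¹ *
    ∑ φ : V → Fin q, ∏ e ∈ G.edgeFinset,
      Sym2.lift ⟨fun i j => 1 + Polynomial.X * Polynomial.C (a i j),
        fun i j => by simp only [ha.apply j i]⟩ (e.map φ)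

theorem homPolynomial_eval {V : Type*} [Fintype V] [DecidableEq V] (G : SimpleGraph V)
    [DecidableRel G.Adj] {q : ℕ} {A : Matrix (Fin q) (Fin q) ℂ} (hA : A.IsSymm)
    (ha : (A - onesMatrix q).IsSymm) (x : ℂ) :
    (homPolynomial G ha).eval x = homPoly G A hA x := by
  simp only [homPolynomial, homPoly, homNum, Polynomial.eval_mul, Polynomial.eval_C,
    Polynomial.eval_finsetSum, Polynomial.eval_prod]
  congr 1
  refine Finset.sum_congr rfl fun φ _ => Finset.prod_congr rfl fun e _ => ?_
  induction e with
  | h u v => simp [onesMatrix]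

/-- The normalisation $q^{-|V|}$ is distributed as a weight $1/q$ on every vertex. -/
theorem coe_homPolynomial {V : Type*} [Fintype V] [DecidableEq V] (G : SimpleGraph V)
    [DecidableRel G.Adj] {q : ℕ} {a : Matrix (Fin q) (Fin q) ℂ} (ha : a.IsSymm) :
    (homPolynomial G ha : ℂ⟦X⟧) =
      partition G ha Finset.univ fun _ _ => C ((q : ℂ)⁻¹) := by
  rw [← Polynomial.coeToPowerSeries.ringHom_apply]
  simp only [homPolynomial, map_mul, map_sum, map_prod, partition, vertexWeight, edgeWeight,
    Finset.mem_univ, if_true, implies_true, Finset.filter_true]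
  rw [Finset.mul_sum]
  refine Finset.sum_congr rfl fun φ _ => ?_
  congr 1
  · simp [Finset.prod_const, ← map_pow]
  · refine Finset.prod_congr rfl fun e _ => ?_
    induction e with
    | h u v =>
      simp only [Sym2.map_mk, Sym2.lift_mk, edgeFactor_mk, map_add, map_one, map_mul,
        Polynomial.coeToPowerSeries.ringHom_apply, Polynomial.coe_X, Polynomial.coe_C]

theorem homPolynomial_eval_zero {V : Type*} [Fintype V] [DecidableEq V] (G : SimpleGraph V)
    [DecidableRel G.Adj] {q : ℕ} (hq : q ≠ 0) {a : Matrix (Fin q) (Fin q) ℂ} (ha : a.IsSymm) :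
    (homPolynomial G ha).eval 0 = 1 := by
  rw [← Polynomial.coeff_zero_eq_eval_zero, ← Polynomial.constantCoeff_coe, coe_homPolynomial,
    constantCoeff_partition hq]
  simp

end PartitionSeries

/-! ### Time-bounded Hoare logic for the random access machine -/

namespace AlgRAM

section

variable {q : ℕ} {inp : Input q} {procs : List Stmt}

/-- Started in `s`, the statement `c` halts within `T` steps in a state that satisfies `Q`. -/
def Runs (inp : Input q) (procs : List Stmt) (c : Stmt) (s : State) (T : ℕ) (Q : State → Prop) :
    Prop :=
  ∃ t s', Exec inp procs c s t s' ∧ t ≤ T ∧ Q s'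

theorem Runs.mono {c : Stmt} {s : State} {T T' : ℕ} {Q Q' : State → Prop}
    (h : Runs inp procs c s T Q) (hT : T ≤ T') (hQ : ∀ s', Q s' → Q' s') :
    Runs inp procs c s T' Q' := by
  obtain ⟨t, s', h1, h2, h3⟩ := h
  exact ⟨t, s', h1, h2.trans hT, hQ _ h3⟩

theorem Runs.skip {s : State} {T : ℕ} {Q : State → Prop} (hT : 1 ≤ T) (hQ : Q s) :
    Runs inp procs .skip s T Q := ⟨1, s, .skip s, hT, hQ⟩

theorem Runs.setReg {r : ℕ} {e : IExp} {s : State} {T : ℕ} {Q : State → Prop}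
    (hT : e.cost + 1 ≤ T) (hQ : Q { s with reg := Function.update s.reg r (e.eval inp s) }) :
    Runs inp procs (.setReg r e) s T Q := ⟨_, _, .setReg r e s, hT, hQ⟩

theorem Runs.setMem {a e : IExp} {s : State} {T : ℕ} {Q : State → Prop}
    (hT : a.cost + e.cost + 1 ≤ T)
    (hQ : Q { s with mem := Function.update s.mem (a.eval inp s) (e.eval inp s) }) :
    Runs inp procs (.setMem a e) s T Q := ⟨_, _, .setMem a e s, hT, hQ⟩

theorem Runs.setFld {a : IExp} {e : FExp} {s : State} {T : ℕ} {Q : State → Prop}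
    (hT : a.cost + e.cost + 1 ≤ T) (he : e.Defined inp s)
    (hQ : Q { s with fld := Function.update s.fld (a.eval inp s) (e.eval inp s) }) :
    Runs inp procs (.setFld a e) s T Q := ⟨_, _, .setFld a e s he, hT, hQ⟩

theorem Runs.seq {c d : Stmt} {s : State} {T T₁ T₂ : ℕ} {Q₁ Q : State → Prop}
    (h₁ : Runs inp procs c s T₁ Q₁) (h₂ : ∀ s', Q₁ s' → Runs inp procs d s' T₂ Q)
    (hT : T₁ + T₂ ≤ T) : Runs inp procs (.seq c d) s T Q := by
  obtain ⟨t₁, s₁, e₁, ht₁, hq₁⟩ := h₁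
  obtain ⟨t₂, s₂, e₂, ht₂, hq₂⟩ := h₂ s₁ hq₁
  exact ⟨_, _, .seq e₁ e₂, by omega, hq₂⟩

theorem Runs.ite {b : BExp} {c d : Stmt} {s : State} {T T₁ : ℕ} {Q : State → Prop}
    (h₁ : b.eval inp s = true → Runs inp procs c s T₁ Q)
    (h₂ : b.eval inp s = false → Runs inp procs d s T₁ Q) (hT : b.cost + T₁ ≤ T) :
    Runs inp procs (.ite b c d) s T Q := by
  cases hb : b.eval inp s with
  | true =>
    obtain ⟨t, s', e, ht, hq⟩ := h₁ hb
    exact ⟨_, _, .iteTrue hb e, by omega, hq⟩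
  | false =>
    obtain ⟨t, s', e, ht, hq⟩ := h₂ hb
    exact ⟨_, _, .iteFalse hb e, by omega, hq⟩

theorem Runs.call {p : ℕ} {c : Stmt} {s : State} {T T₁ : ℕ} {Q : State → Prop}
    (hp : procs[p]? = some c)
    (h : Runs inp procs c s T₁ fun s' => Q { s' with reg := s.reg }) (hT : T₁ + 1 ≤ T) :
    Runs inp procs (.call p) s T Q := by
  obtain ⟨t, s', e, ht, hq⟩ := h
  exact ⟨_, _, .call hp e, by omega, hq⟩

/-- `for r = 0, …, hi - 1 do body`. -/
def forLoop (r : ℕ) (hi : IExp) (body : Stmt) : Stmt :=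
  .seq (.setReg r (.const 0))
    (.while (.lt (.reg r) hi) (.seq body (.setReg r (.add (.reg r) (.const 1)))))

/-- `I i` describes the state at the test before round `i`, counter included. A round costs `hi.cost
+ 6` beyond the body, for test and increment; the bound is re-evaluated each time, hence `hreg`. -/
theorem Runs.forLoop {r : ℕ} {hi : IExp} {body : Stmt} {s : State} {T₁ T N : ℕ}
    {Q : State → Prop} (I : ℕ → State → Prop)
    (h0 : I 0 { s with reg := Function.update s.reg r 0 })
    (hreg : ∀ i s, I i s → s.reg r = i ∧ hi.eval inp s = N)
    (hbody : ∀ i s, i < N → I i s → Runs inp procs body s T₁ fun s' =>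
      s'.reg r = i ∧ I (i + 1) { s' with reg := Function.update s'.reg r (i + 1) })
    (hQ : ∀ s, I N s → Q s) (hT : N * (T₁ + hi.cost + 6) + hi.cost + 4 ≤ T) :
    Runs inp procs (AlgRAM.forLoop r hi body) s T Q := by
  -- Induction on the number `j` of rounds that remain.
  have main : ∀ j i s, i + j = N → I i s → Runs inp procs
      (.while (.lt (.reg r) hi) (.seq body (.setReg r (.add (.reg r) (.const 1))))) s
      (j * (T₁ + hi.cost + 6) + hi.cost + 2) Q := by
    intro j
    induction j with
    | zero =>
      intro i s hij hI
      obtain rfl : i = N := by omega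
      obtain ⟨h1, h2⟩ := hreg _ _ hI
      refine ⟨_, s, .whileFalse (by simp [BExp.eval, IExp.eval, h1, h2]), ?_, hQ _ hI⟩
      simp only [BExp.cost, IExp.cost]
      omega
    | succ j ih =>
      intro i s hij hI
      obtain ⟨h1, h2⟩ := hreg _ _ hI
      obtain ⟨t₁, s₁, e₁, ht₁, hr, hI₁⟩ := hbody i s (by omega) hI
      obtain ⟨t₂, s₂, e₂, ht₂, hq⟩ := ih (i + 1) _ (by omega) hI₁
      have e3 := Exec.setReg (inp := inp) (procs := procs) r (.add (.reg r) (.const 1)) s₁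
      simp only [IExp.eval, hr] at e3
      refine ⟨_, s₂, .whileTrue (by simp only [BExp.eval, IExp.eval, h1, h2]; simp; omega)
        (.seq e₁ e3) e₂, ?_, hq⟩
      simp only [BExp.cost, IExp.cost]
      rw [Nat.succ_mul]
      omega
  refine Runs.seq (T₁ := 2) (T₂ := N * (T₁ + hi.cost + 6) + hi.cost + 2)
    (Q₁ := fun s' => I 0 s') (Runs.setReg (by simp [IExp.cost]) h0) ?_ (by omega)
  intro s' hI
  exact main N 0 s' (by omega) hI

/-- The statements `f 0, …, f (N - 1)` one after another. -/
def unroll : ℕ → (ℕ → Stmt) → Stmt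
  | 0, _ => .skip
  | c + 1, f => .seq (unroll c f) (f c)

/-- Loops over colours are unrolled, as `q` is fixed with the program. They need no counter
register, and each colour is a constant in its copy of the body. -/
theorem Runs.unroll {f : ℕ → Stmt} {s : State} {T₁ T N : ℕ} {Q : State → Prop}
    (I : ℕ → State → Prop) (h0 : I 0 s)
    (hf : ∀ c s, c < N → I c s → Runs inp procs (f c) s T₁ (I (c + 1)))
    (hQ : ∀ s, I N s → Q s) (hT : N * T₁ + 1 ≤ T) :
    Runs inp procs (AlgRAM.unroll N f) s T Q := by
  have main : ∀ c, c ≤ N → Runs inp procs (AlgRAM.unroll c f) s (c * T₁ + 1) (I c) := by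
    intro c
    induction c with
    | zero => intro _; exact Runs.skip (by omega) h0
    | succ c ih =>
      intro hc
      refine Runs.seq (ih (by omega)) (fun s' hI => hf c s' (by omega) hI) ?_
      rw [Nat.succ_mul]
      omega
  exact (main N le_rfl).mono hT hQ

/-- The expression `c * e` for a constant `c`. -/
def IExp.times : ℕ → IExp → IExp
  | 0, _ => .const 0
  | c + 1, e => .add (IExp.times c e) e

@[simp]
theorem IExp.times_eval (c : ℕ) (e : IExp) (s : State) :
    (IExp.times c e).eval inp s = c * e.eval inp s := by
  induction c with
  | zero => simp [times, eval]
  | succ c ih => simp [times, eval, ih, Nat.succ_mul]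

@[simp]
theorem IExp.times_cost (c : ℕ) (e : IExp) : (IExp.times c e).cost = c * (e.cost + 1) + 1 := by
  induction c with
  | zero => simp [times, cost]
  | succ c ih => simp only [times, cost, ih, Nat.succ_mul]; omega

/-- The sum of the expressions `f 0, …, f (N - 1)`. -/
def FExp.sum : ℕ → (ℕ → FExp) → FExp
  | 0, _ => .zero
  | c + 1, f => .add (FExp.sum c f) (f c)

@[simp]
theorem FExp.sum_eval (N : ℕ) (f : ℕ → FExp) (s : State) :
    (FExp.sum N f).eval inp s = ∑ c ∈ Finset.range N, (f c).eval inp s := by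
  induction N with
  | zero => simp [sum, eval]
  | succ c ih => simp [sum, eval, ih, Finset.sum_range_succ]

theorem FExp.sum_defined (N : ℕ) (f : ℕ → FExp) (s : State) (h : ∀ c, (f c).Defined inp s) :
    (FExp.sum N f).Defined inp s := by
  induction N with
  | zero => simp [sum, Defined]
  | succ c ih => exact ⟨ih, h c⟩

theorem FExp.sum_cost_le (N K : ℕ) (f : ℕ → FExp) (h : ∀ c < N, (f c).cost ≤ K) :
    (FExp.sum N f).cost ≤ N * (K + 1) + 1 := by
  induction N with
  | zero => simp [sum, cost]
  | succ c ih =>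
    have h1 := ih fun d hd => h d (by omega)
    have h2 := h c (by omega)
    simp only [sum, cost, Nat.succ_mul]
    omega

/-! ### Blocks of the complex memory -/

/-- The cells `d, …, d + N - 1` overwritten by the values of `v`. -/
def write (f : ℕ → ℂ) (d N : ℕ) (v : ℕ → ℂ) : ℕ → ℂ :=
  fun x => if d ≤ x ∧ x < d + N then v (x - d) else f x

theorem write_zero (f : ℕ → ℂ) (d : ℕ) (v : ℕ → ℂ) : write f d 0 v = f := by
  funext x
  simp only [write]
  split_ifs
  · omega
  · rfl

theorem write_succ (f : ℕ → ℂ) (d N : ℕ) (v : ℕ → ℂ) :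
    Function.update (write f d N v) (d + N) (v N) = write f d (N + 1) v := by
  funext x
  by_cases hx : x = d + N
  · subst hx; simp [write]
  · rw [Function.update_of_ne hx]
    simp only [write]
    split_ifs <;> first | rfl | omega

theorem write_add (f : ℕ → ℂ) (d N : ℕ) (v : ℕ → ℂ) (i : ℕ) (h : i < N) :
    write f d N v (d + i) = v i := by
  simp [write, h]

theorem write_of_notMem (f : ℕ → ℂ) (d N : ℕ) (v : ℕ → ℂ) (x : ℕ) (h : x < d ∨ d + N ≤ x) :
    write f d N v x = f x := by
  simp only [write]
  split_ifs
  · omega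
  · rfl

/-- `for r = 0, …, hi - 1 do fld[dst] := e`. -/
def fill (r : ℕ) (hi dst : IExp) (e : FExp) : Stmt := forLoop r hi (.setFld dst e)

/-- The expression is evaluated when the first `i` cells are already written, so it may refer to
earlier values; the table of integers in `logStmt` is built in this way. -/
theorem Runs.fill {r : ℕ} {hi dst : IExp} {e : FExp} {s : State} {T N d : ℕ}
    {Q : State → Prop} (v : ℕ → ℂ)
    (hhi : ∀ i f, hi.eval inp ⟨Function.update s.reg r i, s.mem, f⟩ = N)
    (hdst : ∀ i f, dst.eval inp ⟨Function.update s.reg r i, s.mem, f⟩ = d + i)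
    (he : ∀ i, i < N →
      e.Defined inp ⟨Function.update s.reg r i, s.mem, write s.fld d i v⟩ ∧
      e.eval inp ⟨Function.update s.reg r i, s.mem, write s.fld d i v⟩ = v i)
    (hQ : Q ⟨Function.update s.reg r N, s.mem, write s.fld d N v⟩)
    (hT : N * (dst.cost + e.cost + hi.cost + 7) + hi.cost + 4 ≤ T) :
    Runs inp procs (AlgRAM.fill r hi dst e) s T Q := by
  refine Runs.forLoop (T₁ := dst.cost + e.cost + 1) (N := N)
    (fun i s' => s' = ⟨Function.update s.reg r i, s.mem, write s.fld d i v⟩) ?_ ?_ ?_ ?_ ?_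
  · simp [write_zero]
  · rintro i s' rfl
    exact ⟨by simp, hhi _ _⟩
  · rintro i s' hi' rfl
    obtain ⟨h1, h2⟩ := he i hi'
    refine Runs.setFld le_rfl h1 ?_
    refine ⟨by simp, ?_⟩
    rw [h2, hdst]
    simp [write_succ]
  · rintro s' rfl
    exact hQ
  · refine le_trans (le_of_eq ?_) hT
    ring

end

end AlgRAM

/-! ### Multiplication and division of truncated power series -/

namespace AlgRAM

open PowerSeries

section

variable {q : ℕ} {inp : Input q} {procs : List Stmt}

/-- The cells `d, …, d + m` contain the coefficients of `p` up to order `m`. -/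
def Holds (f : ℕ → ℂ) (d m : ℕ) (p : ℂ⟦X⟧) : Prop := ∀ i ≤ m, f (d + i) = coeff i p

theorem Holds.congr {f g : ℕ → ℂ} {d m : ℕ} {p : ℂ⟦X⟧} (h : Holds f d m p)
    (hfg : ∀ x, d ≤ x → x < d + (m + 1) → g x = f x) : Holds g d m p := fun i hi => by
  rw [hfg _ (by omega) (by omega), h i hi]

/-- The states `s` and `s'` differ only in scratch registers and in the cells `d, …, d + m` of the
complex memory, which hold the coefficients of `p` in the state `s'`. -/
structure Updates (s : State) (d m : ℕ) (p : ℂ⟦X⟧) (s' : State) : Prop where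
  reg : ∀ r, r < 4 ∨ 8 ≤ r → s'.reg r = s.reg r
  mem : s'.mem = s.mem
  frame : ∀ x, x < d ∨ d + (m + 1) ≤ x → s'.fld x = s.fld x
  holds : Holds s'.fld d m p

/-- Besides the old coefficient `j + 1`, only coefficients of index at most `j` of both series
enter. This makes in-place multiplication and division possible, and only the first `m` coefficients
of `y` are needed. -/
theorem coeff_succ_mul_one_add_X_mul (p y : ℂ⟦X⟧) (j : ℕ) :
    coeff (j + 1) (p * (1 + X * y)) =
      coeff (j + 1) p + ∑ t ∈ Finset.range (j + 1), coeff t p * coeff (j - t) y := by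
  rw [show p * (1 + X * y) = p + X * (p * y) by ring, map_add, coeff_succ_X_mul, coeff_mul,
    Finset.Nat.sum_antidiagonal_eq_sum_range_succ_mk]

theorem coeff_zero_mul_one_add_X_mul (p y : ℂ⟦X⟧) :
    coeff 0 (p * (1 + X * y)) = coeff 0 p := by
  simp

/-- Multiply the series at address `reg 4` by `1 + X y` where `y` is at address `reg 5`. -/
def mulStmt : Stmt :=
  forLoop 6 .level (forLoop 7 (.sub .level (.reg 6))
    (.setFld (.add (.reg 4) (.sub .level (.reg 6)))
      (.add (.load (.add (.reg 4) (.sub .level (.reg 6))))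
        (.mul (.load (.add (.reg 4) (.reg 7)))
          (.load (.add (.reg 5) (.sub (.sub .level (.reg 6)) (.add (.reg 7) (.const 1)))))))))

/-- Divide the series at address `reg 4` by `1 + X y` where `y` is at address `reg 5`. -/
def divStmt : Stmt :=
  forLoop 6 .level (forLoop 7 (.add (.reg 6) (.const 1))
    (.setFld (.add (.reg 4) (.add (.reg 6) (.const 1)))
      (.sub (.load (.add (.reg 4) (.add (.reg 6) (.const 1))))
        (.mul (.load (.add (.reg 4) (.reg 7)))
          (.load (.add (.reg 5) (.sub (.reg 6) (.reg 7))))))))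

theorem Runs.mulStmt {s : State} {P Y T : ℕ} {p y : ℂ⟦X⟧} (hP : s.reg 4 = P) (hY : s.reg 5 = Y)
    (hp : Holds s.fld P inp.m p) (hy : ∀ t < inp.m, s.fld (Y + t) = coeff t y)
    (hPY : ∀ t < inp.m, Y + t < P ∨ P + (inp.m + 1) ≤ Y + t) (hT : 60 * (inp.m + 1) ^ 2 ≤ T) :
    Runs inp procs AlgRAM.mulStmt s T fun s' => s'.mem = s.mem ∧
      (∀ x, x < P ∨ P + (inp.m + 1) ≤ x → s'.fld x = s.fld x) ∧
      Holds s'.fld P inp.m (p * (1 + X * y)) := by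
  set m := inp.m with hm
  -- Coefficients are overwritten from the top down: before round `j` those of index at most `m - j`
  -- are still the ones of `p`. The inner loop has at most `m` rounds of `28 + 3 + 6` steps and an
  -- overhead of 7.
  refine Runs.forLoop (N := m) (T₁ := 37 * m + 7)
    (fun j s' => j ≤ m ∧ s'.reg 6 = j ∧ s'.reg 4 = P ∧ s'.reg 5 = Y ∧ s'.mem = s.mem ∧
      (∀ x, x < P ∨ P + (m + 1) ≤ x → s'.fld x = s.fld x) ∧
      (∀ i, i + j ≤ m → s'.fld (P + i) = coeff i p) ∧
      ∀ i ≤ m, m < i + j → s'.fld (P + i) = coeff i (p * (1 + X * y))) ?_ ?_ ?_ ?_ ?_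
  · refine ⟨by omega, by simp, by simp [hP], by simp [hY], rfl, fun _ _ => rfl,
      fun i hi => hp i (by omega), fun i hi hi' => by omega⟩
  · rintro j s' ⟨-, h6, -⟩
    exact ⟨h6, rfl⟩
  · rintro j s₁ hj ⟨-, h6, h4, h5, hmem, hfr, hlo, hhi⟩
    obtain ⟨i, hi⟩ : ∃ i, m - j = i + 1 := ⟨m - j - 1, by omega⟩
    refine Runs.forLoop (N := i + 1) (T₁ := 28)
      (fun l s' => l ≤ i + 1 ∧ s'.reg 7 = l ∧ s'.reg 6 = j ∧ s'.reg 4 = P ∧ s'.reg 5 = Y ∧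
        s'.mem = s.mem ∧ (∀ x, x < P ∨ P + (m + 1) ≤ x → s'.fld x = s.fld x) ∧
        (∀ t ≤ i, s'.fld (P + t) = coeff t p) ∧
        (s'.fld (P + (i + 1)) =
          coeff (i + 1) p + ∑ t ∈ Finset.range l, coeff t p * coeff (i - t) y) ∧
        ∀ t ≤ m, i + 1 < t → s'.fld (P + t) = coeff t (p * (1 + X * y))) ?_ ?_ ?_ ?_ ?_
    · refine ⟨by omega, by simp, by simp [h6], by simp [h4], by simp [h5], hmem, hfr,
        fun t ht => hlo t (by omega), ?_, fun t ht ht' => hhi t ht (by omega)⟩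
      simp [hlo (i + 1) (by omega)]
    · rintro l s₂ ⟨-, h7, h6, -⟩
      refine ⟨h7, ?_⟩
      simp only [IExp.eval, h6]
      omega
    · rintro l s₂ hl ⟨-, h7, h6, h4, h5, hmem, hfr, hlo, hmid, hhi⟩
      refine Runs.setFld (by simp [IExp.cost, FExp.cost]) (by simp [FExp.Defined]) ?_
      have e1 : (IExp.add (.reg 4) (.sub .level (.reg 6))).eval inp s₂ = P + (i + 1) := by
        simp only [IExp.eval, h4, h6]
        omega
      have e2 : (IExp.add (.reg 5) (.sub (.sub .level (.reg 6)) (.add (.reg 7) (.const 1)))).eval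
          inp s₂ = Y + (i - l) := by
        simp only [IExp.eval, h5, h6, h7]
        omega
      have e3 : (IExp.add (.reg 4) (.reg 7)).eval inp s₂ = P + l := by
        simp only [IExp.eval, h4, h7]
      simp only [FExp.eval, e1, e2, e3]
      refine ⟨h7, by omega, by simp, by simp [h6], by simp [h4], by simp [h5], hmem, ?_, ?_, ?_,
        ?_⟩
      · intro x hx
        rw [Function.update_of_ne (by omega), hfr x hx]
      · intro t ht
        rw [Function.update_of_ne (by omega), hlo t ht]
      · rw [Function.update_self, hmid, hlo l (by omega), hfr _ (hPY _ (by omega)),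
          hy _ (by omega), Finset.sum_range_succ]
        ring
      · intro t ht ht'
        rw [Function.update_of_ne (by omega), hhi t ht ht']
    · rintro s₂ ⟨-, h7, h6, h4, h5, hmem, hfr, hlo, hmid, hhi⟩
      refine ⟨h6, by omega, by simp, by simp [h4], by simp [h5], hmem, hfr,
        fun t ht => hlo t (by omega), ?_⟩
      intro t ht ht'
      rcases Nat.lt_or_ge (i + 1) t with h | h
      · exact hhi t ht h
      · obtain rfl : t = i + 1 := by omega
        rw [coeff_succ_mul_one_add_X_mul]
        exact hmid
    · simp only [IExp.cost]
      omega
  · rintro s' ⟨-, -, -, -, hmem, hfr, hlo, hhi⟩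
    refine ⟨hmem, hfr, fun i hi => ?_⟩
    rcases Nat.eq_zero_or_pos i with rfl | h
    · rw [hlo 0 (by omega), coeff_zero_mul_one_add_X_mul]
    · exact hhi i hi (by omega)
  · simp only [IExp.cost]
    nlinarith

theorem Runs.divStmt {s : State} {P Y T : ℕ} {p y : ℂ⟦X⟧} (hP : s.reg 4 = P) (hY : s.reg 5 = Y)
    (hp : Holds s.fld P inp.m (p * (1 + X * y))) (hy : ∀ t < inp.m, s.fld (Y + t) = coeff t y)
    (hPY : ∀ t < inp.m, Y + t < P ∨ P + (inp.m + 1) ≤ Y + t) (hT : 60 * (inp.m + 1) ^ 2 ≤ T) :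
    Runs inp procs AlgRAM.divStmt s T fun s' => s'.mem = s.mem ∧
      (∀ x, x < P ∨ P + (inp.m + 1) ≤ x → s'.fld x = s.fld x) ∧ Holds s'.fld P inp.m p := by
  set m := inp.m with hm
  -- Division runs upwards instead, since the next coefficient of the quotient is found from the
  -- ones already in place.
  refine Runs.forLoop (N := m) (T₁ := 37 * m + 7)
    (fun j s' => j ≤ m ∧ s'.reg 6 = j ∧ s'.reg 4 = P ∧ s'.reg 5 = Y ∧ s'.mem = s.mem ∧
      (∀ x, x < P ∨ P + (m + 1) ≤ x → s'.fld x = s.fld x) ∧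
      (∀ i ≤ j, s'.fld (P + i) = coeff i p) ∧
      ∀ i ≤ m, j < i → s'.fld (P + i) = coeff i (p * (1 + X * y))) ?_ ?_ ?_ ?_ ?_
  · refine ⟨by omega, by simp, by simp [hP], by simp [hY], rfl, fun _ _ => rfl, ?_,
      fun i hi hi' => hp i hi⟩
    intro i hi
    obtain rfl : i = 0 := by omega
    rw [← coeff_zero_mul_one_add_X_mul p y]
    exact hp 0 (by omega)
  · rintro j s' ⟨-, h6, -⟩
    exact ⟨h6, rfl⟩
  · rintro j s₁ hj ⟨-, h6, h4, h5, hmem, hfr, hlo, hhi⟩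
    refine Runs.forLoop (N := j + 1) (T₁ := 26)
      (fun l s' => l ≤ j + 1 ∧ s'.reg 7 = l ∧ s'.reg 6 = j ∧ s'.reg 4 = P ∧ s'.reg 5 = Y ∧
        s'.mem = s.mem ∧ (∀ x, x < P ∨ P + (m + 1) ≤ x → s'.fld x = s.fld x) ∧
        (∀ t ≤ j, s'.fld (P + t) = coeff t p) ∧
        (s'.fld (P + (j + 1)) = coeff (j + 1) (p * (1 + X * y)) -
          ∑ t ∈ Finset.range l, coeff t p * coeff (j - t) y) ∧
        ∀ t ≤ m, j + 1 < t → s'.fld (P + t) = coeff t (p * (1 + X * y))) ?_ ?_ ?_ ?_ ?_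
    · refine ⟨by omega, by simp, by simp [h6], by simp [h4], by simp [h5], hmem, hfr,
        hlo, ?_, fun t ht ht' => hhi t ht (by omega)⟩
      simp [hhi (j + 1) (by omega) (by omega)]
    · rintro l s₂ ⟨-, h7, h6, -⟩
      exact ⟨h7, by simp only [IExp.eval, h6]⟩
    · rintro l s₂ hl ⟨-, h7, h6, h4, h5, hmem, hfr, hlo, hmid, hhi⟩
      refine Runs.setFld (by simp [IExp.cost, FExp.cost]) (by simp [FExp.Defined]) ?_
      simp only [FExp.eval, IExp.eval, h4, h5, h6, h7]
      refine ⟨trivial, by omega, by simp, by simp [h6], by simp [h4], by simp [h5], hmem, ?_, ?_, ?_,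
        ?_⟩
      · intro x hx
        rw [Function.update_of_ne (by omega), hfr x hx]
      · intro t ht
        rw [Function.update_of_ne (by omega), hlo t ht]
      · rw [Function.update_self, hmid, hlo l (by omega), hfr _ (hPY _ (by omega)),
          hy _ (by omega), Finset.sum_range_succ]
        ring
      · intro t ht ht'
        rw [Function.update_of_ne (by omega), hhi t ht ht']
    · rintro s₂ ⟨-, h7, h6, h4, h5, hmem, hfr, hlo, hmid, hhi⟩
      refine ⟨h6, by omega, by simp, by simp [h4], by simp [h5], hmem, hfr, ?_, hhi⟩
      intro t ht
      rcases Nat.lt_or_ge j t with h | h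
      · obtain rfl : t = j + 1 := by omega
        rw [hmid, coeff_succ_mul_one_add_X_mul]
        ring
      · exact hlo t h
    · simp only [IExp.cost]
      omega
  · rintro s' ⟨-, -, -, -, hmem, hfr, hlo, hhi⟩
    exact ⟨hmem, hfr, fun i hi => hlo i hi⟩
  · simp only [IExp.cost]
    nlinarith

/-- Call the multiplication procedure. -/
def callMul (P Y : IExp) : Stmt := .seq (.setReg 4 P) (.seq (.setReg 5 Y) (.call 1))

/-- Call the division procedure. -/
def callDiv (P Y : IExp) : Stmt := .seq (.setReg 4 P) (.seq (.setReg 5 Y) (.call 2))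

/-- The arguments are put into registers 4 and 5 of the caller, while the counters 6 and 7 are
restored on return; `Updates` makes no promise about these four. -/
theorem Runs.callMul (h1 : procs[1]? = some AlgRAM.mulStmt) {Pe Ye : IExp} {s : State}
    {P Y T : ℕ} {p y : ℂ⟦X⟧} (hP : Pe.eval inp s = P)
    (hY : Ye.eval inp { s with reg := Function.update s.reg 4 P } = Y)
    (hp : Holds s.fld P inp.m p) (hy : ∀ t < inp.m, s.fld (Y + t) = coeff t y)
    (hPY : ∀ t < inp.m, Y + t < P ∨ P + (inp.m + 1) ≤ Y + t)
    (hT : Pe.cost + Ye.cost + 3 + 60 * (inp.m + 1) ^ 2 ≤ T) :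
    Runs inp procs (AlgRAM.callMul Pe Ye) s T (Updates s P inp.m (p * (1 + X * y))) := by
  have hs : Runs inp procs (.call 1)
      ⟨Function.update (Function.update s.reg 4 P) 5 Y, s.mem, s.fld⟩
      (60 * (inp.m + 1) ^ 2 + 1) (Updates s P inp.m (p * (1 + X * y))) := by
    refine Runs.call h1 (T₁ := 60 * (inp.m + 1) ^ 2) ((Runs.mulStmt
      (s := ⟨Function.update (Function.update s.reg 4 P) 5 Y, s.mem, s.fld⟩)
      (P := P) (Y := Y) (p := p) (y := y) (by simp) (by simp) hp hy hPY le_rfl).mono le_rfl ?_) le_rfl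
    rintro s' ⟨a1, a2, a3⟩
    refine ⟨?_, a1, a2, a3⟩
    intro r hr
    simp only
    rw [Function.update_of_ne (by omega), Function.update_of_ne (by omega)]
  refine Runs.seq (T₁ := Pe.cost + 1) (T₂ := (Ye.cost + 1) + (60 * (inp.m + 1) ^ 2 + 1))
    (Q₁ := fun s' => s' = ⟨Function.update s.reg 4 P, s.mem, s.fld⟩)
    (Runs.setReg le_rfl (by rw [hP])) ?_ (by omega)
  rintro _ rfl
  refine Runs.seq (T₁ := Ye.cost + 1) (T₂ := 60 * (inp.m + 1) ^ 2 + 1)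
    (Q₁ := fun s' => s' = ⟨Function.update (Function.update s.reg 4 P) 5 Y, s.mem, s.fld⟩)
    (Runs.setReg le_rfl (by rw [← hY])) ?_ le_rfl
  rintro _ rfl
  exact hs

theorem Runs.callDiv (h2 : procs[2]? = some AlgRAM.divStmt) {Pe Ye : IExp} {s : State}
    {P Y T : ℕ} {p y : ℂ⟦X⟧} (hP : Pe.eval inp s = P)
    (hY : Ye.eval inp { s with reg := Function.update s.reg 4 P } = Y)
    (hp : Holds s.fld P inp.m (p * (1 + X * y))) (hy : ∀ t < inp.m, s.fld (Y + t) = coeff t y)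
    (hPY : ∀ t < inp.m, Y + t < P ∨ P + (inp.m + 1) ≤ Y + t)
    (hT : Pe.cost + Ye.cost + 3 + 60 * (inp.m + 1) ^ 2 ≤ T) :
    Runs inp procs (AlgRAM.callDiv Pe Ye) s T (Updates s P inp.m p) := by
  have hs : Runs inp procs (.call 2)
      ⟨Function.update (Function.update s.reg 4 P) 5 Y, s.mem, s.fld⟩
      (60 * (inp.m + 1) ^ 2 + 1) (Updates s P inp.m p) := by
    refine Runs.call h2 (T₁ := 60 * (inp.m + 1) ^ 2) ((Runs.divStmt
      (s := ⟨Function.update (Function.update s.reg 4 P) 5 Y, s.mem, s.fld⟩)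
      (P := P) (Y := Y) (p := p) (y := y) (by simp) (by simp) hp hy hPY le_rfl).mono le_rfl ?_) le_rfl
    rintro s' ⟨a1, a2, a3⟩
    refine ⟨?_, a1, a2, a3⟩
    intro r hr
    simp only
    rw [Function.update_of_ne (by omega), Function.update_of_ne (by omega)]
  refine Runs.seq (T₁ := Pe.cost + 1) (T₂ := (Ye.cost + 1) + (60 * (inp.m + 1) ^ 2 + 1))
    (Q₁ := fun s' => s' = ⟨Function.update s.reg 4 P, s.mem, s.fld⟩)
    (Runs.setReg le_rfl (by rw [hP])) ?_ (by omega)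
  rintro _ rfl
  refine Runs.seq (T₁ := Ye.cost + 1) (T₂ := 60 * (inp.m + 1) ^ 2 + 1)
    (Q₁ := fun s' => s' = ⟨Function.update (Function.update s.reg 4 P) 5 Y, s.mem, s.fld⟩)
    (Runs.setReg le_rfl (by rw [← hY])) ?_ le_rfl
  rintro _ rfl
  exact hs

/-! ### Addresses of blocks -/

/-- The expression `m + 1`. -/
def stride : IExp := .add .level (.const 1)

/-- The address of the block number `c` from `e` on. -/
def blk (e : IExp) (c : ℕ) : IExp := .add e (.times c stride)

/-- The address of the cell number `reg 6` in the block number `c` from `e` on. -/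
def cell (e : IExp) (c : ℕ) : IExp := .add (blk e c) (.reg 6)

@[simp]
theorem stride_eval (s : State) : stride.eval inp s = inp.m + 1 := rfl

@[simp]
theorem stride_cost : stride.cost = 3 := rfl

@[simp]
theorem blk_eval (e : IExp) (c : ℕ) (s : State) :
    (blk e c).eval inp s = e.eval inp s + c * (inp.m + 1) := by
  simp [blk, IExp.eval]

@[simp]
theorem blk_cost (e : IExp) (c : ℕ) : (blk e c).cost = e.cost + 4 * c + 2 := by
  simp only [blk, IExp.cost, IExp.times_cost, stride_cost]
  omega

@[simp]
theorem cell_eval (e : IExp) (c : ℕ) (s : State) :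
    (cell e c).eval inp s = e.eval inp s + c * (inp.m + 1) + s.reg 6 := by
  simp [cell, IExp.eval]

@[simp]
theorem cell_cost (e : IExp) (c : ℕ) : (cell e c).cost = e.cost + 4 * c + 4 := by
  simp only [cell, IExp.cost, blk_cost]

/-- The hypothesis `he` speaks of an arbitrary state with the properties that hold in round `i`, so
that users need not handle `write`. The constant is `14` per cell plus `7` for the loop. -/
theorem Runs.fillBlock {be : IExp} {c : ℕ} {e : FExp} {s : State} {T d : ℕ} {p : ℂ⟦X⟧}
    (hd : ∀ i f, be.eval inp ⟨Function.update s.reg 6 i, s.mem, f⟩ + c * (inp.m + 1) = d)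
    (he : ∀ i, i ≤ inp.m → ∀ s' : State, s'.reg 6 = i → (∀ r, r ≠ 6 → s'.reg r = s.reg r) →
      s'.mem = s.mem → (∀ x, x < d ∨ d + (inp.m + 1) ≤ x → s'.fld x = s.fld x) →
      (∀ j < i, s'.fld (d + j) = coeff j p) → s'.fld (d + i) = s.fld (d + i) →
      e.Defined inp s' ∧ e.eval inp s' = coeff i p)
    (hT : (be.cost + 4 * c + e.cost + 21) * (inp.m + 1) ^ 2 ≤ T) :
    Runs inp procs (AlgRAM.fill 6 stride (cell be c) e) s T (Updates s d inp.m p) := by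
  refine Runs.fill (N := inp.m + 1) (d := d) (fun i => coeff i p) (fun _ _ => rfl) ?_ ?_ ?_ ?_
  · intro i f
    rw [cell_eval, hd]
    simp
  · intro i hi
    refine he i (by omega) _ (by simp) (fun r hr => by simp [hr]) rfl ?_ ?_ ?_
    · intro x hx
      exact write_of_notMem s.fld d i (fun i => coeff i p) x (by omega)
    · intro j hj
      exact write_add s.fld d i (fun i => coeff i p) j hj
    · exact write_of_notMem s.fld d i (fun i => coeff i p) (d + i) (by omega)
  · refine ⟨fun r hr => ?_, rfl, fun x hx => ?_, fun i hi => ?_⟩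
    · simp only
      rw [Function.update_of_ne (by omega)]
    · exact write_of_notMem s.fld d (inp.m + 1) (fun i => coeff i p) x hx
    · exact write_add s.fld d (inp.m + 1) (fun i => coeff i p) i (by omega)
  · refine le_trans ?_ hT
    simp only [cell_cost, stride_cost]
    nlinarith [Nat.zero_le ((be.cost + 4 * c + e.cost) * inp.m * (inp.m + 1))]

end

end AlgRAM

/-! ### The recursive procedure for approximate marginals -/

namespace AlgRAM

open PowerSeries PartitionSeries

section

variable {q : ℕ} {inp : Input q} {procs : List Stmt}

/-- The matrix `A - J`. -/
abbrev Input.offset (inp : Input q) : Matrix (Fin q) (Fin q) ℂ := inp.A - onesMatrix q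

/-- The number of the block that holds the weight of colour `c` at vertex `u`. -/
def weightBlock (q u c : ℕ) : ℕ := 2 + q * q + u * q + c

/-- The number of the first block after the weights. -/
def topBlock (inp : Input q) : ℕ := 2 + q * q + inp.n * q

/-- The complex memory cells that are not used for weights. -/
def Outside (inp : Input q) (x : ℕ) : Prop :=
  x < (2 + q * q) * (inp.m + 1) ∨ topBlock inp * (inp.m + 1) ≤ x

theorem block_add_le {b b' : ℕ} (m : ℕ) (h : b < b') : b * (m + 1) + (m + 1) ≤ b' * (m + 1) := by
  rw [← Nat.succ_mul]
  exact Nat.mul_le_mul_right _ h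

theorem block_disjoint {b b' : ℕ} (m : ℕ) (h : b ≠ b') (x : ℕ) (h1 : b * (m + 1) ≤ x)
    (h2 : x < b * (m + 1) + (m + 1)) : x < b' * (m + 1) ∨ b' * (m + 1) + (m + 1) ≤ x := by
  rcases Nat.lt_or_gt_of_ne h with h | h <;> have := block_add_le m h <;> omega

theorem mul_add_lt_mul {u n c q : ℕ} (hu : u < n) (hc : c < q) : u * q + c < n * q :=
  lt_of_lt_of_le (Nat.add_lt_add_left hc _)
    (by rw [← Nat.succ_mul]; exact Nat.mul_le_mul_right _ hu)

theorem weightBlock_inj {u u' c c' : ℕ} (hc : c < q) (hc' : c' < q)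
    (h : weightBlock q u c = weightBlock q u' c') : u = u' ∧ c = c' := by
  have h' : u * q + c = u' * q + c' := by unfold weightBlock at h; omega
  have hq : 0 < q := by omega
  have h1 : ∀ u c, c < q → (u * q + c) / q = u := fun u c hc => by
    rw [mul_comm, Nat.mul_add_div hq, Nat.div_eq_of_lt hc, add_zero]
  have hu : u = u' := by rw [← h1 u c hc, h', h1 u' c' hc']
  subst hu
  exact ⟨rfl, by omega⟩

/-- The memory represents the active set `U`, the weights `w` and the matrix `A - J`. -/
structure Inv (inp : Input q) (U : Finset (Fin inp.n)) (w : Fin inp.n → Fin q → ℂ⟦X⟧)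
    (s : State) : Prop where
  base : ∀ u : Fin inp.n, s.mem u = (2 + q * q + u * q) * (inp.m + 1)
  flag : ∀ u : Fin inp.n, s.mem (inp.n + u) = if u ∈ U then 0 else 1
  weight : ∀ (u : Fin inp.n) (c : Fin q),
    Holds s.fld (weightBlock q u c * (inp.m + 1)) inp.m (w u c)
  mat : ∀ c c' : Fin q,
    Holds s.fld ((2 + (c * q + c')) * (inp.m + 1)) inp.m (C (inp.offset c c'))

theorem weightBlock_add_le (u : Fin inp.n) (c : Fin q) :
    weightBlock q u c * (inp.m + 1) + (inp.m + 1) ≤ topBlock inp * (inp.m + 1) := by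
  refine block_add_le _ ?_
  have := mul_add_lt_mul u.2 c.2
  unfold weightBlock topBlock
  omega

theorem le_weightBlock (u : ℕ) (c : ℕ) :
    (2 + q * q) * (inp.m + 1) ≤ weightBlock q u c * (inp.m + 1) := by
  refine Nat.mul_le_mul_right _ ?_
  unfold weightBlock
  omega

theorem matBlock_add_le (c c' : Fin q) :
    (2 + (c * q + c')) * (inp.m + 1) + (inp.m + 1) ≤ (2 + q * q) * (inp.m + 1) := by
  refine block_add_le _ ?_
  have := mul_add_lt_mul c.2 c'.2
  omega

theorem le_topBlock : (2 + q * q) * (inp.m + 1) ≤ topBlock inp * (inp.m + 1) :=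
  Nat.mul_le_mul_right _ (by unfold topBlock; omega)

/-- Frames lie above `topBlock`, so writing to them cannot disturb the represented data. -/
theorem Inv.congr {U : Finset (Fin inp.n)} {w : Fin inp.n → Fin q → ℂ⟦X⟧} {s s' : State}
    (h : Inv inp U w s) (hm : s'.mem = s.mem)
    (hf : ∀ x < topBlock inp * (inp.m + 1), s'.fld x = s.fld x) : Inv inp U w s' where
  base u := by rw [hm, h.base]
  flag u := by rw [hm, h.flag]
  weight u c := (h.weight u c).congr fun x _ h2 => hf x (by
    have := weightBlock_add_le (inp := inp) u c
    omega)
  mat c c' := (h.mat c c').congr fun x _ h2 => hf x (by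
    have := matBlock_add_le (inp := inp) c c'
    have := le_topBlock (inp := inp)
    omega)

theorem Inv.setWeight {U : Finset (Fin inp.n)} {w w' : Fin inp.n → Fin q → ℂ⟦X⟧} {s s' : State}
    {v : Fin inp.n} {c : Fin q} {p : ℂ⟦X⟧} (h : Inv inp U w s)
    (hu : Updates s (weightBlock q v c * (inp.m + 1)) inp.m p s')
    (hw : ∀ v' d, w' v' d = if v' = v ∧ d = c then p else w v' d) : Inv inp U w' s' where
  base u := by rw [hu.mem, h.base]
  flag u := by rw [hu.mem, h.flag]
  weight u d := by
    rw [hw]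
    split_ifs with hud
    · rw [hud.1, hud.2]
      exact hu.holds
    · refine (h.weight u d).congr fun x h1 h2 => hu.frame x ?_
      refine block_disjoint _ (fun he => hud ?_) x h1 h2
      obtain ⟨e1, e2⟩ := weightBlock_inj d.2 c.2 he
      exact ⟨Fin.ext e1, Fin.ext e2⟩
  mat c₁ c₂ := (h.mat c₁ c₂).congr fun x _ h2 => hu.frame x (by
    have := matBlock_add_le (inp := inp) c₁ c₂
    have := le_weightBlock (q := q) (inp := inp) v c
    omega)

theorem Outside.not_mem {x : ℕ} (h : Outside inp x) (v : Fin inp.n) (c : Fin q) :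
    x < weightBlock q v c * (inp.m + 1) ∨ weightBlock q v c * (inp.m + 1) + (inp.m + 1) ≤ x := by
  have := weightBlock_add_le (inp := inp) v c
  have := le_weightBlock (q := q) (inp := inp) v c
  unfold Outside at h
  omega

/-- A bound for the number of steps of an elementary operation on series. -/
def unitTime (inp : Input q) : ℕ := 200 * (q + 1) ^ 2 * (inp.m + 1) ^ 2

theorem mul_le_unitTime {K : ℕ} (hK : K ≤ 200 * (q + 1) ^ 2) :
    K * (inp.m + 1) ^ 2 ≤ unitTime inp := Nat.mul_le_mul_right _ hK

theorem add_mul_le_unitTime {a : ℕ} (hK : a + 60 ≤ 200 * (q + 1) ^ 2) :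
    a + 60 * (inp.m + 1) ^ 2 ≤ unitTime inp := by
  refine le_trans ?_ (mul_le_unitTime hK)
  have : 1 ≤ (inp.m + 1) ^ 2 := Nat.one_le_pow _ _ (by omega)
  nlinarith [Nat.mul_le_mul_left a this]

theorem le_unitTime {K : ℕ} (hK : K ≤ 200 * (q + 1) ^ 2) : K ≤ unitTime inp := by
  refine le_trans ?_ (mul_le_unitTime hK)
  exact Nat.le_mul_of_pos_right _ (by positivity)

/-! ### Pinning and unpinning in place -/

/-- Multiply the weights of the vertex `reg 8` by the factors of colour `c`. -/
def pinStmt (q c : ℕ) : Stmt := unroll q fun c' =>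
  callMul (blk (.load (.reg 8)) c') (.times (2 + (c * q + c')) stride)

/-- Divide the weights of the vertex `reg 8` by the factors of colour `c`. -/
def unpinStmt (q c : ℕ) : Stmt := unroll q fun c' =>
  callDiv (blk (.load (.reg 8)) c') (.times (2 + (c * q + c')) stride)

theorem pin_cost_le {c c' : ℕ} (hc : c < q) (hc' : c' < q) :
    (blk (.load (.reg 8)) c').cost + (IExp.times (2 + (c * q + c')) stride).cost + 3 + 60 ≤
      200 * (q + 1) ^ 2 := by
  have := mul_add_lt_mul hc hc'
  simp only [blk_cost, IExp.times_cost, IExp.cost, stride_cost]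
  nlinarith

theorem Runs.pinStmt (h1 : procs[1]? = some AlgRAM.mulStmt) {U : Finset (Fin inp.n)}
    {w : Fin inp.n → Fin q → ℂ⟦X⟧} {s : State} {v : Fin inp.n} (c : Fin q) (hI : Inv inp U w s)
    (hv : s.reg 8 = v) :
    Runs inp procs (AlgRAM.pinStmt q c) s (q * unitTime inp + 1) fun s' =>
      Inv inp U (pin inp.offset c v w) s' ∧ (∀ r, r < 4 ∨ 8 ≤ r → s'.reg r = s.reg r) ∧
      ∀ x, Outside inp x → s'.fld x = s.fld x := by
  refine Runs.unroll (T₁ := unitTime inp) (fun k s' =>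
    Inv inp U (fun v' d => if v' = v ∧ d < k then w v' d * (1 + X * C (inp.offset c d))
      else w v' d) s' ∧ (∀ r, r < 4 ∨ 8 ≤ r → s'.reg r = s.reg r) ∧
      ∀ x, Outside inp x → s'.fld x = s.fld x) ?_ ?_ ?_ le_rfl
  · exact ⟨by simpa using hI, fun _ _ => rfl, fun _ _ => rfl⟩
  · rintro k s₁ hk ⟨hI₁, hr₁, hf₁⟩
    have hreg : s₁.reg 8 = v := by rw [hr₁ 8 (by omega), hv]
    have hw := hI₁.weight v ⟨k, hk⟩
    simp only [true_and, lt_irrefl, if_false] at hw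
    have hm := hI₁.mat c ⟨k, hk⟩
    refine (Runs.callMul h1 (P := weightBlock q v k * (inp.m + 1))
      (Y := (2 + (c * q + k)) * (inp.m + 1)) (y := C (inp.offset c ⟨k, hk⟩)) ?_ ?_ hw
      (fun t ht => hm t ht.le) (fun t ht => ?_)
      (add_mul_le_unitTime (pin_cost_le c.2 hk))).mono le_rfl ?_
    · simp only [blk_eval, IExp.eval, hreg, hI₁.base, weightBlock]
      ring
    · simp
    · have := matBlock_add_le (inp := inp) c ⟨k, hk⟩
      have := le_weightBlock (q := q) (inp := inp) v k
      simp only at *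
      omega
    · intro s₂ hu
      refine ⟨hI₁.setWeight (c := ⟨k, hk⟩) hu ?_, fun r hr => by rw [hu.reg r hr, hr₁ r hr],
        fun x hx => by rw [hu.frame x (hx.not_mem v ⟨k, hk⟩), hf₁ x hx]⟩
      intro v' d
      by_cases hv' : v' = v
      · subst hv'
        by_cases hd : d = ⟨k, hk⟩
        · subst hd; simp
        · have : (d : ℕ) ≠ k := fun h => hd (Fin.ext h)
          have h2 : (d : ℕ) < k + 1 ↔ (d : ℕ) < k := by omega
          simp [hd, h2]
      · simp [hv']
  · rintro s' ⟨hI', hr, hf⟩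
    refine ⟨?_, hr, hf⟩
    convert hI' using 1
    funext v' d
    simp [pin]

/-- Truncated division by $1+Xa$ exactly inverts the truncated multiplication, so the earlier
weights reappear in memory without having been saved. -/
theorem Runs.unpinStmt (h2 : procs[2]? = some AlgRAM.divStmt) {U : Finset (Fin inp.n)}
    {w : Fin inp.n → Fin q → ℂ⟦X⟧} {s : State} {v : Fin inp.n} (c : Fin q)
    (hI : Inv inp U (pin inp.offset c v w) s) (hv : s.reg 8 = v) :
    Runs inp procs (AlgRAM.unpinStmt q c) s (q * unitTime inp + 1) fun s' =>
      Inv inp U w s' ∧ (∀ r, r < 4 ∨ 8 ≤ r → s'.reg r = s.reg r) ∧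
      ∀ x, Outside inp x → s'.fld x = s.fld x := by
  refine Runs.unroll (T₁ := unitTime inp) (fun k s' =>
    Inv inp U (fun v' d => if v' = v ∧ ¬ d < k then w v' d * (1 + X * C (inp.offset c d))
      else w v' d) s' ∧ (∀ r, r < 4 ∨ 8 ≤ r → s'.reg r = s.reg r) ∧
      ∀ x, Outside inp x → s'.fld x = s.fld x) ?_ ?_ ?_ le_rfl
  · refine ⟨?_, fun _ _ => rfl, fun _ _ => rfl⟩
    convert hI using 1
    funext v' d
    simp [pin]
  · rintro k s₁ hk ⟨hI₁, hr₁, hf₁⟩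
    have hreg : s₁.reg 8 = v := by rw [hr₁ 8 (by omega), hv]
    have hw := hI₁.weight v ⟨k, hk⟩
    simp only [true_and, lt_irrefl, not_false_eq_true, if_true] at hw
    have hm := hI₁.mat c ⟨k, hk⟩
    refine (Runs.callDiv h2 (P := weightBlock q v k * (inp.m + 1))
      (Y := (2 + (c * q + k)) * (inp.m + 1)) (y := C (inp.offset c ⟨k, hk⟩)) ?_ ?_ hw
      (fun t ht => hm t ht.le) (fun t ht => ?_)
      (add_mul_le_unitTime (pin_cost_le c.2 hk))).mono le_rfl ?_
    · simp only [blk_eval, IExp.eval, hreg, hI₁.base, weightBlock]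
      ring
    · simp
    · have := matBlock_add_le (inp := inp) c ⟨k, hk⟩
      have := le_weightBlock (q := q) (inp := inp) v k
      simp only at *
      omega
    · intro s₂ hu
      refine ⟨hI₁.setWeight (c := ⟨k, hk⟩) hu ?_, fun r hr => by rw [hu.reg r hr, hr₁ r hr],
        fun x hx => by rw [hu.frame x (hx.not_mem v ⟨k, hk⟩), hf₁ x hx]⟩
      intro v' d
      by_cases hv' : v' = v
      · subst hv'
        by_cases hd : d = ⟨k, hk⟩
        · subst hd; simp
        · have : (d : ℕ) ≠ k := fun h => hd (Fin.ext h)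
          have h2 : (d : ℕ) < k + 1 ↔ (d : ℕ) < k := by omega
          simp only [hd, h2, and_false, if_false]
      · simp [hv']
  · rintro s' ⟨hI', hr, hf⟩
    refine ⟨?_, hr, hf⟩
    convert hI' using 1
    funext v' d
    simp

/-- Run `body` for all active neighbours of the vertex `reg 0`, which are put into `reg 8`. -/
def nbrLoop (body : Stmt) : Stmt :=
  forLoop 3 (.deg (.reg 0)) (.seq (.setReg 8 (.nbr (.reg 0) (.reg 3)))
    (.ite (.eq (.load (.add .order (.reg 8))) (.const 0)) body .skip))

theorem deg_eval {s : State} {u : Fin inp.n} (h : s.reg 0 = u) :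
    (IExp.deg (.reg 0)).eval inp s = (inp.nbrs u).length := by
  simp [IExp.eval, h]

theorem nbr_eval {s : State} {u : Fin inp.n} {j : ℕ} (h : s.reg 0 = u) (hj : s.reg 3 = j)
    (hlt : j < (inp.nbrs u).length) :
    (IExp.nbr (.reg 0) (.reg 3)).eval inp s = ((inp.nbrs u)[j] : ℕ) := by
  simp [IExp.eval, h, hj, hlt]

/-- By `hcongr` the invariant sees only registers 0, 1, 2 and the memories, which leaves register 3
free for the counter and register 8 for the neighbour. -/
theorem Runs.nbrLoop {body : Stmt} {s : State} {u : Fin inp.n} {U : Finset (Fin inp.n)}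
    {T₁ T : ℕ} {Q : State → Prop} (I : ℕ → State → Prop) (h0 : I 0 s)
    (hreg : ∀ j s, I j s → s.reg 0 = u ∧
      ∀ v : Fin inp.n, s.mem (inp.n + v) = if v ∈ U then 0 else 1)
    (hcongr : ∀ j s s', I j s → (∀ r < 3, s'.reg r = s.reg r) → s'.mem = s.mem →
      s'.fld = s.fld → I j s')
    (hbody : ∀ j (hj : j < (inp.nbrs u).length) s, I j s → s.reg 8 = ((inp.nbrs u)[j] : ℕ) →
      (inp.nbrs u)[j] ∈ U →
      Runs inp procs body s T₁ fun s' => s'.reg 3 = s.reg 3 ∧ I (j + 1) s')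
    (hskip : ∀ j (hj : j < (inp.nbrs u).length) s, I j s → (inp.nbrs u)[j] ∉ U → I (j + 1) s)
    (hQ : ∀ s, I (inp.nbrs u).length s → Q s)
    (hT : (inp.nbrs u).length * (T₁ + 30) + 10 ≤ T) :
    Runs inp procs (AlgRAM.nbrLoop body) s T Q := by
  refine Runs.forLoop (N := (inp.nbrs u).length) (T₁ := T₁ + 15)
    (fun j s' => s'.reg 3 = j ∧ I j s') ?_ ?_ ?_ (fun s' h => hQ s' h.2) ?_
  · refine ⟨by simp, hcongr 0 s _ h0 (fun r hr => ?_) rfl rfl⟩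
    simp only
    rw [Function.update_of_ne (by omega)]
  · rintro j s₁ ⟨h3, hI⟩
    exact ⟨h3, deg_eval (hreg j s₁ hI).1⟩
  · rintro j s₁ hj ⟨h3, hI⟩
    obtain ⟨hu, -⟩ := hreg j s₁ hI
    refine Runs.seq (T₁ := 4) (T₂ := T₁ + 8)
      (Q₁ := fun s' => s'.reg 3 = j ∧ I j s' ∧ s'.reg 8 = ((inp.nbrs u)[j] : ℕ))
      (Runs.setReg (by simp [IExp.cost]) ?_) ?_ (by omega)
    · rw [nbr_eval hu h3 hj]
      refine ⟨by simp [h3], hcongr j s₁ _ hI (fun r hr => ?_) rfl rfl, by simp⟩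
      simp only
      rw [Function.update_of_ne (by omega)]
    · rintro s₂ ⟨h3, hI, h8⟩
      have hfl := (hreg j s₂ hI).2 (inp.nbrs u)[j]
      have hpost : ∀ s' : State, s'.reg 3 = j → I (j + 1) s' → s'.reg 3 = j ∧
          Function.update s'.reg 3 (j + 1) 3 = j + 1 ∧
            I (j + 1) { s' with reg := Function.update s'.reg 3 (j + 1) } := by
        intro s' h3' hI'
        refine ⟨h3', by simp, hcongr _ _ _ hI' (fun r hr => ?_) rfl rfl⟩
        simp only
        rw [Function.update_of_ne (by omega)]
      refine Runs.ite (T₁ := T₁ + 1) (fun hb => ?_) (fun hb => ?_)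
        (by simp [BExp.cost, IExp.cost]; omega)
      · have hU : (inp.nbrs u)[j] ∈ U := by
          by_contra hU
          simp [BExp.eval, IExp.eval, h8, hfl, hU] at hb
        refine (hbody j hj s₂ hI h8 hU).mono (by omega) ?_
        rintro s' ⟨h3', hI'⟩
        exact hpost s' (h3'.trans h3) hI'
      · have hU : (inp.nbrs u)[j] ∉ U := by
          intro hU
          simp [BExp.eval, IExp.eval, h8, hfl, hU] at hb
        exact Runs.skip (by omega) (hpost s₂ h3 (hskip j hj s₂ hI hU))
  · refine le_trans ?_ hT
    simp only [IExp.cost]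
    nlinarith [Nat.zero_le (inp.nbrs u).length]

end

end AlgRAM

/-! ### Scanning the neighbours of a vertex -/

namespace AlgRAM

open PowerSeries PartitionSeries

section

variable {q : ℕ} {inp : Input q} {procs : List Stmt}

/-- The series `∑ a_{c c'} M_{c'}`, where `M` is in the frame after the one at `reg 2`. -/
def sumExp (q c : ℕ) : FExp := FExp.sum q fun c' =>
  .mul (.sub (.entry (.const c) (.const c')) .one) (.load (cell (.reg 2) (q + 2 + c')))

/-- Compute the marginals of the active neighbour `reg 8`, multiply the ratio of colour `c` by the
resulting factor, and pin the neighbour. -/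
def scanStmt (q c : ℕ) : Stmt :=
  .seq (.call 3) (.seq (fill 6 stride (cell (.reg 2) (q + 1)) (sumExp q c))
    (.seq (callMul (blk (.reg 2) c) (blk (.reg 2) (q + 1))) (pinStmt q c)))

/-- The recursive procedure: for the vertex `reg 0`, depth `reg 1` and frame address `reg 2`,
compute the approximate marginals and their normalising factor. -/
def margBody (q : ℕ) : Stmt :=
  .seq (unroll q fun c => fill 6 stride (cell (.reg 2) c) (.load (cell (.load (.reg 0)) c)))
    (.seq (.ite (.lt (.const 0) (.reg 1))
      (.seq (.setMem (.add .order (.reg 0)) (.const 1))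
        (.seq (unroll q fun c => .seq (nbrLoop (scanStmt q c)) (nbrLoop (unpinStmt q c)))
          (.setMem (.add .order (.reg 0)) (.const 0)))) .skip)
    (.seq (fill 6 stride (cell (.reg 2) q) (FExp.sum q fun c => .load (cell (.reg 2) c)))
      (unroll q fun c => callDiv (blk (.reg 2) c) (.add (blk (.reg 2) q) (.const 1)))))

/-- Prepare the registers and call the recursive procedure. -/
def margCall (q : ℕ) : Stmt :=
  .seq (.setReg 0 (.reg 8)) (.seq (.setReg 1 (.sub (.reg 1) (.const 1)))
    (.seq (.setReg 2 (blk (.reg 2) (q + 2))) (.call 0)))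

/-- The procedures of the program. -/
def procedures (q : ℕ) : List Stmt := [margBody q, mulStmt, divStmt, margCall q]

/-- What the recursive procedure achieves. -/
structure MargPost (inp : Input q) (k : ℕ) (U : Finset (Fin inp.n))
    (w : Fin inp.n → Fin q → ℂ⟦X⟧) (u : Fin inp.n) (fp : ℕ) (s s' : State) : Prop where
  inv : Inv inp U w s'
  frame : ∀ x < fp, Outside inp x → s'.fld x = s.fld x
  marg : ∀ c : Fin q, Holds s'.fld (fp + c * (inp.m + 1)) inp.m (marg inp.offset inp.nbrs k U w u c)
  den : Holds s'.fld (fp + q * (inp.m + 1)) inp.m (den inp.offset inp.nbrs k U w u)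

/-- The specification of the recursive procedure at depth `k`, with time bound `T`. -/
def MargSpec (inp : Input q) (k T : ℕ) : Prop :=
  ∀ (U : Finset (Fin inp.n)) (w : Fin inp.n → Fin q → ℂ⟦X⟧) (s : State) (u : Fin inp.n) (fp : ℕ),
    u ∈ U → (∀ v c, constantCoeff (w v c) = (q : ℂ)⁻¹) → Inv inp U w s → s.reg 0 = u →
    s.reg 1 = k → s.reg 2 = fp → topBlock inp * (inp.m + 1) ≤ fp →
    Runs inp (procedures q) (margBody q) s T (MargPost inp k U w u fp s)

/-- The arguments of the recursive call are set inside a procedure of its own, so that the caller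
gets its vertex, depth and frame address back. The new frame starts `q + 2` blocks further, behind
the caller's numerators, their sum and the scratch series. -/
theorem Runs.margCall {k T T' : ℕ} (hspec : MargSpec inp k T) {U : Finset (Fin inp.n)}
    {w : Fin inp.n → Fin q → ℂ⟦X⟧} {s : State} {v : Fin inp.n} {fp : ℕ} (hv : v ∈ U)
    (hw : ∀ v c, constantCoeff (w v c) = (q : ℂ)⁻¹) (hI : Inv inp U w s)
    (h8 : s.reg 8 = v) (h1 : s.reg 1 = k + 1) (h2 : s.reg 2 = fp)
    (hfp : topBlock inp * (inp.m + 1) ≤ fp) (hT : T + 4 * q + 30 ≤ T') :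
    Runs inp (procedures q) (.call 3) s T' fun s' => s'.reg = s.reg ∧
      MargPost inp k U w v (fp + (q + 2) * (inp.m + 1)) s s' := by
  refine Runs.call (c := AlgRAM.margCall q) (T₁ := T + 4 * q + 25) rfl ?_ (by omega)
  refine Runs.seq (T₁ := 2) (T₂ := T + 4 * q + 22)
    (Q₁ := fun s' => s' = ⟨Function.update s.reg 0 v, s.mem, s.fld⟩)
    (Runs.setReg (by simp [IExp.cost]) (by simp [IExp.eval, h8])) ?_ (by omega)
  rintro _ rfl
  refine Runs.seq (T₁ := 4) (T₂ := T + 4 * q + 18)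
    (Q₁ := fun s' => s' = ⟨Function.update (Function.update s.reg 0 v) 1 k, s.mem, s.fld⟩)
    (Runs.setReg (by simp [IExp.cost]) (by simp [IExp.eval, h1])) ?_ (by omega)
  rintro _ rfl
  refine Runs.seq (T₁ := 4 * q + 12) (T₂ := T + 1)
    (Q₁ := fun s' => s' = ⟨Function.update (Function.update (Function.update s.reg 0 v) 1 k) 2
      (fp + (q + 2) * (inp.m + 1)), s.mem, s.fld⟩)
    (Runs.setReg (by simp [IExp.cost]; omega) (by simp [IExp.eval, h2])) ?_ (by omega)
  rintro _ rfl
  refine Runs.call (c := margBody q) (T₁ := T) rfl ?_ le_rfl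
  have hI' : Inv inp U w ⟨Function.update (Function.update (Function.update s.reg 0 v) 1 k) 2
      (fp + (q + 2) * (inp.m + 1)), s.mem, s.fld⟩ := hI.congr rfl fun _ _ => rfl
  refine (hspec U w _ v (fp + (q + 2) * (inp.m + 1)) hv hw hI' (by simp) (by simp) (by simp)
    (by omega)).mono le_rfl ?_
  intro s' hp
  exact ⟨rfl, hp.inv.congr rfl fun _ _ => rfl, hp.frame, hp.marg, hp.den⟩

theorem const_le_unitTime {K : ℕ} (hK : K ≤ 200) : K ≤ unitTime inp :=
  le_unitTime (hK.trans (Nat.le_mul_of_pos_right _ (by positivity)))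

theorem linear_le_sq {K : ℕ} (hK : K ≤ 200 * (q + 1)) : K ≤ 200 * (q + 1) ^ 2 :=
  hK.trans (Nat.mul_le_mul_left _ (Nat.le_self_pow (by omega) _))

theorem quadratic_le_sq {K : ℕ} (hK : K ≤ 100 * (q * q) + 200 * q + 200) :
    K ≤ 200 * (q + 1) ^ 2 := by
  have : 200 * (q + 1) ^ 2 = 200 * (q * q) + 400 * q + 200 := by ring
  omega

theorem sumExp_cost_le {c : ℕ} : (sumExp q c).cost ≤ q * (8 * q + 30) + 1 := by
  refine FExp.sum_cost_le q (8 * q + 29) _ fun c' hc' => ?_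
  simp only [FExp.cost, cell_cost, IExp.cost]
  omega

/-- Besides the recursive call the cost is one unit each for the call overhead, the sum and the
multiplication, and `q` units for the pins. -/
theorem Runs.scanStmt {k T : ℕ} (hspec : MargSpec inp k T) {U : Finset (Fin inp.n)}
    {w : Fin inp.n → Fin q → ℂ⟦X⟧} {s : State} {v : Fin inp.n} {fp : ℕ} (hv : v ∈ U)
    (hw : ∀ v c, constantCoeff (w v c) = (q : ℂ)⁻¹) (hI : Inv inp U w s)
    (h8 : s.reg 8 = v) (h1 : s.reg 1 = k + 1) (h2 : s.reg 2 = fp)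
    (hfp : topBlock inp * (inp.m + 1) ≤ fp) (c : Fin q) {p : ℂ⟦X⟧}
    (hp : Holds s.fld (fp + c * (inp.m + 1)) inp.m p) :
    Runs inp (procedures q) (AlgRAM.scanStmt q c) s (T + (q + 4) * unitTime inp) fun s' =>
      (∀ r, r < 4 ∨ 8 ≤ r → s'.reg r = s.reg r) ∧ Inv inp U (pin inp.offset c v w) s' ∧
      Holds s'.fld (fp + c * (inp.m + 1)) inp.m
        (p * (1 + X * ∑ c', C (inp.offset c c') * marg inp.offset inp.nbrs k U w v c')) ∧
      ∀ x < fp + q * (inp.m + 1),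
        (x < fp + c * (inp.m + 1) ∨ fp + c * (inp.m + 1) + (inp.m + 1) ≤ x) →
        Outside inp x → s'.fld x = s.fld x := by
  have hcq := block_add_le inp.m c.2
  have hq1 : (q + 1) * (inp.m + 1) = q * (inp.m + 1) + (inp.m + 1) := by ring
  have hq2 : (q + 2) * (inp.m + 1) = q * (inp.m + 1) + 2 * (inp.m + 1) := by ring
  have hu1 : 1 ≤ unitTime inp := const_le_unitTime (by omega)
  have hOut : ∀ x, fp ≤ x → Outside inp x := fun x hx => Or.inr (hfp.trans hx)
  refine Runs.seq (T₁ := T + unitTime inp) (T₂ := (q + 3) * unitTime inp)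
    (Runs.margCall hspec hv hw hI h8 h1 h2 hfp ?_) ?_ ?_
  · have := le_unitTime (q := q) (inp := inp) (K := 4 * q + 30)
      (linear_le_sq (by omega))
    omega
  · rintro s₁ ⟨hr₁, hm₁⟩
    have hI₁ := hm₁.inv
    have hp₁ : Holds s₁.fld (fp + c * (inp.m + 1)) inp.m p := hp.congr fun x h3 h4 =>
      hm₁.frame x (by omega) (hOut x (by omega))
    set y : ℂ⟦X⟧ := ∑ c', C (inp.offset c c') * marg inp.offset inp.nbrs k U w v c' with hy
    refine Runs.seq (T₁ := unitTime inp) (T₂ := (q + 2) * unitTime inp)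
      (Runs.fillBlock (d := fp + (q + 1) * (inp.m + 1)) (p := y) ?_ ?_
        (mul_le_unitTime ?_)) ?_ (by nlinarith)
    · intro i f
      simp [IExp.eval, hr₁, h2]
    · intro i hi s' h6 hr' hmem' hf' _ _
      refine ⟨FExp.sum_defined _ _ _ fun c' => by simp [FExp.Defined], ?_⟩
      rw [sumExp, FExp.sum_eval, Finset.sum_range, hy, map_sum]
      refine Finset.sum_congr rfl fun c' _ => ?_
      -- The marginals were left by the callee in its own frame, which starts at block `q + 2` of
      -- this one.
      have haddr : (cell (.reg 2) (q + 2 + c')).eval inp s' =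
          fp + (q + 2) * (inp.m + 1) + c' * (inp.m + 1) + i := by
        simp only [cell_eval, IExp.eval, h6, hr' 2 (by omega), hr₁, h2]
        ring
      simp only [FExp.eval, haddr, IExp.eval, c.2, c'.2, and_self, coeff_C_mul]
      rw [hf' _ (by omega), hm₁.marg c' i hi]
      simp [onesMatrix]
    · have := sumExp_cost_le (q := q) (c := c)
      have h3 : q * (8 * q + 30) = 8 * (q * q) + 30 * q := by ring
      refine quadratic_le_sq ?_
      simp only [IExp.cost]
      omega
    · intro s₂ hu₂
      have hI₂ : Inv inp U w s₂ := hI₁.congr hu₂.mem fun x hx => hu₂.frame x (by omega)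
      have hp₂ : Holds s₂.fld (fp + c * (inp.m + 1)) inp.m p := hp₁.congr fun x h3 h4 =>
        hu₂.frame x (by omega)
      have hreg2 : s₂.reg 2 = fp := by rw [hu₂.reg 2 (by omega), hr₁, h2]
      refine Runs.seq (T₁ := unitTime inp) (T₂ := q * unitTime inp + 1)
        (Runs.callMul rfl (P := fp + c * (inp.m + 1)) (Y := fp + (q + 1) * (inp.m + 1))
          (y := y) ?_ ?_ hp₂ (fun t ht => hu₂.holds t ht.le) (fun t ht => by omega)
          (add_mul_le_unitTime ?_)) ?_ (by nlinarith)
      · simp [IExp.eval, hreg2]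
      · simp [IExp.eval, hreg2]
      · have := c.2
        refine linear_le_sq ?_
        simp only [blk_cost, IExp.cost]
        omega
      · intro s₃ hu₃
        have hI₃ : Inv inp U w s₃ := hI₂.congr hu₃.mem fun x hx => hu₃.frame x (by omega)
        refine (Runs.pinStmt rfl c hI₃ (v := v) ?_).mono le_rfl ?_
        · rw [hu₃.reg 8 (by omega), hu₂.reg 8 (by omega), hr₁, h8]
        · rintro s₄ ⟨hI₄, hr₄, hf₄⟩
          refine ⟨fun r hr => ?_, hI₄, ?_, ?_⟩
          · rw [hr₄ r hr, hu₃.reg r hr, hu₂.reg r hr, hr₁]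
          · exact hu₃.holds.congr fun x h3 h4 => hf₄ x (hOut x (by omega))
          · intro x hx1 hx2 hx3
            rw [hf₄ x hx3, hu₃.frame x hx2, hu₂.frame x (by omega), hm₁.frame x (by omega) hx3]
  · have : (q + 4) * unitTime inp = (q + 3) * unitTime inp + unitTime inp := by ring
    omega

/-- After `j` rounds memory holds the two components of the fold of `scanStep` over the first `j`
neighbours. Cells of other colours in the frame are untouched, which keeps the numerators found
earlier. -/
theorem Runs.scanLoop {k T Δ T' : ℕ} (hspec : MargSpec inp k T) {U : Finset (Fin inp.n)}
    {w : Fin inp.n → Fin q → ℂ⟦X⟧} {s : State} {u : Fin inp.n} {fp : ℕ}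
    (hΔ : (inp.nbrs u).length ≤ Δ)
    (hw : ∀ v c, constantCoeff (w v c) = (q : ℂ)⁻¹) (hI : Inv inp U w s)
    (h0 : s.reg 0 = u) (h1 : s.reg 1 = k + 1) (h2 : s.reg 2 = fp)
    (hfp : topBlock inp * (inp.m + 1) ≤ fp) (c : Fin q) {p : ℂ⟦X⟧}
    (hp : Holds s.fld (fp + c * (inp.m + 1)) inp.m p)
    (hT : Δ * (T + (q + 5) * unitTime inp) + unitTime inp ≤ T') :
    Runs inp (procedures q) (AlgRAM.nbrLoop (AlgRAM.scanStmt q c)) s T' fun s' =>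
      (∀ r < 3, s'.reg r = s.reg r) ∧
      Inv inp U (pinList inp.offset U c (inp.nbrs u) w) s' ∧
      Holds s'.fld (fp + c * (inp.m + 1)) inp.m
        ((inp.nbrs u).foldl (scanStep inp.offset (marg inp.offset inp.nbrs k U) U c) (p, w)).1 ∧
      ∀ x < fp + q * (inp.m + 1),
        (x < fp + c * (inp.m + 1) ∨ fp + c * (inp.m + 1) + (inp.m + 1) ≤ x) →
        Outside inp x → s'.fld x = s.fld x := by
  set F := scanStep inp.offset (marg inp.offset inp.nbrs k U) U c with hF
  have hsucc : ∀ j (hj : j < (inp.nbrs u).length),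
      ((inp.nbrs u).take (j + 1)).foldl F (p, w) =
        F (((inp.nbrs u).take j).foldl F (p, w)) (inp.nbrs u)[j] := by
    intro j hj
    rw [List.take_add_one, List.getElem?_eq_getElem hj, List.foldl_append]
    rfl
  refine Runs.nbrLoop (u := u) (U := U) (T₁ := T + (q + 4) * unitTime inp) (fun j s' =>
    (∀ r < 3, s'.reg r = s.reg r) ∧
      Inv inp U (((inp.nbrs u).take j).foldl F (p, w)).2 s' ∧
      Holds s'.fld (fp + c * (inp.m + 1)) inp.m (((inp.nbrs u).take j).foldl F (p, w)).1 ∧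
      ∀ x < fp + q * (inp.m + 1),
        (x < fp + c * (inp.m + 1) ∨ fp + c * (inp.m + 1) + (inp.m + 1) ≤ x) →
        Outside inp x → s'.fld x = s.fld x) ?_ ?_ ?_ ?_ ?_ ?_ ?_
  · exact ⟨fun _ _ => rfl, hI, hp, fun _ _ _ _ => rfl⟩
  · rintro j s' ⟨hr, hI', -⟩
    exact ⟨by rw [hr 0 (by omega), h0], hI'.flag⟩
  · rintro j s₁ s₂ ⟨hr, hI', hp', hf'⟩ hr2 hm2 hf2
    refine ⟨fun r h => by rw [hr2 r h, hr r h], hI'.congr hm2 fun x _ => by rw [hf2], ?_, ?_⟩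
    · rw [hf2]; exact hp'
    · rw [hf2]; exact hf'
  · rintro j hj s₁ ⟨hr, hI', hp', hf'⟩ h8 hU
    have hw' : ∀ v c, constantCoeff ((((inp.nbrs u).take j).foldl F (p, w)).2 v c) =
        (q : ℂ)⁻¹ := by
      intro v c
      rw [hF, foldl_scanStep_snd, constantCoeff_pinList, hw]
    refine (Runs.scanStmt hspec hU hw' hI' h8 (by rw [hr 1 (by omega), h1])
      (by rw [hr 2 (by omega), h2]) hfp c hp').mono le_rfl ?_
    rintro s₂ ⟨hr₂, hI₂, hp₂, hf₂⟩
    refine ⟨hr₂ 3 (by omega), fun r h => by rw [hr₂ r (by omega), hr r h], ?_, ?_, ?_⟩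
    · rw [hsucc j hj, hF, scanStep, if_pos hU]
      exact hI₂
    · rw [hsucc j hj, hF, scanStep, if_pos hU]
      exact hp₂
    · intro x hx1 hx2 hx3
      rw [hf₂ x hx1 hx2 hx3, hf' x hx1 hx2 hx3]
  · rintro j hj s₁ ⟨hr, hI', hp', hf'⟩ hU
    have : ((inp.nbrs u).take (j + 1)).foldl F (p, w) =
        ((inp.nbrs u).take j).foldl F (p, w) := by
      rw [hsucc j hj, hF, scanStep, if_neg hU]
    rw [this]
    exact ⟨hr, hI', hp', hf'⟩
  · rintro s' ⟨hr, hI', hp', hf'⟩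
    rw [List.take_length] at hI' hp'
    rw [hF, foldl_scanStep_snd] at hI'
    exact ⟨hr, hI', hp', hf'⟩
  · have hu1 : 30 ≤ unitTime inp := const_le_unitTime (by omega)
    refine le_trans ?_ hT
    refine add_le_add (Nat.mul_le_mul hΔ ?_) (by omega)
    have : (q + 5) * unitTime inp = (q + 4) * unitTime inp + unitTime inp := by ring
    omega

/-- After `j` rounds exactly the pins of the neighbours from position `j` on are left. -/
theorem Runs.unpinLoop {Δ T' : ℕ} {U : Finset (Fin inp.n)}
    {w : Fin inp.n → Fin q → ℂ⟦X⟧} {s : State} {u : Fin inp.n}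
    (hΔ : (inp.nbrs u).length ≤ Δ) (h0 : s.reg 0 = u) (c : Fin q)
    (hI : Inv inp U (pinList inp.offset U c (inp.nbrs u) w) s)
    (hT : Δ * ((q + 2) * unitTime inp) + unitTime inp ≤ T') :
    Runs inp (procedures q) (AlgRAM.nbrLoop (AlgRAM.unpinStmt q c)) s T' fun s' =>
      (∀ r < 3, s'.reg r = s.reg r) ∧ Inv inp U w s' ∧
      ∀ x, Outside inp x → s'.fld x = s.fld x := by
  have hdrop : ∀ j (hj : j < (inp.nbrs u).length),
      pinList inp.offset U c ((inp.nbrs u).drop j) w = if (inp.nbrs u)[j] ∈ U then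
        pin inp.offset c (inp.nbrs u)[j] (pinList inp.offset U c ((inp.nbrs u).drop (j + 1)) w)
        else pinList inp.offset U c ((inp.nbrs u).drop (j + 1)) w := by
    intro j hj
    rw [List.drop_eq_getElem_cons hj, pinList_cons]
  refine Runs.nbrLoop (u := u) (U := U) (T₁ := q * unitTime inp + 1) (fun j s' =>
    (∀ r < 3, s'.reg r = s.reg r) ∧
      Inv inp U (pinList inp.offset U c ((inp.nbrs u).drop j) w) s' ∧
      ∀ x, Outside inp x → s'.fld x = s.fld x) ?_ ?_ ?_ ?_ ?_ ?_ ?_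
  · exact ⟨fun _ _ => rfl, hI, fun _ _ => rfl⟩
  · rintro j s' ⟨hr, hI', -⟩
    exact ⟨by rw [hr 0 (by omega), h0], hI'.flag⟩
  · rintro j s₁ s₂ ⟨hr, hI', hf'⟩ hr2 hm2 hf2
    refine ⟨fun r h => by rw [hr2 r h, hr r h], hI'.congr hm2 fun x _ => by rw [hf2], ?_⟩
    rw [hf2]; exact hf'
  · rintro j hj s₁ ⟨hr, hI', hf'⟩ h8 hU
    rw [hdrop j hj, if_pos hU] at hI'
    refine (Runs.unpinStmt rfl c hI' h8).mono le_rfl ?_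
    rintro s₂ ⟨hI₂, hr₂, hf₂⟩
    exact ⟨hr₂ 3 (by omega), fun r h => by rw [hr₂ r (by omega), hr r h], hI₂,
      fun x hx => by rw [hf₂ x hx, hf' x hx]⟩
  · rintro j hj s₁ ⟨hr, hI', hf'⟩ hU
    rw [hdrop j hj, if_neg hU] at hI'
    exact ⟨hr, hI', hf'⟩
  · rintro s' ⟨hr, hI', hf'⟩
    rw [List.drop_length] at hI'
    exact ⟨hr, hI', hf'⟩
  · have hu1 : 31 ≤ unitTime inp := const_le_unitTime (by omega)
    refine le_trans ?_ hT
    refine add_le_add (Nat.mul_le_mul hΔ ?_) (by omega)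
    have : (q + 2) * unitTime inp = q * unitTime inp + 2 * unitTime inp := by ring
    omega

end

end AlgRAM

/-! ### The recursive procedure and its running time -/

namespace AlgRAM

open PowerSeries PartitionSeries

section

variable {q : ℕ} {inp : Input q}

/-- A series with constant term 1 has the form $1+Xy$ with `y` stored one cell further. Hence the
procedures for $1+Xy$ also handle `den` and the accumulated product. -/
theorem one_add_X_mul_shift {f : ℂ⟦X⟧} (h : constantCoeff f = 1) :
    1 + X * PowerSeries.mk (fun i => coeff (i + 1) f) = f := by
  conv_rhs => rw [eq_X_mul_shift_add_const f, h, map_one]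
  ring

theorem Inv.setFlag {U U' : Finset (Fin inp.n)} {w : Fin inp.n → Fin q → ℂ⟦X⟧} {s : State}
    (h : Inv inp U w s) (u : Fin inp.n) (b : ℕ)
    (hU : ∀ v, (if v ∈ U' then 0 else 1) = if v = u then b else if v ∈ U then 0 else 1) :
    Inv inp U' w { s with mem := Function.update s.mem (inp.n + u) b } where
  base v := by
    have := v.2
    simp only
    rw [Function.update_of_ne (by omega), h.base]
  flag v := by
    simp only
    rw [hU v]
    split_ifs with hv hvU
    · rw [hv, Function.update_self]
    all_goals
      have hne : (v : ℕ) ≠ u := fun h => hv (Fin.ext h)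
      rw [Function.update_of_ne (by omega), h.flag]
      simp [hvU]
  weight := h.weight
  mat := h.mat

/-- The ratios of all colours, for recursion depth `k + 1`. -/
theorem Runs.ratios {k T Δ T' : ℕ} (hspec : MargSpec inp k T) {U : Finset (Fin inp.n)}
    {w : Fin inp.n → Fin q → ℂ⟦X⟧} {s : State} {u : Fin inp.n} {fp : ℕ}
    (hΔ : (inp.nbrs u).length ≤ Δ)
    (hw : ∀ v c, constantCoeff (w v c) = (q : ℂ)⁻¹) (hI : Inv inp U w s)
    (h0 : s.reg 0 = u) (h1 : s.reg 1 = k + 1) (h2 : s.reg 2 = fp)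
    (hfp : topBlock inp * (inp.m + 1) ≤ fp)
    (hp : ∀ d : Fin q, Holds s.fld (fp + d * (inp.m + 1)) inp.m (w u d))
    (hT : q * (Δ * T + Δ * ((2 * q + 7) * unitTime inp) + 2 * unitTime inp) + 1 ≤ T') :
    Runs inp (procedures q)
      (AlgRAM.unroll q fun c => .seq (AlgRAM.nbrLoop (AlgRAM.scanStmt q c))
        (AlgRAM.nbrLoop (AlgRAM.unpinStmt q c))) s T' fun s' =>
      (∀ r < 3, s'.reg r = s.reg r) ∧ Inv inp U w s' ∧
      (∀ d : Fin q, Holds s'.fld (fp + d * (inp.m + 1)) inp.m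
        ((inp.nbrs u).foldl (scanStep inp.offset (PartitionSeries.marg inp.offset inp.nbrs k U) U d)
          (w u d, w)).1) ∧
      ∀ x < fp, Outside inp x → s'.fld x = s.fld x := by
  have hOut : ∀ x, fp ≤ x → Outside inp x := fun x hx => Or.inr (hfp.trans hx)
  refine Runs.unroll
    (T₁ := Δ * T + Δ * ((2 * q + 7) * unitTime inp) + 2 * unitTime inp) (fun c s' =>
      (∀ r < 3, s'.reg r = s.reg r) ∧ Inv inp U w s' ∧
      (∀ d : Fin q, Holds s'.fld (fp + d * (inp.m + 1)) inp.m
        (if (d : ℕ) < c then ((inp.nbrs u).foldl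
          (scanStep inp.offset (PartitionSeries.marg inp.offset inp.nbrs k U) U d)
            (w u d, w)).1 else w u d)) ∧
      ∀ x < fp, Outside inp x → s'.fld x = s.fld x) ?_ ?_ ?_ hT
  · exact ⟨fun _ _ => rfl, hI, by simpa using hp, fun _ _ _ => rfl⟩
  · rintro c s₁ hc ⟨hr₁, hI₁, hp₁, hf₁⟩
    have hcur := hp₁ ⟨c, hc⟩
    simp only [lt_irrefl, if_false] at hcur
    -- The scan for colour `c` leaves the neighbours pinned; unpinning restores `w` before the next
    -- colour.
    refine Runs.seq (T₁ := Δ * (T + (q + 5) * unitTime inp) + unitTime inp)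
      (T₂ := Δ * ((q + 2) * unitTime inp) + unitTime inp)
      (Runs.scanLoop hspec hΔ hw hI₁ (by rw [hr₁ 0 (by omega), h0])
        (by rw [hr₁ 1 (by omega), h1]) (by rw [hr₁ 2 (by omega), h2]) hfp ⟨c, hc⟩ hcur le_rfl)
      ?_ (le_of_eq (by ring))
    rintro s₂ ⟨hr₂, hI₂, hp₂, hf₂⟩
    refine (Runs.unpinLoop hΔ (by rw [hr₂ 0 (by omega), hr₁ 0 (by omega), h0]) ⟨c, hc⟩ hI₂
      le_rfl).mono le_rfl ?_
    rintro s₃ ⟨hr₃, hI₃, hf₃⟩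
    refine ⟨fun r hr => by rw [hr₃ r hr, hr₂ r hr, hr₁ r hr], hI₃, ?_, ?_⟩
    · intro d
      by_cases hd : d = ⟨c, hc⟩
      · subst hd
        rw [if_pos (by simp)]
        exact hp₂.congr fun x hx1 hx2 => hf₃ x (hOut x (by omega))
      · have hdc : (d : ℕ) ≠ c := fun h => hd (Fin.ext h)
        have h3 : (d : ℕ) < c + 1 ↔ (d : ℕ) < c := by omega
        simp only [h3]
        have hlt := block_add_le inp.m d.2
        refine (hp₁ d).congr fun x hx1 hx2 => ?_
        rw [hf₃ x (hOut x (by omega)), hf₂ x (by omega) ?_ (hOut x (by omega))]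
        have := block_disjoint inp.m hdc (x - fp) (by omega) (by omega)
        simp only
        omega
    · intro x hx1 hx2
      have := block_add_le inp.m hc
      rw [hf₃ x hx2, hf₂ x (by omega) (Or.inl (by simp only; omega)) hx2, hf₁ x hx1 hx2]
  · rintro s' ⟨hr, hI', hp', hf⟩
    exact ⟨hr, hI', fun d => by simpa using hp' d, hf⟩

/-- The middle part of the recursive procedure. -/
theorem Runs.nums {k T T' : ℕ} {U : Finset (Fin inp.n)}
    {w : Fin inp.n → Fin q → ℂ⟦X⟧} {s : State} {u : Fin inp.n} {fp Δ : ℕ}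
    (hspec : ∀ k', k = k' + 1 → MargSpec inp k' T) (hΔ : (inp.nbrs u).length ≤ Δ) (hu : u ∈ U)
    (hw : ∀ v c, constantCoeff (w v c) = (q : ℂ)⁻¹) (hI : Inv inp U w s)
    (h0 : s.reg 0 = u) (h1 : s.reg 1 = k) (h2 : s.reg 2 = fp)
    (hfp : topBlock inp * (inp.m + 1) ≤ fp)
    (hp : ∀ d : Fin q, Holds s.fld (fp + d * (inp.m + 1)) inp.m (w u d))
    (hT : q * (Δ * T + Δ * ((2 * q + 7) * unitTime inp) + 2 * unitTime inp) + 20 ≤ T') :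
    Runs inp (procedures q)
      (.ite (.lt (.const 0) (.reg 1))
      (.seq (.setMem (.add .order (.reg 0)) (.const 1))
        (.seq (AlgRAM.unroll q fun c => .seq (AlgRAM.nbrLoop (AlgRAM.scanStmt q c))
        (AlgRAM.nbrLoop (AlgRAM.unpinStmt q c)))
          (.setMem (.add .order (.reg 0)) (.const 0)))) .skip) s T' fun s' =>
      (∀ r < 3, s'.reg r = s.reg r) ∧ Inv inp U w s' ∧
      (∀ d : Fin q, Holds s'.fld (fp + d * (inp.m + 1)) inp.m
        (num inp.offset inp.nbrs k U w u d)) ∧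
      ∀ x < fp, Outside inp x → s'.fld x = s.fld x := by
  refine Runs.ite (T₁ := q * (Δ * T + Δ * ((2 * q + 7) * unitTime inp) + 2 * unitTime inp) + 15)
    (fun hb => ?_) (fun hb => ?_) (by simp [BExp.cost, IExp.cost]; omega)
  · obtain ⟨k', rfl⟩ : ∃ k', k = k' + 1 := by
      refine ⟨k - 1, ?_⟩
      simp [BExp.eval, IExp.eval, h1] at hb
      omega
    refine Runs.seq (T₁ := 5)
      (T₂ := q * (Δ * T + Δ * ((2 * q + 7) * unitTime inp) + 2 * unitTime inp) + 10)
      (Q₁ := fun s' => s' = { s with mem := Function.update s.mem (inp.n + u) 1 })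
      (Runs.setMem (by simp [IExp.cost]) (by simp [IExp.eval, h0])) ?_ (by omega)
    rintro _ rfl
    -- Raising the flag of `u` is all that deletes it; the flag is lowered again after the scans.
    have hI₁ : Inv inp (U.erase u) w { s with mem := Function.update s.mem (inp.n + u) 1 } :=
      hI.setFlag u 1 fun v => by by_cases hv : v = u <;> simp [hv]
    refine Runs.seq
      (T₁ := q * (Δ * T + Δ * ((2 * q + 7) * unitTime inp) + 2 * unitTime inp) + 1)
      (T₂ := 5) (Runs.ratios (hspec k' rfl) hΔ hw hI₁ h0 h1 h2 hfp hp le_rfl) ?_ (by omega)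
    rintro s₂ ⟨hr₂, hI₂, hp₂, hf₂⟩
    refine Runs.setMem (by simp [IExp.cost]) ?_
    have hreg : s₂.reg 0 = u := by rw [hr₂ 0 (by omega)]; exact h0
    simp only [IExp.eval, hreg]
    refine ⟨hr₂, hI₂.setFlag u 0 fun v => ?_, ?_, hf₂⟩
    · by_cases hv : v = u <;> simp [hv, hu]
    · intro d
      rw [num_succ]
      exact hp₂ d
  -- At depth 0 the copied weights already are the numerators.
  · obtain rfl : k = 0 := by
      simp [BExp.eval, IExp.eval, h1] at hb
      omega
    exact Runs.skip (by omega) ⟨fun _ _ => rfl, hI, hp, fun _ _ _ => rfl⟩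

/-- One step of the induction on the depth, with its recurrence for the time: `q` scans of at most
`Δ` neighbours, one recursive call per active neighbour. Asking for the contract only if `k = k' +
1` covers depth 0 as well. -/
theorem Runs.margBody (hq : q ≠ 0) {k T Δ T' : ℕ} (hspec : ∀ k', k = k' + 1 → MargSpec inp k' T)
    (hΔ : ∀ u, (inp.nbrs u).length ≤ Δ)
    (hT : q * (Δ * T + Δ * ((2 * q + 7) * unitTime inp) + 2 * unitTime inp) +
      (2 * q + 4) * unitTime inp ≤ T') : MargSpec inp k T' := by
  intro U w s u fp hu hw hI h0 h1 h2 hfp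
  have hW : 100 ≤ unitTime inp := const_le_unitTime (by omega)
  have hOut : ∀ x, fp ≤ x → Outside inp x := fun x hx => Or.inr (hfp.trans hx)
  have hblk : ∀ c < q, c * (inp.m + 1) + (inp.m + 1) ≤ q * (inp.m + 1) := fun c hc => block_add_le inp.m hc
  refine Runs.seq (T₁ := q * unitTime inp + 1)
    (T₂ := q * (Δ * T + Δ * ((2 * q + 7) * unitTime inp) + 2 * unitTime inp) + 20 +
      (unitTime inp + (q * unitTime inp + 1)))
    (Q₁ := fun s' => (∀ r < 3, s'.reg r = s.reg r) ∧ Inv inp U w s' ∧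
      (∀ d : Fin q, Holds s'.fld (fp + d * (inp.m + 1)) inp.m (w u d)) ∧ ∀ x < fp, s'.fld x = s.fld x)
    ?_ ?_ (by
      have : (2 * q + 4) * unitTime inp = 2 * (q * unitTime inp) + 4 * unitTime inp := by ring
      omega)
  · refine Runs.unroll (T₁ := unitTime inp) (fun c s' =>
      (∀ r < 3, s'.reg r = s.reg r) ∧ Inv inp U w s' ∧
      (∀ d : Fin q, (d : ℕ) < c → Holds s'.fld (fp + d * (inp.m + 1)) inp.m (w u d)) ∧
      ∀ x < fp, s'.fld x = s.fld x) ?_ ?_ ?_ le_rfl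
    · exact ⟨fun _ _ => rfl, hI, by simp, fun _ _ => rfl⟩
    · rintro c s₁ hc ⟨hr₁, hI₁, hp₁, hf₁⟩
      refine (Runs.fillBlock (d := fp + c * (inp.m + 1)) (p := w u ⟨c, hc⟩) ?_ ?_
        (mul_le_unitTime (linear_le_sq ?_))).mono le_rfl ?_
      · intro i f
        simp [IExp.eval, hr₁ 2 (by omega), h2]
      · intro i hi s' h6 hr' hmem' hf' _ _
        refine ⟨by simp [FExp.Defined], ?_⟩
        have haddr : (cell (.load (.reg 0)) c).eval inp s' = weightBlock q u c * (inp.m + 1) + i := by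
          simp only [cell_eval, IExp.eval, h6, hr' 0 (by omega), hr₁ 0 (by omega), h0, hmem',
            hI₁.base, weightBlock]
          ring
        have hlt := weightBlock_add_le (inp := inp) u ⟨c, hc⟩
        simp only at hlt
        rw [FExp.eval, haddr, hf' _ (Or.inl (by omega))]
        exact hI₁.weight u ⟨c, hc⟩ i hi
      · simp only [FExp.cost, cell_cost, IExp.cost]
        omega
      · intro s₂ hu₂
        refine ⟨fun r hr => by rw [hu₂.reg r (by omega), hr₁ r hr],
          hI₁.congr hu₂.mem fun x hx => hu₂.frame x (by omega), fun d hd => ?_,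
          fun x hx => by rw [hu₂.frame x (by omega), hf₁ x hx]⟩
        by_cases hdc : (d : ℕ) = c
        · obtain rfl : d = ⟨c, hc⟩ := Fin.ext hdc
          exact hu₂.holds
        · refine (hp₁ d (by omega)).congr fun x hx1 hx2 => hu₂.frame x ?_
          have := block_disjoint inp.m hdc (x - fp) (by omega) (by omega)
          omega
    · rintro s' ⟨hr, hI', hp', hf⟩
      exact ⟨hr, hI', fun d => hp' d d.2, hf⟩
  rintro s₁ ⟨hr₁, hI₁, hp₁, hf₁⟩
  refine Runs.seq (Runs.nums hspec (hΔ u) hu hw hI₁ (by rw [hr₁ 0 (by omega), h0])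
    (by rw [hr₁ 1 (by omega), h1]) (by rw [hr₁ 2 (by omega), h2]) hfp hp₁ le_rfl) ?_ le_rfl
  rintro s₂ ⟨hr₂, hI₂, hp₂, hf₂⟩
  have hreg2 : s₂.reg 2 = fp := by rw [hr₂ 2 (by omega), hr₁ 2 (by omega), h2]
  refine Runs.seq (T₁ := unitTime inp) (T₂ := q * unitTime inp + 1)
    (Runs.fillBlock (d := fp + q * (inp.m + 1)) (p := den inp.offset inp.nbrs k U w u) ?_ ?_
      (mul_le_unitTime (quadratic_le_sq ?_))) ?_ le_rfl
  · intro i f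
    simp [IExp.eval, hreg2]
  · intro i hi s' h6 hr' hmem' hf' _ _
    refine ⟨FExp.sum_defined _ _ _ fun c' => by simp [FExp.Defined], ?_⟩
    rw [FExp.sum_eval, Finset.sum_range, den, map_sum]
    refine Finset.sum_congr rfl fun c _ => ?_
    have := hblk c c.2
    have haddr : (cell (.reg 2) c).eval inp s' = fp + c * (inp.m + 1) + i := by
      simp only [cell_eval, IExp.eval, h6, hr' 2 (by omega), hreg2]
    rw [FExp.eval, haddr, hf' _ (Or.inl (by omega))]
    exact hp₂ c i hi
  · have h3 := FExp.sum_cost_le q (4 * q + 6) (fun c => .load (cell (.reg 2) c)) fun c hc => by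
      simp only [FExp.cost, cell_cost, IExp.cost]
      omega
    have h4 : q * (4 * q + 6 + 1) = 4 * (q * q) + 7 * q := by ring
    simp only [IExp.cost]
    omega
  intro s₃ hu₃
  have hI₃ : Inv inp U w s₃ := hI₂.congr hu₃.mem fun x hx => hu₃.frame x (by omega)
  refine Runs.unroll (T₁ := unitTime inp) (fun c s' =>
      s'.reg 2 = fp ∧ Inv inp U w s' ∧
      (∀ d : Fin q, Holds s'.fld (fp + d * (inp.m + 1)) inp.m (if (d : ℕ) < c then
        PartitionSeries.marg inp.offset inp.nbrs k U w u d
        else num inp.offset inp.nbrs k U w u d)) ∧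
      Holds s'.fld (fp + q * (inp.m + 1)) inp.m (PartitionSeries.den inp.offset inp.nbrs k U w u) ∧
      ∀ x < fp, Outside inp x → s'.fld x = s.fld x) ?_ ?_ ?_ le_rfl
  · refine ⟨by rw [hu₃.reg 2 (by omega), hreg2], hI₃, fun d => ?_, hu₃.holds, ?_⟩
    · have := hblk d d.2
      simp only [Nat.not_lt_zero, if_false]
      exact (hp₂ d).congr fun x hx1 hx2 => hu₃.frame x (by omega)
    · intro x hx1 hx2
      rw [hu₃.frame x (by omega), hf₂ x hx1 hx2, hf₁ x hx1]
  · rintro c s₄ hc ⟨hr₄, hI₄, hp₄, hd₄, hf₄⟩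
    have hcur := hp₄ ⟨c, hc⟩
    have hcq := hblk c hc
    simp only [lt_irrefl, if_false] at hcur
    -- A numerator is `marg` times $1+Xy$, with `y` the shift of `den`; this is the form that the
    -- division procedure inverts.
    rw [← marg_mul_den hq inp.nbrs k U w hw, ← one_add_X_mul_shift
      (constantCoeff_den (a := inp.offset) hq inp.nbrs k U w hw u)] at hcur
    refine (Runs.callDiv rfl (P := fp + c * (inp.m + 1)) (Y := fp + q * (inp.m + 1) + 1) ?_ ?_ hcur
      (fun t ht => ?_) (fun t ht => by omega)
      (add_mul_le_unitTime (linear_le_sq ?_))).mono le_rfl ?_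
    · simp [IExp.eval, hr₄]
    · simp [IExp.eval, hr₄]
    · rw [coeff_mk, add_assoc, add_comm 1 t]
      exact hd₄ (t + 1) ht
    · simp only [blk_cost, IExp.cost]
      omega
    · intro s₅ hu₅
      refine ⟨by rw [hu₅.reg 2 (by omega), hr₄],
        hI₄.congr hu₅.mem fun x hx => hu₅.frame x (by omega), fun d => ?_,
        hd₄.congr fun x hx1 hx2 => hu₅.frame x (by omega),
        fun x hx1 hx2 => by rw [hu₅.frame x (by omega), hf₄ x hx1 hx2]⟩
      by_cases hdc : (d : ℕ) = c
      · obtain rfl : d = ⟨c, hc⟩ := Fin.ext hdc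
        rw [if_pos (by simp)]
        exact hu₅.holds
      · have h3 : (d : ℕ) < c + 1 ↔ (d : ℕ) < c := by omega
        simp only [h3]
        refine (hp₄ d).congr fun x hx1 hx2 => hu₅.frame x ?_
        have := block_disjoint inp.m hdc (x - fp) (by omega) (by omega)
        omega
  · rintro s' ⟨-, hI', hp', hd', hf'⟩
    exact ⟨hI', hf', fun c => by simpa using hp' c, hd'⟩

theorem margBody_time_le {Δ : ℕ} (hΔ : 1 ≤ Δ) (q W : ℕ) :
    q * (Δ * ((2 * q + 7) * W) + 2 * W) + (2 * q + 4) * W ≤ 20 * (q + 1) ^ 2 * Δ * W := by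
  have h : W ≤ Δ * W := Nat.le_mul_of_pos_left _ hΔ
  calc q * (Δ * ((2 * q + 7) * W) + 2 * W) + (2 * q + 4) * W
      ≤ q * (Δ * ((2 * q + 7) * W) + 2 * (Δ * W)) + (2 * q + 4) * (Δ * W) := by gcongr
    _ = (2 * q ^ 2 + 11 * q + 4) * (Δ * W) := by ring
    _ ≤ (20 * (q + 1) ^ 2) * (Δ * W) := Nat.mul_le_mul_right _ (by nlinarith)
    _ = 20 * (q + 1) ^ 2 * Δ * W := by ring

/-- The running time of the recursive procedure. -/
theorem margSpec (hq : q ≠ 0) {Δ : ℕ} (hΔ1 : 1 ≤ Δ) (hΔ : ∀ u, (inp.nbrs u).length ≤ Δ) (k : ℕ) :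
    MargSpec inp k (20 * (q + 1) ^ 2 * Δ * unitTime inp * (2 * (q + 1) * Δ) ^ k) := by
  have h1 := margBody_time_le hΔ1 q (unitTime inp)
  induction k with
  | zero =>
    -- Depth 0 makes no recursive call, so its cost can be taken as 0.
    refine Runs.margBody (T := 0) (Δ := Δ) (inp := inp) hq (k := 0) (by simp) hΔ ?_
    simpa using h1
  | succ k ih =>
    refine Runs.margBody (T := 20 * (q + 1) ^ 2 * Δ * unitTime inp * (2 * (q + 1) * Δ) ^ k) hq
      (fun k' hk' => ?_) hΔ ?_
    · obtain rfl : k = k' := by omega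
      exact ih
    · have hX : 1 ≤ (2 * (q + 1) * Δ) ^ k := Nat.one_le_pow _ _ (by positivity)
      rw [pow_succ]
      set W := unitTime inp
      set Y := (2 * (q + 1) * Δ) ^ k
      set B := 20 * (q + 1) ^ 2 * Δ * W
      -- The local work `B` is no larger than the bound `(q + 1) * Δ * (B * Y)` for the recursive
      -- calls. Doubling that bound is the origin of the 2 in the base, later replaced by $e$.
      have h2 : B ≤ (q + 1) * Δ * (B * Y) :=
        (Nat.le_mul_of_pos_right _ hX).trans (Nat.le_mul_of_pos_left _ (by positivity))
      have h3 : q * (Δ * (B * Y)) ≤ (q + 1) * Δ * (B * Y) := by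
        rw [← mul_assoc]
        gcongr
        omega
      calc q * (Δ * (B * Y) + Δ * ((2 * q + 7) * W) + 2 * W) + (2 * q + 4) * W
          = q * (Δ * (B * Y)) + (q * (Δ * ((2 * q + 7) * W) + 2 * W) + (2 * q + 4) * W) := by ring
        _ ≤ (q + 1) * Δ * (B * Y) + (q + 1) * Δ * (B * Y) := add_le_add h3 (h1.trans h2)
        _ = B * (Y * (2 * (q + 1) * Δ)) := by ring

end

end AlgRAM

/-! ### The main program -/

namespace AlgRAM

open PowerSeries PartitionSeries

section

variable {q : ℕ} {inp : Input q}

/-- Fill the table of addresses and set all weights to `1 / q`. -/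
def initVertices (q : ℕ) : Stmt :=
  .seq (.setReg 10 (.times (2 + q * q) stride))
    (forLoop 9 .order (.seq (.setMem (.reg 9) (.reg 10))
      (unroll q fun _ => .seq (.setFld (.reg 10) (.div .one (FExp.sum q fun _ => .one)))
        (.setReg 10 (.add (.reg 10) stride)))))

/-- Store the entries of `A - J`. -/
def initMatrix (q : ℕ) : Stmt := unroll q fun c => unroll q fun c' =>
  .setFld (.times (2 + (c * q + c')) stride) (.sub (.entry (.const c) (.const c')) .one)

/-- Multiply the normalising factors of all vertices, removing the vertices one by one. -/
def rootLoop (q : ℕ) : Stmt :=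
  forLoop 9 .order (.seq (.setReg 0 (.reg 9)) (.seq (.setReg 1 .level) (.seq (.setReg 2 (.reg 10))
    (.seq (.call 0) (.seq (callMul stride (.add (blk (.reg 10) q) (.const 1)))
      (.setMem (.add .order (.reg 9)) (.const 1)))))))

/-- Compute the logarithm of the series in the block `1`. -/
def logStmt : Stmt :=
  .seq (.setFld (.reg 10) .zero)
    (.seq (fill 6 .level (.add (.reg 10) (.add (.reg 6) (.const 1)))
      (.add (.load (.add (.reg 10) (.reg 6))) .one))
    (.seq (fill 6 stride (cell (.const 0) 0)
      (.mul (.load (cell (.reg 10) 0)) (.load (cell stride 0))))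
    (.seq (callDiv (.const 0) (.add stride (.const 1)))
      (fill 6 .level (.add (.reg 6) (.const 1)) (.div (.load (.add (.reg 6) (.const 1)))
        (.load (.add (.reg 10) (.add (.reg 6) (.const 1)))))))))

/-- The program. -/
def program (q : ℕ) : Program where
  main := .seq (initVertices q) (.seq (initMatrix q) (.seq (.setFld stride .one)
    (.seq (rootLoop q) logStmt)))
  procs := procedures q

/-- Every block of the complex memory holds a constant series. -/
def HoldsConst (f : ℕ → ℂ) (m : ℕ) (F : ℕ → ℂ) : Prop :=
  ∀ b, Holds f (b * (m + 1)) m (C (F b))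

/-- As the memory starts at zero, writing the first cell of a block is enough to store a constant
series. -/
theorem HoldsConst.update {f : ℕ → ℂ} {m : ℕ} {F : ℕ → ℂ} (h : HoldsConst f m F) (b : ℕ) (z : ℂ) :
    HoldsConst (Function.update f (b * (m + 1)) z) m (Function.update F b z) := by
  intro b' i hi
  by_cases hb : b' = b
  · subst hb
    rw [Function.update_self]
    rcases Nat.eq_zero_or_pos i with rfl | hi0
    · simp
    · rw [Function.update_of_ne (by omega), h b' i hi, coeff_C, coeff_C, if_neg (by omega),
        if_neg (by omega)]
  · have := block_disjoint m hb (b' * (m + 1) + i) (by omega) (by omega)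
    rw [Function.update_of_ne hb, Function.update_of_ne (by omega), h b' i hi]

theorem Runs.initVertices {T : ℕ} (hq : q ≠ 0)
    (hT : inp.n * ((q + 2) * unitTime inp) + unitTime inp ≤ T) (procs : List Stmt) :
    Runs inp procs (AlgRAM.initVertices q) State.init T fun s =>
      s.reg 10 = topBlock inp * (inp.m + 1) ∧
      (∀ u < inp.n, s.mem u = (2 + q * q + u * q) * (inp.m + 1)) ∧
      (∀ x, inp.n ≤ x → s.mem x = 0) ∧
      HoldsConst s.fld inp.m fun b =>
        if 2 + q * q ≤ b ∧ b < topBlock inp then (q : ℂ)⁻¹ else 0 := by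
  have hW : ∀ K ≤ 200, K * (q + 1) ^ 2 ≤ unitTime inp := fun K hK =>
    le_unitTime (Nat.mul_le_mul_right _ hK)
  have hW1 := hW 100 (by omega)
  have hsq : (q + 1) ^ 2 = q * q + 2 * q + 1 := by ring
  rw [hsq] at hW1
  have hstep : ∀ (s : State) (B : ℕ), s.reg 10 = B * (inp.m + 1) → 2 + q * q ≤ B →
      (HoldsConst s.fld inp.m fun b => if 2 + q * q ≤ b ∧ b < B then (q : ℂ)⁻¹ else 0) →
      Runs inp procs (.seq (.setFld (.reg 10) (.div .one (FExp.sum q fun _ => .one)))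
        (.setReg 10 (.add (.reg 10) stride))) s (2 * q + 20) fun s' =>
        s'.reg 9 = s.reg 9 ∧ s'.reg 10 = (B + 1) * (inp.m + 1) ∧ s'.mem = s.mem ∧
        HoldsConst s'.fld inp.m fun b =>
          if 2 + q * q ≤ b ∧ b < B + 1 then (q : ℂ)⁻¹ else 0 := by
    intro s B hB hB2 hF
    -- The machine has only 0 and 1 as complex constants, so `q` is added up from ones.
    have hval : (FExp.sum q fun _ => FExp.one).eval inp s = q := by
      simp [FExp.eval]
    have hcost := FExp.sum_cost_le q 1 (fun _ => .one) fun c _ => le_rfl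
    refine Runs.seq (T₁ := 2 * q + 10) (T₂ := 6)
      (Q₁ := fun s' => s' =
        { s with fld := Function.update s.fld (B * (inp.m + 1)) ((q : ℂ)⁻¹) })
      (Runs.setFld ?_ ?_ ?_) ?_ (by omega)
    · simp only [FExp.cost, IExp.cost]
      omega
    · refine ⟨trivial, FExp.sum_defined _ _ _ fun _ => trivial, ?_⟩
      rw [hval]
      exact_mod_cast hq
    · simp only [IExp.eval, FExp.eval, hval, hB, one_div]
    · rintro _ rfl
      refine Runs.setReg (by simp [IExp.cost]) ⟨by simp, ?_, rfl, ?_⟩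
      · simp [IExp.eval, hB, Nat.succ_mul]
      · convert hF.update B ((q : ℂ)⁻¹) using 1
        funext b
        by_cases hb : b = B
        · subst hb; simp [hB2]
        · have : b < B + 1 ↔ b < B := by omega
          simp [hb, this]
  refine Runs.seq (T₁ := unitTime inp - 10) (T₂ := inp.n * ((q + 2) * unitTime inp) + 10)
    (Q₁ := fun s => s.reg 10 = (2 + q * q) * (inp.m + 1) ∧ (∀ x, s.mem x = 0) ∧
      ∀ x, s.fld x = 0) (Runs.setReg ?_ ?_) ?_ (by omega)
  · simp only [IExp.times_cost, stride_cost]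
    omega
  · exact ⟨by simp, fun _ => rfl, fun _ => rfl⟩
  rintro s₀ ⟨h10, hm0, hf0⟩
  refine Runs.forLoop (N := inp.n) (T₁ := q * unitTime inp + 20) (fun i s => i ≤ inp.n ∧
    s.reg 9 = i ∧ s.reg 10 = (2 + q * q + i * q) * (inp.m + 1) ∧
    (∀ u < i, s.mem u = (2 + q * q + u * q) * (inp.m + 1)) ∧
    (∀ x, i ≤ x → s.mem x = 0) ∧
    HoldsConst s.fld inp.m fun b =>
        if 2 + q * q ≤ b ∧ b < 2 + q * q + i * q then (q : ℂ)⁻¹ else 0) ?_ ?_ ?_ ?_ ?_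
  · refine ⟨by omega, by simp, by simp [h10], by simp, fun x _ => hm0 x, ?_⟩
    intro b i hi
    have : ¬ (2 + q * q ≤ b ∧ b < 2 + q * q + 0 * q) := by omega
    simp only [if_neg this, map_zero]
    exact hf0 _
  · rintro i s ⟨-, h9, -⟩
    exact ⟨h9, rfl⟩
  · rintro i s hi ⟨-, h9, h10, hm, hm', hF⟩
    refine Runs.seq (T₁ := 3) (T₂ := q * unitTime inp + 1)
      (Q₁ := fun s' => s' = ⟨s.reg, Function.update s.mem i
        ((2 + q * q + i * q) * (inp.m + 1)), s.fld⟩)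
      (Runs.setMem (by simp [IExp.cost]) (by simp [IExp.eval, h9, h10])) ?_ (by omega)
    rintro _ rfl
    refine Runs.unroll (T₁ := unitTime inp) (fun c s' => s'.reg 9 = i ∧
      s'.reg 10 = (2 + q * q + i * q + c) * (inp.m + 1) ∧
      s'.mem = Function.update s.mem i ((2 + q * q + i * q) * (inp.m + 1)) ∧
      HoldsConst s'.fld inp.m fun b =>
        if 2 + q * q ≤ b ∧ b < 2 + q * q + i * q + c then (q : ℂ)⁻¹ else 0) ?_ ?_ ?_ le_rfl
    · exact ⟨h9, h10, rfl, hF⟩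
    · rintro c s₁ hc ⟨h9, h10, hm1, hF1⟩
      refine (hstep s₁ _ h10 (by omega) hF1).mono (by omega) ?_
      rintro s₂ ⟨g9, g10, gm, gF⟩
      exact ⟨g9.trans h9, g10, gm.trans hm1, gF⟩
    · rintro s₁ ⟨h9, h10, hm1, hF1⟩
      have he : 2 + q * q + (i + 1) * q = 2 + q * q + i * q + q := by ring
      refine ⟨h9, by omega, by simp, by simp [h10, he], ?_, ?_, ?_⟩
      · intro u hu
        simp only [hm1]
        by_cases hui : u = i
        · subst hui; simp
        · rw [Function.update_of_ne hui, hm u (by omega)]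
      · intro x hx
        simp only [hm1]
        rw [Function.update_of_ne (by omega), hm' x (by omega)]
      · rw [he]; exact hF1
  · rintro s ⟨-, -, h10, hm, hm', hF⟩
    exact ⟨h10, hm, hm', hF⟩
  · simp only [IExp.cost]
    have : (q + 2) * unitTime inp = q * unitTime inp + 2 * unitTime inp := by ring
    have h3 : inp.n * (q * unitTime inp + 20 + 1 + 6) ≤ inp.n * ((q + 2) * unitTime inp) :=
      Nat.mul_le_mul_left _ (by omega)
    omega

theorem Runs.initMatrix {s : State} {F : ℕ → ℂ} (hF : HoldsConst s.fld inp.m F)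
    (procs : List Stmt) :
    Runs inp procs (AlgRAM.initMatrix q) s (q * (q * unitTime inp + 1) + 1) fun s' =>
      s'.reg = s.reg ∧ s'.mem = s.mem ∧ ∃ F', HoldsConst s'.fld inp.m F' ∧
        (∀ d d' : Fin q, F' (2 + (d * q + d')) = inp.offset d d') ∧
        ∀ b, b < 2 ∨ 2 + q * q ≤ b → F' b = F b := by
  refine Runs.unroll (T₁ := q * unitTime inp + 1) (fun c s' => s'.reg = s.reg ∧ s'.mem = s.mem ∧
    ∃ F', HoldsConst s'.fld inp.m F' ∧
      (∀ d d' : Fin q, d * q + d' < c * q → F' (2 + (d * q + d')) = inp.offset d d') ∧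
      ∀ b, b < 2 ∨ 2 + q * q ≤ b → F' b = F b) ?_ ?_ ?_ le_rfl
  · exact ⟨rfl, rfl, F, hF, by simp, fun _ _ => rfl⟩
  · rintro c s₁ hc ⟨hr₁, hm₁, F₁, hF₁, ha₁, hb₁⟩
    refine Runs.unroll (T₁ := unitTime inp) (fun c' s' => s'.reg = s.reg ∧ s'.mem = s.mem ∧
      ∃ F', HoldsConst s'.fld inp.m F' ∧
        (∀ d d' : Fin q, d * q + d' < c * q + c' → F' (2 + (d * q + d')) = inp.offset d d') ∧
        ∀ b, b < 2 ∨ 2 + q * q ≤ b → F' b = F b) ?_ ?_ ?_ le_rfl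
    · exact ⟨hr₁, hm₁, F₁, hF₁, ha₁, hb₁⟩
    · rintro c' s₂ hc' ⟨hr₂, hm₂, F₂, hF₂, ha₂, hb₂⟩
      have hlt := mul_add_lt_mul hc hc'
      refine Runs.setFld ?_ (by simp [FExp.Defined]) ⟨hr₂, hm₂,
        Function.update F₂ (2 + (c * q + c')) (inp.offset ⟨c, hc⟩ ⟨c', hc'⟩), ?_, ?_, ?_⟩
      · refine le_unitTime (quadratic_le_sq ?_)
        simp only [IExp.times_cost, stride_cost, FExp.cost, IExp.cost]
        omega
      · have := hF₂.update (2 + (c * q + c')) (inp.offset ⟨c, hc⟩ ⟨c', hc'⟩)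
        simpa [FExp.eval, IExp.eval, hc, hc', onesMatrix] using this
      · intro d d' hd
        by_cases he : d * q + d' = c * q + c'
        -- Matrix positions use the same numbering `d * q + d'`, so uniqueness of quotient and
        -- remainder is borrowed from the weights.
        · obtain ⟨h1, h2⟩ := weightBlock_inj (q := q) (u := d) (u' := c) d'.2 hc' (by
            unfold weightBlock; omega)
          obtain rfl : d = ⟨c, hc⟩ := Fin.ext h1
          obtain rfl : d' = ⟨c', hc'⟩ := Fin.ext h2
          simp
        · rw [Function.update_of_ne (by omega), ha₂ d d' (by omega)]
      · intro b hb
        rw [Function.update_of_ne (by omega), hb₂ b hb]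
    · rintro s₂ ⟨hr₂, hm₂, F₂, hF₂, ha₂, hb₂⟩
      exact ⟨hr₂, hm₂, F₂, hF₂, fun d d' hd => ha₂ d d' (by rwa [Nat.succ_mul] at hd), hb₂⟩
  · rintro s' ⟨hr, hm, F', hF', ha, hb⟩
    exact ⟨hr, hm, F', hF', fun d d' => ha d d' (mul_add_lt_mul d.2 d'.2), hb⟩

/-- The vertices from `i` on. -/
def verticesFrom (n i : ℕ) : Finset (Fin n) := Finset.univ.filter fun v => i ≤ (v : ℕ)

/-- The uniform weights. -/
noncomputable def uniformWeight (q n : ℕ) : Fin n → Fin q → ℂ⟦X⟧ := fun _ _ => C ((q : ℂ)⁻¹)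

/-- The invariant is that `acc` times the partition function of the remaining vertices agrees with
that of all vertices modulo $X^{m+1}$. In the end no vertex is left and `partition_empty` removes
the second factor. -/
theorem Runs.rootLoop (hq : q ≠ 0) {G : SimpleGraph (Fin inp.n)} [DecidableRel G.Adj]
    (hn : IsAdjList G inp.nbrs) (ha : inp.offset.IsSymm) {T T' : ℕ}
    (hspec : MargSpec inp inp.m T) {s : State}
    (hI : Inv inp Finset.univ (uniformWeight q inp.n) s)
    (hacc : Holds s.fld (inp.m + 1) inp.m 1) (h10 : s.reg 10 = topBlock inp * (inp.m + 1))
    (hT : inp.n * (T + 2 * unitTime inp) + 10 ≤ T') :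
    Runs inp (procedures q) (AlgRAM.rootLoop q) s T' fun s' =>
      s'.reg 10 = topBlock inp * (inp.m + 1) ∧ ∃ acc : ℂ⟦X⟧, Holds s'.fld (inp.m + 1) inp.m acc ∧
        constantCoeff acc = 1 ∧ X ^ (inp.m + 1) ∣
          acc - partition G ha Finset.univ (uniformWeight q inp.n) := by
  have hw : ∀ v c, constantCoeff (uniformWeight q inp.n v c) = (q : ℂ)⁻¹ := fun v c => by
    simp [uniformWeight]
  have hW : 100 ≤ unitTime inp := const_le_unitTime (by omega)
  have htop := le_topBlock (inp := inp)
  have h2q : (2 + q * q) * (inp.m + 1) = 2 * (inp.m + 1) + q * q * (inp.m + 1) := by ring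
  refine Runs.forLoop (N := inp.n) (T₁ := T + unitTime inp + 30) (fun i s' =>
    s'.reg 9 = i ∧ s'.reg 10 = topBlock inp * (inp.m + 1) ∧
    Inv inp (verticesFrom inp.n i) (uniformWeight q inp.n) s' ∧
    ∃ acc : ℂ⟦X⟧, Holds s'.fld (inp.m + 1) inp.m acc ∧ constantCoeff acc = 1 ∧
      X ^ (inp.m + 1) ∣
        acc * partition G ha (verticesFrom inp.n i) (uniformWeight q inp.n) -
          partition G ha Finset.univ (uniformWeight q inp.n)) ?_ ?_ ?_ ?_ ?_
  · have huniv : verticesFrom inp.n 0 = Finset.univ := by simp [verticesFrom]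
    refine ⟨by simp, by simp [h10], ?_, 1, hacc, map_one _, ?_⟩
    · rw [huniv]
      exact hI.congr rfl fun _ _ => rfl
    · rw [huniv, one_mul, sub_self]
      exact dvd_zero _
  · rintro i s' ⟨h9, -⟩
    exact ⟨h9, rfl⟩
  · rintro i s₁ hi ⟨h9, h10, hI₁, acc, hacc, hacc1, hdvd⟩
    set u : Fin inp.n := ⟨i, hi⟩ with hu
    have huU : u ∈ verticesFrom inp.n i := by simp [verticesFrom, hu]
    have herase : (verticesFrom inp.n i).erase u = verticesFrom inp.n (i + 1) := by
      ext v
      simp only [verticesFrom, Finset.mem_erase, Finset.mem_filter, Finset.mem_univ, true_and, hu,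
        ne_eq, Fin.ext_iff]
      omega
    refine Runs.seq (T₁ := 2) (T₂ := T + unitTime inp + 20)
      (Q₁ := fun s' => s' = ⟨Function.update s₁.reg 0 i, s₁.mem, s₁.fld⟩)
      (Runs.setReg (by simp [IExp.cost]) (by simp [IExp.eval, h9])) ?_ (by omega)
    rintro _ rfl
    refine Runs.seq (T₁ := 2) (T₂ := T + unitTime inp + 15)
      (Q₁ := fun s' => s' = ⟨Function.update (Function.update s₁.reg 0 i) 1 inp.m, s₁.mem, s₁.fld⟩)
      (Runs.setReg (by simp [IExp.cost]) (by simp [IExp.eval])) ?_ (by omega)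
    rintro _ rfl
    refine Runs.seq (T₁ := 2) (T₂ := T + unitTime inp + 10)
      (Q₁ := fun s' => s' = ⟨Function.update (Function.update (Function.update s₁.reg 0 i) 1 inp.m)
        2 (topBlock inp * (inp.m + 1)), s₁.mem, s₁.fld⟩)
      (Runs.setReg (by simp [IExp.cost]) (by simp [IExp.eval, h10])) ?_ (by omega)
    rintro _ rfl
    set s₂ : State := ⟨Function.update (Function.update (Function.update s₁.reg 0 i) 1 inp.m)
        2 (topBlock inp * (inp.m + 1)), s₁.mem, s₁.fld⟩ with hs₂
    refine Runs.seq (T₁ := T + 1) (T₂ := unitTime inp + 5) (Q₁ := fun s' => s'.reg = s₂.reg ∧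
      MargPost inp inp.m (verticesFrom inp.n i) (uniformWeight q inp.n) u
        (topBlock inp * (inp.m + 1)) s₂ s') (Runs.call (c := AlgRAM.margBody q) rfl ((hspec
          (verticesFrom inp.n i) (uniformWeight q inp.n) s₂ u (topBlock inp * (inp.m + 1)) huU hw
          (hI₁.congr rfl fun _ _ => rfl) (by simp [hs₂, hu]) (by simp [hs₂]) (by simp [hs₂])
          le_rfl).mono le_rfl ?_) le_rfl) ?_ (by omega)
    · intro s' hp
      exact ⟨rfl, hp.inv.congr rfl fun _ _ => rfl, hp.frame, hp.marg, hp.den⟩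
    rintro s₃ ⟨hr₃, hm₃⟩
    have hr9 : s₃.reg 9 = i := by rw [hr₃]; simp [hs₂, h9]
    have hr10 : s₃.reg 10 = topBlock inp * (inp.m + 1) := by rw [hr₃]; simp [hs₂, h10]
    set D := den inp.offset inp.nbrs inp.m (verticesFrom inp.n i) (uniformWeight q inp.n) u with hD
    have hD1 : constantCoeff D = 1 := constantCoeff_den hq _ _ _ _ hw _
    have hacc₃ : Holds s₃.fld (inp.m + 1) inp.m acc := hacc.congr fun x hx1 hx2 =>
      hm₃.frame x (by omega) (Or.inl (by omega))
    refine Runs.seq (T₁ := unitTime inp) (T₂ := 5)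
      (Runs.callMul rfl (P := inp.m + 1)
        (Y := topBlock inp * (inp.m + 1) + q * (inp.m + 1) + 1)
        (y := PowerSeries.mk fun i => coeff (i + 1) D) rfl ?_ hacc₃ (fun t ht => ?_)
        (fun t ht => by omega) (add_mul_le_unitTime (linear_le_sq ?_))) ?_ (by omega)
    · simp [IExp.eval, hr10]
    · rw [coeff_mk, add_assoc, add_comm 1 t]
      exact hm₃.den (t + 1) ht
    · simp only [blk_cost, IExp.cost, stride_cost]
      omega
    intro s₄ hu₄
    rw [one_add_X_mul_shift hD1] at hu₄
    -- `Inv.congr` does not apply, since the accumulator lies below `topBlock`; it is however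
    -- disjoint from the blocks of weights and matrix entries.
    have hI₄ : Inv inp (verticesFrom inp.n i) (uniformWeight q inp.n) s₄ := by
      refine ⟨fun v => by rw [hu₄.mem, hm₃.inv.base], fun v => by rw [hu₄.mem, hm₃.inv.flag],
        fun v c => (hm₃.inv.weight v c).congr fun x hx1 hx2 => hu₄.frame x ?_,
        fun c c' => (hm₃.inv.mat c c').congr fun x hx1 hx2 => hu₄.frame x ?_⟩
      · have := le_weightBlock (q := q) (inp := inp) v c
        omega
      · have : (2 + (c * q + c')) * (inp.m + 1) =
            2 * (inp.m + 1) + (c * q + c') * (inp.m + 1) := by ring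
        omega
    have h9' : s₄.reg 9 = i := by rw [hu₄.reg 9 (by omega), hr9]
    refine Runs.setMem (by simp [IExp.cost]) ⟨h9', by simp, ?_, ?_, acc * D, hu₄.holds, ?_, ?_⟩
    · simp only
      rw [Function.update_of_ne (by omega), hu₄.reg 10 (by omega), hr10]
    · have := hI₄.setFlag (U' := verticesFrom inp.n (i + 1)) u 1 fun v => by
        rw [← herase]
        by_cases hv : v = u <;> simp [hv]
      simp only [IExp.eval, h9']
      exact this.congr rfl fun _ _ => rfl
    · rw [map_mul, hacc1, hD1, one_mul]
    -- Depth `m` is what yields accuracy $X^{m+1}$.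
    · have h1 := X_pow_dvd_den (G := G) (ha := ha) hq inp.nbrs hn inp.m (verticesFrom inp.n i)
        (uniformWeight q inp.n) hw u huU
      rw [herase] at h1
      have key : acc * D * partition G ha (verticesFrom inp.n (i + 1)) (uniformWeight q inp.n) -
          partition G ha Finset.univ (uniformWeight q inp.n) =
          acc * (D * partition G ha (verticesFrom inp.n (i + 1)) (uniformWeight q inp.n) -
            partition G ha (verticesFrom inp.n i) (uniformWeight q inp.n)) +
          (acc * partition G ha (verticesFrom inp.n i) (uniformWeight q inp.n) -
            partition G ha Finset.univ (uniformWeight q inp.n)) := by ring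
      rw [key]
      exact dvd_add (h1.mul_left _) hdvd
  · rintro s' ⟨-, h10, -, acc, hacc, hacc1, hdvd⟩
    have hempty : verticesFrom inp.n inp.n = ∅ := by
      ext v
      have := v.2
      simp only [verticesFrom, Finset.mem_filter, Finset.mem_univ, true_and, Finset.notMem_empty,
        iff_false]
      omega
    rw [hempty, partition_empty hq, mul_one] at hdvd
    exact ⟨h10, acc, hacc, hacc1, hdvd⟩
  · refine le_trans ?_ hT
    simp only [IExp.cost]
    have : inp.n * (T + unitTime inp + 30 + 1 + 6) ≤ inp.n * (T + 2 * unitTime inp) :=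
      Nat.mul_le_mul_left _ (by omega)
    omega

/-- Natural numbers cannot be converted to complex ones, so a table of $0,\dots,m$ is built in the
free space from `B` on. It serves twice: to form the coefficients $i\,f_i$ of $Xf'$, with $f$ the
accumulated series, and, after division by $f$, to divide by $i$. Coefficient 0 of `r` vanishes and
is left as it is. -/
theorem Runs.logStmt {s : State} {acc : ℂ⟦X⟧} (hacc : Holds s.fld (inp.m + 1) inp.m acc)
    (hacc1 : constantCoeff acc = 1) (h10 : s.reg 10 = topBlock inp * (inp.m + 1)) {r : ℂ⟦X⟧}
    (hr : r * acc = X * PowerSeries.derivative ℂ acc) {T : ℕ} (hT : 5 * unitTime inp ≤ T) :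
    Runs inp (procedures q) AlgRAM.logStmt s T fun s' =>
      s'.fld 0 = 0 ∧ ∀ i, 1 ≤ i → i ≤ inp.m → s'.fld i = coeff i r / i := by
  have hW : ∀ K ≤ 200, K * (inp.m + 1) ^ 2 ≤ unitTime inp := fun K hK =>
    mul_le_unitTime (hK.trans (Nat.le_mul_of_pos_right _ (by positivity)))
  have hWm : ∀ K ≤ 200, K * (inp.m + 1) ≤ unitTime inp := fun K hK =>
    (Nat.mul_le_mul_left K (Nat.le_self_pow (by omega) _)).trans (hW K hK)
  have hW1 : 100 ≤ unitTime inp := const_le_unitTime (by omega)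
  have h2q : topBlock inp * (inp.m + 1) =
      2 * (inp.m + 1) + (q * q + inp.n * q) * (inp.m + 1) := by
    unfold topBlock; ring
  set B := topBlock inp * (inp.m + 1) with hB
  refine Runs.seq (T₁ := unitTime inp) (T₂ := 4 * unitTime inp)
    (Q₁ := fun s' => s' = { s with fld := Function.update s.fld B 0 })
    (Runs.setFld (by simp [IExp.cost, FExp.cost]; omega) trivial
      (by simp [IExp.eval, FExp.eval, h10])) ?_ (by omega)
  rintro _ rfl
  refine Runs.seq (T₁ := unitTime inp) (T₂ := 3 * unitTime inp)
    (Q₁ := fun s' => s'.reg 10 = B ∧ Holds s'.fld (inp.m + 1) inp.m acc ∧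
      ∀ i ≤ inp.m, s'.fld (B + i) = i)
    (Runs.fill (N := inp.m) (d := B + 1) (fun i => (i : ℂ) + 1) (fun _ _ => rfl) ?_ ?_ ?_ ?_) ?_
    (by omega)
  · intro i f
    simp [IExp.eval, h10]
    omega
  · intro i hi
    refine ⟨⟨trivial, trivial⟩, ?_⟩
    have haddr : ∀ f, (IExp.add (.reg 10) (.reg 6)).eval inp
        ⟨Function.update s.reg 6 i, s.mem, f⟩ = B + i := fun f => by simp [IExp.eval, h10]
    simp only [FExp.eval, haddr]
    congr 1
    rcases Nat.eq_zero_or_pos i with rfl | hi0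
    · simp [write_zero]
    · obtain ⟨j, rfl⟩ : ∃ j, i = j + 1 := ⟨i - 1, by omega⟩
      rw [show B + (j + 1) = B + 1 + j by omega, write_add _ _ _ _ _ (by omega)]
      push_cast
      ring
  · refine ⟨by simp [h10], hacc.congr fun x hx1 hx2 => ?_, fun i hi => ?_⟩
    · simp only
      rw [write_of_notMem _ _ _ _ _ (by omega), Function.update_of_ne (by omega)]
    · simp only
      rcases Nat.eq_zero_or_pos i with rfl | hi0
      · rw [write_of_notMem _ _ _ _ _ (by omega)]
        simp
      · obtain ⟨j, rfl⟩ : ∃ j, i = j + 1 := ⟨i - 1, by omega⟩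
        rw [show B + (j + 1) = B + 1 + j by omega, write_add _ _ _ _ _ (by omega)]
        push_cast
        ring
  · refine le_trans ?_ (hWm 100 (by omega))
    simp only [IExp.cost, FExp.cost]
    nlinarith
  rintro s₂ ⟨h10, hacc, hidx⟩
  refine Runs.seq (T₁ := unitTime inp) (T₂ := 2 * unitTime inp)
    (Runs.fillBlock (d := 0) (p := r * acc) ?_ ?_ ?_) ?_ (by omega)
  · intro i f
    simp [IExp.eval]
  · intro i hi s' h6 hr' hm' hf' _ _
    refine ⟨by simp [FExp.Defined], ?_⟩
    have e1 : (cell (.reg 10) 0).eval inp s' = B + i := by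
      simp only [cell_eval, IExp.eval, h6, hr' 10 (by omega), h10]
      omega
    have e2 : (cell stride 0).eval inp s' = inp.m + 1 + i := by
      simp only [cell_eval, stride_eval, h6]
      omega
    simp only [FExp.eval, e1, e2]
    rw [hf' _ (by omega), hf' _ (by omega), hidx i hi, hacc i hi, hr]
    rcases Nat.eq_zero_or_pos i with rfl | hi0
    · simp
    · obtain ⟨j, rfl⟩ : ∃ j, i = j + 1 := ⟨i - 1, by omega⟩
      rw [coeff_succ_X_mul, coeff_derivative]
      push_cast
      ring
  · refine le_trans (Nat.mul_le_mul_right _ ?_) (hW 200 le_rfl)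
    simp only [IExp.cost, FExp.cost, cell_cost, stride_cost]
    omega
  intro s₃ hu₃
  have h10₃ : s₃.reg 10 = B := by rw [hu₃.reg 10 (by omega), h10]
  have hcur := hu₃.holds
  rw [← one_add_X_mul_shift hacc1] at hcur
  refine Runs.seq (T₁ := unitTime inp) (T₂ := unitTime inp)
    (Runs.callDiv rfl (P := 0) (Y := inp.m + 1 + 1) rfl rfl hcur (fun t ht => ?_)
      (fun t ht => by omega) (add_mul_le_unitTime (linear_le_sq ?_))) ?_ (by omega)
  · rw [coeff_mk, hu₃.frame _ (by omega), add_assoc (inp.m + 1), add_comm 1 t]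
    exact hacc (t + 1) ht
  · simp only [IExp.cost, stride_cost]
    omega
  intro s₄ hu₄
  have h10₄ : s₄.reg 10 = B := by rw [hu₄.reg 10 (by omega), h10₃]
  have hidx₄ : ∀ i ≤ inp.m, s₄.fld (B + i) = i := fun i hi => by
    rw [hu₄.frame _ (by omega), hu₃.frame _ (by omega), hidx i hi]
  have hr0 : coeff 0 r = 0 := by
    have := congrArg constantCoeff hr
    rw [map_mul, hacc1, mul_one] at this
    simpa using this
  refine Runs.fill (N := inp.m) (d := 1) (fun i => coeff (i + 1) r / ((i + 1 : ℕ) : ℂ))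
    (fun _ _ => rfl) ?_ ?_ ⟨?_, ?_⟩ ?_
  · intro i f
    simp [IExp.eval]
    omega
  · intro i hi
    have e1 : ∀ f, (IExp.add (.reg 6) (.const 1)).eval inp
        ⟨Function.update s₄.reg 6 i, s₄.mem, f⟩ = i + 1 := fun f => by simp [IExp.eval]
    have e2 : ∀ f, (IExp.add (.reg 10) (.add (.reg 6) (.const 1))).eval inp
        ⟨Function.update s₄.reg 6 i, s₄.mem, f⟩ = B + (i + 1) := fun f => by
      simp [IExp.eval, h10₄]
    have hne : ((i + 1 : ℕ) : ℂ) ≠ 0 := by exact_mod_cast i.succ_ne_zero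
    have v1 : write s₄.fld 1 i (fun i => coeff (i + 1) r / ((i + 1 : ℕ) : ℂ)) (i + 1) =
        coeff (i + 1) r := by
      rw [write_of_notMem _ _ _ _ _ (by omega)]
      have := hu₄.holds (i + 1) hi
      rwa [zero_add] at this
    have v2 : write s₄.fld 1 i (fun i => coeff (i + 1) r / ((i + 1 : ℕ) : ℂ)) (B + (i + 1)) =
        ((i + 1 : ℕ) : ℂ) := by
      rw [write_of_notMem _ _ _ _ _ (by omega), hidx₄ (i + 1) hi]
    refine ⟨⟨trivial, trivial, ?_⟩, ?_⟩
    · simp only [FExp.eval, e2, v2]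
      exact hne
    · simp only [FExp.eval, e1, e2, v1, v2]
  · simp only
    rw [write_of_notMem _ _ _ _ _ (by omega), ← hr0]
    exact hu₄.holds 0 (by omega)
  · intro i hi1 hi2
    obtain ⟨j, rfl⟩ : ∃ j, i = j + 1 := ⟨i - 1, by omega⟩
    simp only
    rw [add_comm j 1, write_add _ _ _ _ _ (by omega), add_comm 1 j]
  · refine le_trans ?_ (hWm 100 (by omega))
    simp only [IExp.cost, FExp.cost]
    nlinarith

theorem program_runs (hq : q ≠ 0) {G : SimpleGraph (Fin inp.n)} [DecidableRel G.Adj]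
    (hn : IsAdjList G inp.nbrs) (ha : inp.offset.IsSymm) {Δ : ℕ} (hΔ1 : 1 ≤ Δ)
    (hΔ : ∀ u, (inp.nbrs u).length ≤ Δ) (hn1 : 1 ≤ inp.n) :
    Runs inp (program q).procs (program q).main State.init
      (60 * (q + 1) ^ 2 * (inp.n * Δ * (2 * (q + 1) * Δ) ^ inp.m * unitTime inp)) fun s =>
      ∃ acc r : ℂ⟦X⟧,
        X ^ (inp.m + 1) ∣ acc - partition G ha Finset.univ (uniformWeight q inp.n) ∧
        r * acc = X * PowerSeries.derivative ℂ acc ∧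
        s.fld 0 = 0 ∧ ∀ i, 1 ≤ i → i ≤ inp.m → s.fld i = coeff i r / i := by
  have hW : 100 ≤ unitTime inp := const_le_unitTime (by omega)
  set W := unitTime inp with hWdef
  set Tm := 20 * (q + 1) ^ 2 * Δ * W * (2 * (q + 1) * Δ) ^ inp.m with hTm
  refine Runs.seq (T₁ := inp.n * ((q + 2) * W) + W)
    (T₂ := q * (q * W + 1) + 1 + (W + (inp.n * (Tm + 2 * W) + 10 + 5 * W)))
    (Runs.initVertices hq le_rfl _) ?_ ?_
  · rintro s₁ ⟨h10, hm, hm', hF⟩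
    refine Runs.seq (Runs.initMatrix hF _) ?_ le_rfl
    rintro s₂ ⟨hr₂, hm₂, F, hF₂, ha₂, hb₂⟩
    refine Runs.seq (T₁ := W) (T₂ := inp.n * (Tm + 2 * W) + 10 + 5 * W)
      (Q₁ := fun s' => s' = { s₂ with fld := Function.update s₂.fld (1 * (inp.m + 1)) 1 })
      (Runs.setFld (by simp [FExp.cost]; omega) trivial (by simp [FExp.eval])) ?_ le_rfl
    rintro _ rfl
    have hF₃ := hF₂.update 1 1
    have hI : Inv inp Finset.univ (uniformWeight q inp.n)
        { s₂ with fld := Function.update s₂.fld (1 * (inp.m + 1)) 1 } := by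
      refine ⟨fun u => ?_, fun u => ?_, fun u c => ?_, fun c c' => ?_⟩
      · simp only
        rw [hm₂, hm u u.2]
      · simp only
        rw [hm₂, hm' _ (by omega), if_pos (Finset.mem_univ u)]
      · have h1 := hF₃ (weightBlock q u c)
        have h2 := mul_add_lt_mul u.2 c.2
        have h3 : 2 + q * q ≤ weightBlock q u c ∧ weightBlock q u c < topBlock inp := by
          unfold weightBlock topBlock
          omega
        rw [Function.update_of_ne (by omega), hb₂ _ (by omega), if_pos h3] at h1
        exact h1
      · have h1 := hF₃ (2 + (c * q + c'))
        rw [Function.update_of_ne (by omega), ha₂] at h1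
        exact h1
    have hacc := hF₃ 1
    rw [Function.update_self, map_one, one_mul] at hacc
    refine Runs.seq (Runs.rootLoop hq hn ha (margSpec hq hΔ1 hΔ inp.m) hI
      (by simpa using hacc) (by rw [← h10, ← hr₂]) le_rfl) ?_ le_rfl
    rintro s₃ ⟨h10₃, acc, hacc, hacc1, hdvd⟩
    have hr : X * PowerSeries.derivative ℂ acc * acc⁻¹ * acc =
        X * PowerSeries.derivative ℂ acc := by
      rw [mul_assoc, PowerSeries.inv_mul_cancel _ (by simp [hacc1]), mul_one]
    refine (Runs.logStmt hacc hacc1 h10₃ hr le_rfl).mono le_rfl ?_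
    rintro s₄ ⟨h0, hi⟩
    exact ⟨acc, _, hdvd, hr, h0, hi⟩
  · set Y := (2 * (q + 1) * Δ) ^ inp.m with hY
    have hY1 : 1 ≤ Y := Nat.one_le_pow _ _ (by positivity)
    -- All summands of the running time are compared with multiples of `Z`.
    set Z := inp.n * Δ * Y * W with hZ
    have hnY : inp.n ≤ inp.n * Δ * Y := by
      rw [mul_assoc]
      exact Nat.le_mul_of_pos_right _ (by positivity)
    have h1 : inp.n * W ≤ Z := Nat.mul_le_mul_right _ hnY
    have h2 : W ≤ Z := Nat.le_mul_of_pos_left _ (by omega)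
    have h3 : inp.n * Tm = 20 * (q + 1) ^ 2 * Z := by rw [hTm, hZ]; ring
    have e1 : inp.n * ((q + 2) * W) = (q + 2) * (inp.n * W) := by ring
    have e2 : inp.n * (Tm + 2 * W) = 20 * (q + 1) ^ 2 * Z + 2 * (inp.n * W) := by
      rw [mul_add, h3]; ring
    have e3 : q * (q * W + 1) = q * q * W + q := by ring
    rw [e1, e2, e3]
    have f1 : (q + 2) * (inp.n * W) ≤ (q + 2) * Z := Nat.mul_le_mul_left _ h1
    have f2 : q * q * W ≤ q * q * Z := Nat.mul_le_mul_left _ h2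
    have f3 : q ≤ q * Z := Nat.le_mul_of_pos_right _ (by omega)
    have f4 : 60 * (q + 1) ^ 2 * Z = 20 * (q + 1) ^ 2 * Z + (40 * (q * q * Z) + 80 * (q * Z) +
      40 * Z) := by ring
    have f5 : (q + 2) * Z = q * Z + 2 * Z := by ring
    omega

end

end AlgRAM

/-! ### The final time bound and the theorem -/

theorem AlgRAM.IsAdjList.length_eq_degree {n : ℕ} {G : SimpleGraph (Fin n)} [DecidableRel G.Adj]
    {nbrs : Fin n → List (Fin n)} (h : AlgRAM.IsAdjList G nbrs) (u : Fin n) :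
    (nbrs u).length = G.degree u := by
  rw [← List.toFinset_card_of_nodup (h u).1, ← SimpleGraph.card_neighborFinset_eq_degree]
  congr 1
  ext v
  simp [(h u).2]

/-- The base is enlarged by $2\le e$, and $(m+1)^2\le 4m^3$ because $m\ge 1$; the constant is
$60\cdot 200\cdot 4$. -/
theorem AlgRAM.time_bound_le (q n Δ m : ℕ) (hm : 1 ≤ m) :
    ((60 * (q + 1) ^ 2 * (n * Δ * (2 * (q + 1) * Δ) ^ m * (200 * (q + 1) ^ 2 * (m + 1) ^ 2)) : ℕ) :
      ℝ) ≤ 48000 * ((q : ℝ) + 1) ^ 4 *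
        ((n : ℝ) * Δ * (Real.exp 1 * ((q : ℝ) + 1) * Δ) ^ m * (m : ℝ) ^ 3) := by
  have he : (2 : ℝ) ≤ Real.exp 1 := by
    have := Real.add_one_le_exp (1 : ℝ)
    linarith
  have hm' : (1 : ℝ) ≤ m := by exact_mod_cast hm
  have h1 : (2 * ((q : ℝ) + 1) * Δ) ^ m ≤ (Real.exp 1 * ((q : ℝ) + 1) * Δ) ^ m := by gcongr
  have h2 : ((m : ℝ) + 1) ^ 2 ≤ 4 * (m : ℝ) ^ 3 := by
    calc ((m : ℝ) + 1) ^ 2 ≤ (2 * m) ^ 2 := by gcongr; linarith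
      _ = 4 * (m : ℝ) ^ 2 * 1 := by ring
      _ ≤ 4 * (m : ℝ) ^ 2 * m := by gcongr
      _ = 4 * (m : ℝ) ^ 3 := by ring
  push_cast
  calc 60 * ((q : ℝ) + 1) ^ 2 *
        ((n : ℝ) * Δ * (2 * ((q : ℝ) + 1) * Δ) ^ m * (200 * ((q : ℝ) + 1) ^ 2 * ((m : ℝ) + 1) ^ 2))
      = 12000 * ((q : ℝ) + 1) ^ 4 * ((n : ℝ) * Δ) *
        ((2 * ((q : ℝ) + 1) * Δ) ^ m * ((m : ℝ) + 1) ^ 2) := by ring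
    _ ≤ 12000 * ((q : ℝ) + 1) ^ 4 * ((n : ℝ) * Δ) *
        ((Real.exp 1 * ((q : ℝ) + 1) * Δ) ^ m * (4 * (m : ℝ) ^ 3)) := by gcongr
    _ = _ := by ring

theorem mainTheorem5 (q : ℕ) (hq : 2 ≤ q) :
    ∃ (P : AlgRAM.Program) (C : ℝ),
      ∀ (A : Matrix (Fin q) (Fin q) ℂ) (hA : A.IsSymm)
        (n : ℕ) (G : SimpleGraph (Fin n)) [DecidableRel G.Adj] (nbrs : Fin n → List (Fin n))
        (Δ m : ℕ), 1 ≤ n → 1 ≤ Δ → 1 ≤ m → (∀ v, G.degree v ≤ Δ) → AlgRAM.IsAdjList G nbrs →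
        ∃ t : ℕ,
          P.Computes ⟨n, nbrs, m, A⟩ t (taylorPoly (fun x => Complex.log (homPoly G A hA x)) m) ∧
          (t : ℝ) ≤ C * ((n : ℝ) * Δ * (Real.exp 1 * ((q : ℝ) + 1) * Δ) ^ m * (m : ℝ) ^ 3) := by
  refine ⟨AlgRAM.program q, 48000 * ((q : ℝ) + 1) ^ 4, ?_⟩
  intro A hA n G _ nbrs Δ m hn hΔ hm hdeg hadj
  have hq0 : q ≠ 0 := by omega
  have ha : (A - onesMatrix q).IsSymm :=
    hA.sub (Matrix.IsSymm.ext fun i j => by simp [onesMatrix])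
  obtain ⟨t, s, hexec, ht, acc, r, hacc, hr, h0, hl⟩ :=
    AlgRAM.program_runs (inp := ⟨n, nbrs, m, A⟩) hq0 hadj ha hΔ
      (fun u => (hadj.length_eq_degree u).trans_le (hdeg u)) hn
  refine ⟨t, ⟨s, hexec, ?_⟩, ?_⟩
  · have hp := PartitionSeries.homPolynomial_eval_zero G hq0 ha
    have hacc' : PowerSeries.X ^ (m + 1) ∣
        acc - (PartitionSeries.homPolynomial G ha : PowerSeries ℂ) := by
      rw [PartitionSeries.coe_homPolynomial]
      exact hacc
    have := PartitionSeries.taylorPoly_log_eq _ hp m acc r hacc' hr s.fld h0 hl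
    simp only [PartitionSeries.homPolynomial_eval G hA ha] at this
    exact this.symm
  · exact le_trans (by exact_mod_cast ht) (AlgRAM.time_bound_le q n Δ m hm)
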